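/- All functions are real-valued, Lebesgue measurable on $(0,\infty)$, identified when equal almost everywhere; $m$ is Lebesgue measure. For such $x$ let $x^*(t)=\inf\{s\ge 0: m(\{|x|>s\})\le t\}$ be its non-increasing right-continuous rearrangement, and write $y\prec\prec x$ if $\int_0^t y^*(s)\,ds\le\int_0^t x^*(s)\,ds$ for all $t\ge 0$. Let $(\sigma_s f)(t)=f(t/s)$ for $s>0$. A Banach space $E$ of such functions is an ideal lattice if $x\in E$ and $|y|\le|x|$ imply $y\in E$ and $\|y\|_E\le\|x\|_E$. It is symmetric if, moreover, every $x\in E$ satisfies $m(\{|x|>s\})<\infty$ for some $s$, and $x\in E$, $y^*=x^*$ imply $y\in E$ and $\|y\|_E=\|x\|_E$. It is fully symmetric if, moreover, $x\in E$, $y\in L_1+L_\infty$, $y\prec\prec x$ imply $y\in E$ and $\|y\|_E\le\|x\|_E$. Its norm is a Fatou norm if $0\le x_n\uparrow x\in E$ a.e. implies $\|x_n\|_E\uparrow\|x\|_E$. For $x\in E$ put $$\Omega_+(x)=\{0\le y\in L_1+L_\infty:\ y\prec\prec x\},\qquad \varphi(x)=\lim_{s\to\infty}\frac1s\|\sigma_s(x^*)\|_E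 .$$ **Theorem.** Let $E$ be a fully symmetric space on $(0,\infty)$ with $E\not\subseteq L_1$, and let $x\in E$. If $\varphi(x)=0$, then $\Omega_+(x)$ is the $\|\cdot\|_E$-closed convex hull of its extreme points. If, in addition, the norm of $E$ is a Fatou norm, then the converse also holds: if $\Omega_+(x)$ is the $\|\cdot\|_E$-closed convex hull of its extreme points, then $\varphi(x)=0$. -/

import Mathlib

namespace SymmetricOrbit

open MeasureTheory Set Filter Topology
open scoped ENNReal

/-- Lebesgue measure on the semi-axis `(0, ∞)`. -/
noncomputable abbrev semiAxis : Measure ℝ := volume.restrict (Ioi (0 : ℝ))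

/-- Real-valued Lebesgue measurable functions on `(0, ∞)`, modulo equality a.e. -/
abbrev L0 : Type := ℝ →ₘ[semiAxis] ℝ

/-- The functions whose distribution function `s ↦ m {|x| > s}` is finite at some `s`. -/
def S0 : Set L0 :=
  {x | ∃ s : ℝ, semiAxis {t | s < |x t|} < ∞}

/-- `L₁(0, ∞)`. -/
def L1 : Set L0 := {x | MemLp x 1 semiAxis}

/-- `L_∞(0, ∞)`. -/
def LInfty : Set L0 := {x | MemLp x ∞ semiAxis}

/-- `L₁ + L_∞`. -/
def L1AddLInfty : Set L0 := {x | ∃ f ∈ L1, ∃ g ∈ LInfty, x = f + g}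

/-- The non-increasing right-continuous rearrangement
`x^*(t) = inf {s ≥ 0 : m {|x| > s} ≤ t}`, with values in `[0, ∞]`, for `t ≥ 0`.
(Replacing `|x| > s` by `|x| ≥ s` does not change the infimum.) -/
noncomputable def rearrangement (x : L0) (t : ℝ) : ℝ≥0∞ :=
  sInf {s : ℝ≥0∞ | semiAxis {u | s < ‖x u‖ₑ} ≤ ENNReal.ofReal t}

theorem rearrangement_antitone (x : L0) : Antitone (rearrangement x) := by
  intro a b hab
  refine sInf_le_sInf ?_
  intro s hs
  exact le_trans hs (ENNReal.ofReal_le_ofReal hab)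

/-- The dilation `(σ_τ f)(t) = f (t / τ)`. -/
noncomputable def dilation (τ : ℝ) (f : ℝ → ℝ) : ℝ → ℝ := fun t => f (t / τ)

theorem dilation_rearrangement_measurable (τ : ℝ) (x : L0) :
    AEStronglyMeasurable (dilation τ fun t => (rearrangement x t).toReal) semiAxis :=
  ((rearrangement_antitone x).measurable.ennreal_toReal.comp
    (measurable_id.div_const τ)).aestronglyMeasurable

/-- The function `σ_τ (x^*)`, as an element of `L0`. (For `x` in `S0` the rearrangement is finite
on `(0, ∞)`, so that passing from `[0, ∞]` to `ℝ` loses nothing.) -/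
noncomputable def dilatedRearrangement (τ : ℝ) (x : L0) : L0 :=
  AEEqFun.mk (dilation τ fun t => (rearrangement x t).toReal)
    (dilation_rearrangement_measurable τ x)

/-- Submajorization in the sense of Hardy, Littlewood and Polya: `y ≺≺ x`. -/
def Submajorized (y x : L0) : Prop :=
  ∀ t : ℝ, 0 ≤ t →
    ∫⁻ s in Ioc 0 t, rearrangement y s ≤ ∫⁻ s in Ioc 0 t, rearrangement x s

/-- `Ω₊(x) = {0 ≤ y ∈ L₁ + L_∞ : y ≺≺ x}`. -/
def OmegaPlus (x : L0) : Set L0 :=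
  {y | 0 ≤ y ∧ y ∈ L1AddLInfty ∧ Submajorized y x}

/-- A Banach space of (classes of) real measurable functions on `(0, ∞)` which is an ideal lattice.
The value of `norm` matters on `carrier` only. -/
structure BanachIdealLattice where
  carrier : Submodule ℝ L0
  norm : L0 → ℝ
  norm_nonneg : ∀ x ∈ carrier, 0 ≤ norm x
  eq_zero_of_norm_eq_zero : ∀ x ∈ carrier, norm x = 0 → x = 0
  norm_smul : ∀ (c : ℝ), ∀ x ∈ carrier, norm (c • x) = |c| * norm x
  norm_add_le : ∀ x ∈ carrier, ∀ y ∈ carrier, norm (x + y) ≤ norm x + norm y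
  complete : ∀ u : ℕ → L0, (∀ n, u n ∈ carrier) →
    (∀ ε : ℝ, 0 < ε → ∃ N, ∀ m ≥ N, ∀ n ≥ N, norm (u m - u n) < ε) →
    ∃ x ∈ carrier, Tendsto (fun n => norm (u n - x)) atTop (𝓝 0)
  solid : ∀ x ∈ carrier, ∀ y : L0, |y| ≤ |x| → y ∈ carrier ∧ norm y ≤ norm x

namespace BanachIdealLattice

variable (E : BanachIdealLattice)

/-- `E` is a symmetric space. -/
def IsSymmetric : Prop :=
  (∀ x ∈ E.carrier, x ∈ S0) ∧
  ∀ x ∈ E.carrier, ∀ y : L0, (∀ t : ℝ, 0 < t → rearrangement y t = rearrangement x t) →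
    y ∈ E.carrier ∧ E.norm y = E.norm x

/-- `E` is a fully symmetric space. -/
def IsFullySymmetric : Prop :=
  E.IsSymmetric ∧
  ∀ x ∈ E.carrier, ∀ y ∈ L1AddLInfty, Submajorized y x → y ∈ E.carrier ∧ E.norm y ≤ E.norm x

/-- The norm of `E` is a Fatou norm: `0 ≤ xₙ ↑ x ∈ E` a.e. implies `‖xₙ‖ ↑ ‖x‖`. -/
def IsFatouNorm : Prop :=
  ∀ (u : ℕ → L0) (x : L0), x ∈ E.carrier → (∀ n, 0 ≤ u n) → Monotone u →
    (∀ᵐ t ∂semiAxis, Tendsto (fun n => u n t) atTop (𝓝 (x t))) →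
    Tendsto (fun n => E.norm (u n)) atTop (𝓝 (E.norm x))

/-- `φ(x) = l`, where `φ(x) = lim_{s → ∞} ‖σ_s (x^*)‖ / s`. -/
def DilationFunctionalEq (x : L0) (l : ℝ) : Prop :=
  Tendsto (fun s : ℝ => (1 / s) * E.norm (dilatedRearrangement s x)) atTop (𝓝 l)

/-- The closure of a subset in the norm of `E`. -/
def normClosure (A : Set L0) : Set L0 :=
  {y | y ∈ E.carrier ∧ ∀ ε : ℝ, 0 < ε → ∃ z ∈ A, z ∈ E.carrier ∧ E.norm (y - z) < ε}

/-- `Q₊(x)`: the norm-closed convex hull of the extreme points of `Ω₊(x)`. -/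
def QPlus (x : L0) : Set L0 :=
  E.normClosure (convexHull ℝ ((OmegaPlus x).extremePoints ℝ))

end BanachIdealLattice

end SymmetricOrbit

/-! The order `≺≺` is governed by the excess Φ_e(s) = ∫ (e - s)⁺, a decreasing convex function of
the level s that depends only on the distribution of e. For x in `S0`, y ≺≺ x means Φ_|y| ≤ Φ_|x|
(`submajorized_iff`), and the norm, extended to [0, ∞]-valued functions, is monotone with respect to
excess (`extNorm_le_of_excess_le`). The normalized dilation τ⁻¹σ_τ turns Φ(s) into Φ(τs)
(`excess_spread`), so φ(x) measures what survives of x when its mass is spread thinner and thinner.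
Let c be the limit of x* at infinity (`asymptote`).

Sufficiency. A nonnegative z with Φ_z = Φ_|x| above c and values in {0} ∪ [c, ∞) is extreme
(`mem_extremePoints_of_excess_eq`). Given y in the orbit, round (y - c)⁺ down to countably many
levels and cut x* - c into windows whose averages are those levels, plus a remainder
(`exists_windows`). Chopping every window into N pieces and permuting them cyclically over N equal
cells of the corresponding level set gives N equimeasurable functions whose mean is nearly the level
(`exists_averaging_family`). The remainder is parked on a set of infinite measure; N such sets
partition the half-line, so each point is spoiled by only one of them. Every error is either O(1/N)
times |y| or the constant c, or is dominated in excess by x* dilated by N and divided by N; the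
latter tends to zero in norm because φ(x) = 0. The other inclusion holds since the orbit is convex
and norm closed (`normClosure_omegaPlus_subset`).

Necessity. At levels where Φ_z < Φ_|x|, an extreme z can take no values, as small equal masses could
be moved up and down (`exists_forall_not_abs_sub_lt`); comparing an affine with a convex function
then shows that equality at one level persists at all higher ones (`excess_eq_of_le`). So an extreme
point either carries all of the high excess of x or is at most c; if c = 0, it either has all the
excess of x or is integrable. If φ(x) = 0 fails, then either the peaks (x* - σ)⁺ have non-small
dilations for every σ, or c = 0, x* is not integrable and all its tails have non-small dilations;
here E ⊄ L₁ enters (`exists_extNorm_spread_le`). In either case averaging x* over suitable blocks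
gives a y in the orbit that is small compared with levels above which x* still has much norm, a
choice made possible by the Fatou property. Suppose y is close to a finite convex combination of
extreme points. If those carrying the full excess have weight at least 1/2, they force values far
above y (`extNorm_spread_le_four_mul`); otherwise the integral of the combination over an initial
interval falls short of that of y. -/

namespace SymmetricOrbit

open MeasureTheory Set Filter Topology
open scoped ENNReal

/-! ### The excess functional `∫ (e - s)⁺` -/

/-- `∫ (e - s)⁺` over the semi-axis. -/
noncomputable def excess (e : ℝ → ℝ≥0∞) (s : ℝ≥0∞) : ℝ≥0∞ := ∫⁻ t, (e t - s) ∂semiAxis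

theorem excess_mono_ae {e e' : ℝ → ℝ≥0∞} (h : ∀ᵐ t ∂semiAxis, e t ≤ e' t) (s : ℝ≥0∞) :
    excess e s ≤ excess e' s :=
  lintegral_mono_ae (h.mono fun _ ht => tsub_le_tsub_right ht s)

theorem excess_congr_ae {e e' : ℝ → ℝ≥0∞} (h : ∀ᵐ t ∂semiAxis, e t = e' t) (s : ℝ≥0∞) :
    excess e s = excess e' s :=
  lintegral_congr_ae (h.mono fun t ht => by simp only [ht])

theorem excess_antitone (e : ℝ → ℝ≥0∞) : Antitone (excess e) := fun _ _ h =>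
  lintegral_mono fun _ => tsub_le_tsub_left h _

theorem excess_zero_right (e : ℝ → ℝ≥0∞) : excess e 0 = ∫⁻ t, e t ∂semiAxis := by
  simp [excess]

theorem excess_tsub (e : ℝ → ℝ≥0∞) (c s : ℝ≥0∞) :
    excess (fun t => e t - c) s = excess e (c + s) := by
  simp only [excess, tsub_tsub]

theorem excess_const_mul (e : ℝ → ℝ≥0∞) {c : ℝ≥0∞} (hc : c ≠ ∞) (s : ℝ≥0∞) :
    excess (fun t => c * e t) (c * s) = c * excess e s := by
  unfold excess
  rw [← lintegral_const_mul' c _ hc]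
  refine lintegral_congr fun t => ?_
  rw [ENNReal.mul_sub (fun _ _ => hc)]

theorem excess_const_mul' (e : ℝ → ℝ≥0∞) {c : ℝ≥0∞} (hc0 : c ≠ 0) (hc : c ≠ ∞) (s : ℝ≥0∞) :
    excess (fun t => c * e t) s = c * excess e (c⁻¹ * s) := by
  rw [← excess_const_mul e hc, ← mul_assoc, ENNReal.mul_inv_cancel hc0 hc, one_mul]

/-- The level is split along with the function, so that a small error is absorbed by a small shift
of the level. This is how limits are taken in the closedness proof. -/
theorem excess_add_le {e e' : ℝ → ℝ≥0∞} (he : AEMeasurable e semiAxis) (s s' : ℝ≥0∞) :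
    excess (fun t => e t + e' t) (s + s') ≤ excess e s + excess e' s' := by
  unfold excess
  rw [← lintegral_add_left' (he.sub_const s)]
  exact lintegral_mono fun t => add_tsub_add_le_tsub_add_tsub

theorem tsub_convex (a b e l m : ℝ≥0∞) (h : l + m = 1) :
    e - (l * a + m * b) ≤ l * (e - a) + m * (e - b) := by
  have hl : l ≠ ∞ := fun hl => by simp [hl] at h
  have hm : m ≠ ∞ := fun hm => by simp [hm] at h
  rw [ENNReal.mul_sub (fun _ _ => hl), ENNReal.mul_sub (fun _ _ => hm)]
  calc e - (l * a + m * b) = (l * e + m * e) - (l * a + m * b) := by rw [← add_mul, h, one_mul]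
    _ ≤ _ := add_tsub_add_le_tsub_add_tsub

theorem tsub_convex_left (x y s l m : ℝ≥0∞) (h : l + m = 1) :
    (l * x + m * y) - s ≤ l * (x - s) + m * (y - s) := by
  have hl : l ≠ ∞ := fun hl => by simp [hl] at h
  have hm : m ≠ ∞ := fun hm => by simp [hm] at h
  rw [ENNReal.mul_sub (fun _ _ => hl), ENNReal.mul_sub (fun _ _ => hm)]
  calc (l * x + m * y) - s = (l * x + m * y) - (l * s + m * s) := by rw [← add_mul, h, one_mul]
    _ ≤ _ := add_tsub_add_le_tsub_add_tsub

theorem excess_convex {e : ℝ → ℝ≥0∞} (he : AEMeasurable e semiAxis) (a b l m : ℝ≥0∞)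
    (h : l + m = 1) :
    excess e (l * a + m * b) ≤ l * excess e a + m * excess e b := by
  have hl : l ≠ ∞ := fun hl => by simp [hl] at h
  have hm : m ≠ ∞ := fun hm => by simp [hm] at h
  unfold excess
  rw [← lintegral_const_mul' l _ hl, ← lintegral_const_mul' m _ hm,
    ← lintegral_add_left' ((he.sub_const a).const_mul l)]
  exact lintegral_mono fun t => tsub_convex a b (e t) l m h

theorem excess_convex_left {e e' : ℝ → ℝ≥0∞} (he : AEMeasurable e semiAxis) (s l m : ℝ≥0∞)
    (h : l + m = 1) :
    excess (fun t => l * e t + m * e' t) s ≤ l * excess e s + m * excess e' s := by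
  have hl : l ≠ ∞ := fun hl => by simp [hl] at h
  have hm : m ≠ ∞ := fun hm => by simp [hm] at h
  unfold excess
  rw [← lintegral_const_mul' l _ hl, ← lintegral_const_mul' m _ hm,
    ← lintegral_add_left' ((he.sub_const s).const_mul l)]
  exact lintegral_mono fun t => tsub_convex_left (e t) (e' t) s l m h

/-- Right continuity of the excess. -/
theorem tendsto_excess {e : ℝ → ℝ≥0∞} (he : AEMeasurable e semiAxis) (s : ℝ≥0∞)
    {u : ℕ → ℝ≥0∞} (hu : Antitone u) (hu' : Tendsto u atTop (𝓝 s)) :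
    Tendsto (fun n => excess e (u n)) atTop (𝓝 (excess e s)) := by
  refine lintegral_tendsto_of_tendsto_of_monotone (fun n => he.sub_const _) ?_ ?_
  · exact Eventually.of_forall fun t m n hmn => tsub_le_tsub_left (hu hmn) _
  · refine Eventually.of_forall fun t => ?_
    have hs : ∀ n, s ≤ u n := fun n => hu.le_of_tendsto hu' n
    by_cases hst : s = ∞
    · have : ∀ n, u n = ∞ := fun n => top_le_iff.1 (hst ▸ hs n)
      simp [hst, this]
    · exact ENNReal.Tendsto.sub tendsto_const_nhds hu' (Or.inr hst)

theorem tendsto_add_inv_nat (s : ℝ≥0∞) :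
    Tendsto (fun n : ℕ => s + ((n : ℝ≥0∞) + 1)⁻¹) atTop (𝓝 s) := by
  have h : Tendsto (fun n : ℕ => (((n + 1 : ℕ) : ℝ≥0∞))⁻¹) atTop (𝓝 0) :=
    ENNReal.tendsto_inv_nat_nhds_zero.comp (tendsto_add_atTop_nat 1)
  simpa using (tendsto_const_nhds (x := s)).add h

theorem antitone_add_inv_nat (s : ℝ≥0∞) :
    Antitone (fun n : ℕ => s + ((n : ℝ≥0∞) + 1)⁻¹) := fun m n h => by
  dsimp only
  gcongr

/-- Right continuity makes the level `s` accessible from above; in particular no comparison ever has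
to be made at level 0, where the excesses may be infinite. -/
theorem excess_le_of_forall_lt {e e' : ℝ → ℝ≥0∞} (he : AEMeasurable e semiAxis)
    (s : ℝ≥0∞) (h : ∀ r, s < r → r ≠ ∞ → excess e r ≤ excess e' r) :
    excess e s ≤ excess e' s := by
  by_cases hs : s = ∞
  · simp [hs, excess]
  refine le_of_tendsto (tendsto_excess he s (antitone_add_inv_nat s) (tendsto_add_inv_nat s))
    (Eventually.of_forall fun n => ?_)
  refine (h _ ?_ ?_).trans (excess_antitone _ le_self_add)
  · exact ENNReal.lt_add_right hs (by simp)
  · simp [hs]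

/-- Half of a Legendre duality between primitives and excess. For a decreasing function and B = (0,
t] equality holds at the level of its value at t (`excess_add_eq_primitive`). -/
theorem setLIntegral_le_excess {B : Set ℝ} (hB : B ⊆ Ioi 0)
    (e : ℝ → ℝ≥0∞) (s : ℝ≥0∞) :
    ∫⁻ t in B, e t ≤ excess e s + s * volume B := by
  calc ∫⁻ t in B, e t ≤ ∫⁻ t in B, ((e t - s) + s) := lintegral_mono fun t => le_tsub_add
    _ = (∫⁻ t in B, (e t - s)) + s * volume B := by
        rw [lintegral_add_right _ measurable_const, setLIntegral_const]
    _ ≤ _ := by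
        gcongr
        exact lintegral_mono_set hB

/-- The layer cake formula for functions with values in `[0, ∞]`. -/
theorem lintegral_eq_lintegral_meas_lt_ofReal {μ : Measure ℝ} [SFinite μ] {F : ℝ → ℝ≥0∞}
    (hF : Measurable F) :
    ∫⁻ t, F t ∂μ = ∫⁻ r in Ioi (0 : ℝ), μ {t | ENNReal.ofReal r < F t} := by
  have key : ∀ a : ℝ≥0∞, a = ∫⁻ r in Ioi (0 : ℝ), {r : ℝ | ENNReal.ofReal r < a}.indicator 1 r := by
    intro a
    rw [lintegral_indicator_one (measurableSet_lt ENNReal.measurable_ofReal measurable_const),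
      Measure.restrict_apply (measurableSet_lt ENNReal.measurable_ofReal measurable_const)]
    by_cases ha : a = ∞
    · simp [ha]
    · have : {r : ℝ | ENNReal.ofReal r < a} ∩ Ioi 0 = Ioo 0 a.toReal := by
        ext r
        simp only [mem_inter_iff, mem_ofPred_eq, mem_Ioi, mem_Ioo]
        constructor
        · rintro ⟨h1, h2⟩
          exact ⟨h2, (ENNReal.ofReal_lt_iff_lt_toReal h2.le ha).1 h1⟩
        · rintro ⟨h1, h2⟩
          exact ⟨(ENNReal.ofReal_lt_iff_lt_toReal h1.le ha).2 h2, h1⟩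
      rw [this, Real.volume_Ioo, sub_zero, ENNReal.ofReal_toReal ha]
  have hm : MeasurableSet {p : ℝ × ℝ | ENNReal.ofReal p.2 < F p.1} :=
    measurableSet_lt (ENNReal.measurable_ofReal.comp measurable_snd) (hF.comp measurable_fst)
  calc ∫⁻ t, F t ∂μ
      = ∫⁻ t, (∫⁻ r in Ioi (0 : ℝ),
          {p : ℝ × ℝ | ENNReal.ofReal p.2 < F p.1}.indicator 1 (t, r)) ∂μ :=
        lintegral_congr fun t => key (F t)
    _ = ∫⁻ r in Ioi (0 : ℝ), (∫⁻ t,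
          {p : ℝ × ℝ | ENNReal.ofReal p.2 < F p.1}.indicator 1 (t, r) ∂μ) :=
        lintegral_lintegral_swap (measurable_one.indicator hm).aemeasurable
    _ = _ := by
        refine lintegral_congr fun r => ?_
        rw [← lintegral_indicator_one (measurableSet_lt measurable_const hF)]
        rfl

theorem excess_eq_lintegral_meas_lt {e : ℝ → ℝ≥0∞} (he : Measurable e) (s : ℝ≥0∞) :
    excess e s = ∫⁻ r in Ioi (0 : ℝ), semiAxis {t | s + ENNReal.ofReal r < e t} := by
  unfold excess
  rw [lintegral_eq_lintegral_meas_lt_ofReal (he.sub_const s)]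
  simp only [lt_tsub_iff_left]

/-! ### Rearrangements -/

theorem aemeasurable_enorm (x : L0) : AEMeasurable (fun t => ‖x t‖ₑ) semiAxis :=
  x.aestronglyMeasurable.enorm

theorem measurable_enorm_L0 (x : L0) : Measurable (fun t => ‖x t‖ₑ) :=
  x.measurable.enorm

/-- The infimum defining the rearrangement is attained because the distribution function is right
continuous in the level; the resulting equivalence of strict inequalities yields equimeasurability.
-/
theorem lt_rearrangement_iff (x : L0) (t : ℝ) (s : ℝ≥0∞) :
    s < rearrangement x t ↔ ENNReal.ofReal t < semiAxis {u | s < ‖x u‖ₑ} := by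
  constructor
  · intro h
    by_contra! hle
    exact absurd (sInf_le (a := s) hle) (not_le.2 h)
  · intro h
    have hs : s ≠ ∞ := by
      rintro rfl
      simp at h
    have hU : {u | s < ‖x u‖ₑ} = ⋃ n : ℕ, {u | s + ((n : ℝ≥0∞) + 1)⁻¹ < ‖x u‖ₑ} := by
      ext u
      simp only [mem_ofPred_eq, mem_iUnion]
      constructor
      · intro hu
        exact ((tendsto_add_inv_nat s).eventually (gt_mem_nhds hu)).exists
      · rintro ⟨n, hn⟩
        exact lt_of_le_of_lt le_self_add hn
    have hmono : Monotone (fun n : ℕ => {u | s + ((n : ℝ≥0∞) + 1)⁻¹ < ‖x u‖ₑ}) :=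
      fun m n hmn u hu => lt_of_le_of_lt (antitone_add_inv_nat s hmn) hu
    rw [hU, hmono.measure_iUnion, lt_iSup_iff] at h
    obtain ⟨n, hn⟩ := h
    refine lt_of_lt_of_le (ENNReal.lt_add_right hs (by simp : ((n : ℝ≥0∞) + 1)⁻¹ ≠ 0))
      (le_sInf fun r hr => ?_)
    by_contra! hlt
    have : semiAxis {u | s + ((n : ℝ≥0∞) + 1)⁻¹ < ‖x u‖ₑ} ≤ semiAxis {u | r < ‖x u‖ₑ} :=
      measure_mono fun u hu => hlt.trans hu
    exact absurd (this.trans hr) (not_le.2 hn)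

theorem measurable_rearrangement (x : L0) : Measurable (rearrangement x) :=
  (rearrangement_antitone x).measurable

theorem semiAxis_lt_rearrangement (x : L0) (s : ℝ≥0∞) :
    semiAxis {t | s < rearrangement x t} = semiAxis {u | s < ‖x u‖ₑ} := by
  simp only [lt_rearrangement_iff]
  set d := semiAxis {u | s < ‖x u‖ₑ}
  rw [Measure.restrict_apply (measurableSet_lt ENNReal.measurable_ofReal measurable_const)]
  by_cases hd : d = ∞
  · simp [hd]
  · have : {r : ℝ | ENNReal.ofReal r < d} ∩ Ioi 0 = Ioo 0 d.toReal := by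
      ext r
      simp only [mem_inter_iff, mem_ofPred_eq, mem_Ioi, mem_Ioo]
      constructor
      · rintro ⟨h1, h2⟩
        exact ⟨h2, (ENNReal.ofReal_lt_iff_lt_toReal h2.le hd).1 h1⟩
      · rintro ⟨h1, h2⟩
        exact ⟨(ENNReal.ofReal_lt_iff_lt_toReal h1.le hd).2 h2, h1⟩
    rw [this, Real.volume_Ioo, sub_zero, ENNReal.ofReal_toReal hd]

theorem excess_rearrangement (x : L0) (s : ℝ≥0∞) :
    excess (rearrangement x) s = excess (fun t => ‖x t‖ₑ) s := by
  rw [excess_eq_lintegral_meas_lt (measurable_rearrangement x),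
    excess_eq_lintegral_meas_lt (measurable_enorm_L0 x)]
  simp only [semiAxis_lt_rearrangement]

/-- The function is real-valued, so its distribution function, once finite, tends to 0 by continuity
from above and eventually drops below any `t > 0`. -/
theorem rearrangement_ne_top {x : L0} (hx : x ∈ S0) {t : ℝ} (ht : 0 < t) :
    rearrangement x t ≠ ∞ := by
  obtain ⟨s, hs⟩ := hx
  set A : ℕ → Set ℝ := fun n => {u | ENNReal.ofReal s + n < ‖x u‖ₑ} with hA
  have hAm : ∀ n, MeasurableSet (A n) := fun n =>
    measurableSet_lt measurable_const (measurable_enorm_L0 x)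
  have hanti : Antitone A := fun m n hmn u hu => by
    simp only [hA, mem_ofPred_eq] at hu ⊢
    refine lt_of_le_of_lt ?_ hu
    gcongr
  have hlim := tendsto_measure_iInter_atTop (μ := semiAxis) (s := A)
    (fun n => (hAm n).nullMeasurableSet) hanti ⟨0, by
      refine ne_top_of_le_ne_top hs.ne (measure_mono fun u hu => ?_)
      simp only [hA, mem_ofPred_eq, Nat.cast_zero, add_zero, ← ofReal_norm,
        Real.norm_eq_abs] at hu ⊢
      exact lt_of_not_ge fun h => not_le.2 hu (ENNReal.ofReal_le_ofReal h)⟩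
  have hempty : ⋂ n, A n = ∅ := by
    ext u
    simp only [hA, mem_iInter, mem_ofPred_eq, mem_empty_iff_false, iff_false, not_forall, not_lt]
    obtain ⟨n, hn⟩ := ENNReal.exists_nat_gt (enorm_ne_top (x := x u))
    exact ⟨n, hn.le.trans le_add_self⟩
  rw [hempty, measure_empty] at hlim
  obtain ⟨n, hn⟩ := (hlim.eventually (gt_mem_nhds (ENNReal.ofReal_pos.2 ht))).exists
  refine ne_top_of_le_ne_top (b := ENNReal.ofReal s + n) (by simp) ?_
  by_contra! h
  rw [lt_rearrangement_iff] at h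
  exact absurd h (not_lt.2 hn.le)

/-- Truncating at ±s splits off a bounded part; what is left has absolute value (|x| - s)⁺, whose
integral is the excess. -/
theorem mem_L1AddLInfty_of_excess {x : L0} {s : ℝ≥0∞} (hs : s ≠ ∞)
    (h : excess (fun t => ‖x t‖ₑ) s ≠ ∞) : x ∈ L1AddLInfty := by
  lift s to NNReal using hs
  set g : ℝ → ℝ := fun t => max (-(s : ℝ)) (min (x t) s) with hg
  have hxm : Measurable (x : ℝ → ℝ) := x.measurable
  have hgm : Measurable g := measurable_const.max (hxm.min measurable_const)
  have hgb : ∀ t, |g t| ≤ s := fun t => abs_le.2 ⟨le_max_left _ _,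
    max_le (by linarith [s.2]) (min_le_right _ _)⟩
  have hfg : ∀ t, ‖x t - g t‖ₑ = ‖x t‖ₑ - s := by
    intro t
    have h1 : |x t - g t| = max (|x t| - s) 0 := by
      simp only [hg]
      have := s.2
      have hs0 : (0 : ℝ) ≤ s := s.2
      rcases le_total 0 (x t) with h0 | h0
      · rw [abs_of_nonneg h0]
        rcases le_total (x t) s with h1 | h1
        · rw [min_eq_left h1, max_eq_right (by linarith), max_eq_right (by linarith)]; simp
        · rw [min_eq_right h1, max_eq_right (by linarith), max_eq_left (by linarith),
            abs_of_nonneg (by linarith)]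
      · rw [abs_of_nonpos h0, min_eq_left (by linarith)]
        rcases le_total (-(s : ℝ)) (x t) with h1 | h1
        · rw [max_eq_right h1, max_eq_right (by linarith)]; simp
        · rw [max_eq_left h1, max_eq_left (by linarith), abs_of_nonpos (by linarith)]; ring
    rw [Real.enorm_eq_ofReal_abs, Real.enorm_eq_ofReal_abs, h1,
      ENNReal.ofReal_max, ENNReal.ofReal_zero, max_eq_left zero_le,
      ENNReal.ofReal_sub (q := (s : ℝ)) _ s.2]
    simp
  refine ⟨AEEqFun.mk (fun t => x t - g t) (hxm.sub hgm).aestronglyMeasurable, ?_,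
    AEEqFun.mk g hgm.aestronglyMeasurable, ?_, ?_⟩
  · change MemLp _ 1 semiAxis
    rw [memLp_congr_ae (AEEqFun.coeFn_mk _ _), memLp_one_iff_integrable]
    refine ⟨(hxm.sub hgm).aestronglyMeasurable, ?_⟩
    change ∫⁻ t, ‖x t - g t‖ₑ ∂semiAxis < ∞
    simp only [hfg]
    exact lt_top_iff_ne_top.2 h
  · change MemLp _ ∞ semiAxis
    rw [memLp_congr_ae (AEEqFun.coeFn_mk _ _)]
    exact memLp_top_of_bound hgm.aestronglyMeasurable s
      (Eventually.of_forall fun t => by simpa using hgb t)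
  · refine AEEqFun.ext ?_
    filter_upwards [AEEqFun.coeFn_add (AEEqFun.mk (fun t => x t - g t)
      (hxm.sub hgm).aestronglyMeasurable) (AEEqFun.mk g hgm.aestronglyMeasurable),
      AEEqFun.coeFn_mk (fun t => x t - g t) (hxm.sub hgm).aestronglyMeasurable,
      AEEqFun.coeFn_mk g hgm.aestronglyMeasurable] with t h1 h2 h3
    rw [h1, Pi.add_apply, h2, h3]
    ring

theorem exists_excess_ne_top {x : L0} (hx : x ∈ L1AddLInfty) :
    ∃ s : ℝ≥0∞, s ≠ ∞ ∧ excess (fun t => ‖x t‖ₑ) s ≠ ∞ := by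
  obtain ⟨f, hf, g, hg, rfl⟩ := hx
  have hf : MemLp f 1 semiAxis := hf
  have hg : MemLp g ∞ semiAxis := hg
  refine ⟨eLpNorm g ∞ semiAxis, hg.2.ne, ?_⟩
  have h1 : excess (fun t => ‖(f + g : L0) t‖ₑ) (0 + eLpNorm g ∞ semiAxis)
      ≤ excess (fun t => ‖f t‖ₑ) 0 + excess (fun t => ‖g t‖ₑ) (eLpNorm g ∞ semiAxis) := by
    refine le_trans (excess_mono_ae ?_ _) (excess_add_le (aemeasurable_enorm f) _ _)
    filter_upwards [AEEqFun.coeFn_add f g] with t ht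
    rw [ht]
    exact enorm_add_le _ _
  have h2 : excess (fun t => ‖g t‖ₑ) (eLpNorm g ∞ semiAxis) = 0 := by
    unfold excess
    rw [lintegral_eq_zero_iff' ((aemeasurable_enorm g).sub_const _)]
    filter_upwards [ae_le_eLpNormEssSup (f := g) (μ := semiAxis)] with t ht
    rw [eLpNorm_exponent_top]
    exact tsub_eq_zero_of_le ht
  have h3 : excess (fun t => ‖f t‖ₑ) 0 ≠ ∞ := by
    rw [excess_zero_right]
    exact (memLp_one_iff_integrable.1 hf).2.ne
  rw [zero_add, h2, add_zero] at h1
  exact ne_top_of_le_ne_top h3 h1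

theorem mem_S0_of_excess {x : L0} {s : ℝ≥0∞} (hs : s ≠ ∞)
    (h : excess (fun t => ‖x t‖ₑ) s ≠ ∞) : x ∈ S0 := by
  refine ⟨(s + 1).toReal, ?_⟩
  have h1 : semiAxis {t | 1 ≤ ‖x t‖ₑ - s} ≤ excess (fun t => ‖x t‖ₑ) s := by
    have := mul_meas_ge_le_lintegral₀ ((aemeasurable_enorm x).sub_const s) 1
    rwa [one_mul] at this
  refine lt_of_le_of_lt (measure_mono fun t ht => ?_) (lt_top_iff_ne_top.2
    (ne_top_of_le_ne_top h h1))
  simp only [mem_ofPred_eq] at ht ⊢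
  refine ENNReal.le_sub_of_add_le_right hs ?_
  rw [← ofReal_norm, Real.norm_eq_abs, add_comm]
  exact (ENNReal.le_ofReal_iff_toReal_le (by simp [hs]) (abs_nonneg _)).2 ht.le

theorem L1AddLInfty_subset_S0 {x : L0} (hx : x ∈ L1AddLInfty) : x ∈ S0 := by
  obtain ⟨s, hs, h⟩ := exists_excess_ne_top hx
  exact mem_S0_of_excess hs h

/-- An antitone function lies above `s` before some point and below `s` after it. -/
theorem exists_crossing {f : ℝ → ℝ≥0∞} (hf : Antitone f) (s : ℝ≥0∞) {t : ℝ} (ht : 0 ≤ t) :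
    ∃ t' ∈ Icc 0 t, (∀ u, 0 < u → u < t' → s ≤ f u) ∧ (∀ u, t' < u → u ≤ t → f u ≤ s) := by
  set A := {u | 0 ≤ u ∧ u ≤ t ∧ (u = 0 ∨ s ≤ f u)} with hA
  have h0 : (0 : ℝ) ∈ A := ⟨le_rfl, ht, Or.inl rfl⟩
  have hbdd : BddAbove A := ⟨t, fun u hu => hu.2.1⟩
  refine ⟨sSup A, ⟨le_csSup hbdd h0, csSup_le ⟨0, h0⟩ fun u hu => hu.2.1⟩, ?_, ?_⟩
  · intro u hu0 hu
    obtain ⟨v, hv, huv⟩ := exists_lt_of_lt_csSup ⟨0, h0⟩ hu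
    rcases hv.2.2 with rfl | hv2
    · linarith
    · exact hv2.trans (hf huv.le)
  · intro u hu hut
    by_contra! h
    have : 0 ≤ sSup A := le_csSup hbdd h0
    exact absurd (le_csSup hbdd (show u ∈ A from ⟨by linarith, hut, Or.inr h.le⟩)) (not_le.2 hu)

theorem setLIntegral_tsub_add {B : Set ℝ} {e : ℝ → ℝ≥0∞} {s : ℝ≥0∞} (hB : MeasurableSet B)
    (h : ∀ t ∈ B, s ≤ e t) :
    (∫⁻ t in B, (e t - s)) + s * volume B = ∫⁻ t in B, e t := by
  rw [← setLIntegral_const, ← lintegral_add_right _ measurable_const]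
  exact setLIntegral_congr_fun hB fun t ht => tsub_add_cancel_of_le (h t ht)

theorem setLIntegral_Ioo_eq_Ioc (e : ℝ → ℝ≥0∞) (a b : ℝ) :
    ∫⁻ t in Ioo a b, e t = ∫⁻ t in Ioc a b, e t :=
  setLIntegral_congr Ioo_ae_eq_Ioc

/-- If the primitives of antitone functions compare, then so do their excesses. -/
theorem excess_le_of_primitive_le {f g : ℝ → ℝ≥0∞} (hf : Antitone f)
    (h : ∀ t : ℝ, 0 ≤ t → ∫⁻ u in Ioc 0 t, f u ≤ ∫⁻ u in Ioc 0 t, g u) {s : ℝ≥0∞} (hs : s ≠ ∞) :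
    excess f s ≤ excess g s := by
  have key : ∀ t : ℝ, 0 ≤ t → ∫⁻ u in Ioc 0 t, (f u - s) ≤ excess g s := by
    intro t ht
    -- On (0, t] the positive part of f - s lives on (0, t'], where it is f - s itself, so the
    -- hypothesis is needed at t' only.
    obtain ⟨t', ⟨h0, ht'⟩, h1, h2⟩ := exists_crossing hf s ht
    have e1 : ∫⁻ u in Ioc 0 t, (f u - s) = ∫⁻ u in Ioc 0 t', (f u - s) := by
      rw [← Ioc_union_Ioc_eq_Ioc h0 ht', lintegral_union measurableSet_Ioc
        (Set.disjoint_left.2 fun u hu hu' => absurd hu.2 (not_le.2 hu'.1))]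
      rw [setLIntegral_congr_fun (g := fun _ => 0) measurableSet_Ioc
        (fun u hu => tsub_eq_zero_of_le (h2 u hu.1 hu.2))]
      simp
    have e2 : (∫⁻ u in Ioc 0 t', (f u - s)) + s * volume (Ioc 0 t')
        = ∫⁻ u in Ioc 0 t', f u := by
      have := setLIntegral_tsub_add (B := Ioo 0 t') (e := f) (s := s) measurableSet_Ioo
        fun u hu => h1 u hu.1 hu.2
      rw [setLIntegral_Ioo_eq_Ioc, setLIntegral_Ioo_eq_Ioc] at this
      simpa using this
    rw [e1]
    have e3 := (h t' h0).trans (setLIntegral_le_excess (fun u hu => hu.1) g s)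
    rw [← e2] at e3
    refine (ENNReal.add_le_add_iff_right ?_).1 e3
    simpa using ENNReal.mul_ne_top hs ENNReal.ofReal_ne_top
  have hU : Ioi (0 : ℝ) = ⋃ n : ℕ, Ioc (0 : ℝ) n := by
    ext u
    simp only [mem_Ioi, mem_iUnion, mem_Ioc]
    constructor
    · intro hu
      obtain ⟨n, hn⟩ := exists_nat_ge u
      exact ⟨n, hu, hn⟩
    · rintro ⟨n, hn⟩
      exact hn.1
  have hdir : Directed (· ⊆ ·) fun n : ℕ => Ioc (0 : ℝ) n := by
    refine Monotone.directed_le fun m n hmn => ?_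
    exact Ioc_subset_Ioc_right (by exact_mod_cast hmn)
  unfold excess
  rw [semiAxis, hU, setLIntegral_iUnion_of_directed _ hdir]
  exact iSup_le fun n => by
    have := key n n.cast_nonneg
    rwa [excess, semiAxis, hU] at this

/-- For an antitone function, the primitive at `t` is computed by the excess at the value at `t`. -/
theorem excess_add_eq_primitive {f : ℝ → ℝ≥0∞} (hf : Antitone f) {t : ℝ} (ht : 0 ≤ t) :
    excess f (f t) + f t * ENNReal.ofReal t = ∫⁻ u in Ioc 0 t, f u := by
  have h := setLIntegral_tsub_add (B := Ioc 0 t) (e := f) (s := f t) measurableSet_Ioc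
    fun u hu => hf hu.2
  rw [Real.volume_Ioc, sub_zero] at h
  rw [← h, excess, semiAxis, ← Ioc_union_Ioi_eq_Ioi ht, lintegral_union measurableSet_Ioi
        (Set.disjoint_left.2 fun u hu hu' => absurd hu.2 (not_le.2 hu')),
      setLIntegral_congr_fun (s := Ioi t) (g := fun _ => 0) measurableSet_Ioi
        (fun u hu => tsub_eq_zero_of_le (hf (le_of_lt hu)))]
  simp

/-- At the level `g t` the bound of `setLIntegral_le_excess` is an equality for `g`, so this single
level settles the primitive at `t`; it has to be finite since only finite levels are assumed
comparable. -/
theorem primitive_le_of_excess_le {f g : ℝ → ℝ≥0∞} (hg : Antitone g)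
    (h : ∀ s, s ≠ ∞ → excess f s ≤ excess g s) {t : ℝ} (ht : 0 ≤ t) (hgt : 0 < t → g t ≠ ∞) :
    ∫⁻ u in Ioc 0 t, f u ≤ ∫⁻ u in Ioc 0 t, g u := by
  rcases ht.eq_or_lt with rfl | ht'
  · simp
  rw [← excess_add_eq_primitive hg ht]
  refine (setLIntegral_le_excess (fun u hu => hu.1) f (g t)).trans ?_
  rw [Real.volume_Ioc, sub_zero]
  exact add_le_add (h _ (hgt ht')) le_rfl

/-- Excess is an integral of the function itself, with no rearrangement, and is additive over
disjoint pieces; all later arguments use the orbit in this form. Membership of `x` in `S0` makes the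
critical level `rearrangement x t` finite. -/
theorem submajorized_iff {x y : L0} (hx : x ∈ S0) :
    Submajorized y x ↔
      ∀ s : ℝ≥0∞, excess (fun t => ‖y t‖ₑ) s ≤ excess (fun t => ‖x t‖ₑ) s := by
  constructor
  · intro h s
    by_cases hs : s = ∞
    · simp [hs, excess]
    · rw [← excess_rearrangement, ← excess_rearrangement]
      exact excess_le_of_primitive_le (rearrangement_antitone y) h hs
  · intro h t ht
    refine primitive_le_of_excess_le (rearrangement_antitone x) (fun s _ => ?_) ht
      (fun ht' => rearrangement_ne_top hx ht')
    rw [excess_rearrangement, excess_rearrangement]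
    exact h s

/-- The class of a `[0, ∞]`-valued function. -/
noncomputable def classOf (e : ℝ → ℝ≥0∞) (he : AEMeasurable e semiAxis) : L0 :=
  AEEqFun.mk (fun t => (e t).toReal) he.ennreal_toReal.aestronglyMeasurable

theorem coeFn_classOf {e : ℝ → ℝ≥0∞} (he : AEMeasurable e semiAxis) :
    ∀ᵐ t ∂semiAxis, classOf e he t = (e t).toReal :=
  AEEqFun.coeFn_mk _ _

theorem enorm_classOf {e : ℝ → ℝ≥0∞} (he : AEMeasurable e semiAxis)
    (hfin : ∀ᵐ t ∂semiAxis, e t ≠ ∞) : ∀ᵐ t ∂semiAxis, ‖classOf e he t‖ₑ = e t := by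
  filter_upwards [coeFn_classOf he, hfin] with t ht h
  rw [ht, Real.enorm_eq_ofReal ENNReal.toReal_nonneg, ENNReal.ofReal_toReal h]

theorem classOf_nonneg {e : ℝ → ℝ≥0∞} (he : AEMeasurable e semiAxis) : 0 ≤ classOf e he := by
  rw [← AEEqFun.coeFn_le]
  filter_upwards [coeFn_classOf he, AEEqFun.coeFn_zero (α := ℝ) (β := ℝ) (μ := semiAxis)]
    with t ht h0
  rw [ht, h0]
  exact ENNReal.toReal_nonneg

theorem ae_ne_top_of_excess {e : ℝ → ℝ≥0∞} (he : AEMeasurable e semiAxis) {s : ℝ≥0∞}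
    (hs : s ≠ ∞) (h : excess e s ≠ ∞) : ∀ᵐ t ∂semiAxis, e t ≠ ∞ := by
  filter_upwards [ae_lt_top' (he.sub_const s) h] with t ht het
  rw [het, ENNReal.top_sub hs] at ht
  exact lt_irrefl _ ht

/-! ### The norm as an extended functional, monotone under excess. -/

namespace BanachIdealLattice

variable (E : BanachIdealLattice)

theorem solid_ae {x y : L0} (hx : x ∈ E.carrier) (h : ∀ᵐ t ∂semiAxis, ‖y t‖ₑ ≤ ‖x t‖ₑ) :
    y ∈ E.carrier ∧ E.norm y ≤ E.norm x := by
  refine E.solid x hx y ?_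
  rw [← AEEqFun.coeFn_le]
  filter_upwards [h, AEEqFun.coeFn_abs x, AEEqFun.coeFn_abs y] with t ht h1 h2
  rw [h1, h2]
  rw [enorm_le_iff_norm_le] at ht
  exact ht

/-- The norm of `E` as an extended functional on `[0, ∞]`-valued functions. -/
noncomputable def extNorm (e : ℝ → ℝ≥0∞) : ℝ≥0∞ :=
  ⨅ (v : L0) (_ : v ∈ E.carrier) (_ : ∀ᵐ t ∂semiAxis, e t ≤ ‖v t‖ₑ), ENNReal.ofReal (E.norm v)

variable {E}

theorem extNorm_le {e : ℝ → ℝ≥0∞} {v : L0} (hv : v ∈ E.carrier)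
    (h : ∀ᵐ t ∂semiAxis, e t ≤ ‖v t‖ₑ) : E.extNorm e ≤ ENNReal.ofReal (E.norm v) :=
  iInf_le_of_le v (iInf_le_of_le hv (iInf_le_of_le h le_rfl))

theorem exists_of_extNorm_lt {e : ℝ → ℝ≥0∞} {r : ℝ≥0∞} (h : E.extNorm e < r) :
    ∃ v ∈ E.carrier, (∀ᵐ t ∂semiAxis, e t ≤ ‖v t‖ₑ) ∧ ENNReal.ofReal (E.norm v) < r := by
  simp only [extNorm, iInf_lt_iff] at h
  obtain ⟨v, hv, h1, h2⟩ := h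
  exact ⟨v, hv, h1, h2⟩

theorem le_extNorm {e : ℝ → ℝ≥0∞} {r : ℝ≥0∞}
    (h : ∀ v ∈ E.carrier, (∀ᵐ t ∂semiAxis, e t ≤ ‖v t‖ₑ) → r ≤ ENNReal.ofReal (E.norm v)) :
    r ≤ E.extNorm e :=
  le_iInf fun v => le_iInf fun hv => le_iInf fun h1 => h v hv h1

theorem extNorm_mono_ae {e e' : ℝ → ℝ≥0∞} (h : ∀ᵐ t ∂semiAxis, e t ≤ e' t) :
    E.extNorm e ≤ E.extNorm e' :=
  le_extNorm fun _ hv h1 => extNorm_le hv (by filter_upwards [h, h1] with t a b using a.trans b)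

theorem extNorm_mono {e e' : ℝ → ℝ≥0∞} (h : ∀ t, e t ≤ e' t) :
    E.extNorm e ≤ E.extNorm e' := extNorm_mono_ae (Eventually.of_forall h)

theorem extNorm_enorm {u : L0} (hu : u ∈ E.carrier) :
    E.extNorm (fun t => ‖u t‖ₑ) = ENNReal.ofReal (E.norm u) :=
  le_antisymm (extNorm_le hu (Eventually.of_forall fun _ => le_rfl))
    (le_extNorm fun _ hv h => ENNReal.ofReal_le_ofReal (E.solid_ae hv h).2)

theorem mem_of_extNorm_ne_top {u : L0} (h : E.extNorm (fun t => ‖u t‖ₑ) ≠ ∞) : u ∈ E.carrier := by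
  obtain ⟨v, hv, h1, -⟩ := exists_of_extNorm_lt (lt_top_iff_ne_top.2 h)
  exact (E.solid_ae hv h1).1

theorem ae_ne_top_of_extNorm {e : ℝ → ℝ≥0∞} (h : E.extNorm e ≠ ∞) :
    ∀ᵐ t ∂semiAxis, e t ≠ ∞ := by
  obtain ⟨v, hv, h1, -⟩ := exists_of_extNorm_lt (lt_top_iff_ne_top.2 h)
  exact h1.mono fun t ht => ne_top_of_le_ne_top enorm_ne_top ht

theorem extNorm_classOf {e : ℝ → ℝ≥0∞} (he : AEMeasurable e semiAxis) (h : E.extNorm e ≠ ∞) :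
    classOf e he ∈ E.carrier ∧ ENNReal.ofReal (E.norm (classOf e he)) = E.extNorm e := by
  have h1 := enorm_classOf he (ae_ne_top_of_extNorm h)
  have h2 : E.extNorm (fun t => ‖classOf e he t‖ₑ) = E.extNorm e :=
    le_antisymm (extNorm_mono_ae (h1.mono fun t ht => ht.le))
      (extNorm_mono_ae (h1.mono fun t ht => ht.ge))
  have h3 : classOf e he ∈ E.carrier := mem_of_extNorm_ne_top (by rwa [h2])
  exact ⟨h3, by rw [← h2, extNorm_enorm h3]⟩

theorem extNorm_zero : E.extNorm (fun _ => 0) = 0 := by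
  refine le_antisymm ?_ zero_le
  refine (extNorm_le E.carrier.zero_mem (Eventually.of_forall fun _ => zero_le)).trans ?_
  have := E.norm_smul 0 0 E.carrier.zero_mem
  rw [zero_smul, abs_zero, zero_mul] at this
  simp [this]

theorem extNorm_add_le (e e' : ℝ → ℝ≥0∞) :
    E.extNorm (fun t => e t + e' t) ≤ E.extNorm e + E.extNorm e' := by
  refine ENNReal.le_of_forall_pos_le_add fun ε hε hfin => ?_
  have hfin' := ENNReal.add_lt_top.1 hfin
  have hε2 : (ε : ℝ≥0∞) / 2 ≠ 0 := by simp [hε.ne']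
  obtain ⟨v, hv, h1, h2⟩ := exists_of_extNorm_lt (ENNReal.lt_add_right hfin'.1.ne hε2)
  obtain ⟨v', hv', h1', h2'⟩ := exists_of_extNorm_lt (ENNReal.lt_add_right hfin'.2.ne hε2)
  have habs : ∀ w : L0, ∀ᵐ t ∂semiAxis, ‖(|w| : L0) t‖ₑ = ‖w t‖ₑ := fun w => by
    filter_upwards [AEEqFun.coeFn_abs w] with t ht
    rw [ht, Real.enorm_abs]
  have ha := E.solid_ae hv ((habs v).mono fun t ht => ht.le)
  have ha' := E.solid_ae hv' ((habs v').mono fun t ht => ht.le)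
  have hsum : ∀ᵐ t ∂semiAxis, e t + e' t ≤ ‖(|v| + |v'| : L0) t‖ₑ := by
    filter_upwards [h1, h1', AEEqFun.coeFn_add |v| |v'|, AEEqFun.coeFn_abs v,
      AEEqFun.coeFn_abs v'] with t a b c d d'
    rw [c, Pi.add_apply, d, d', Real.enorm_eq_ofReal (by positivity),
      ENNReal.ofReal_add (abs_nonneg _) (abs_nonneg _), ← Real.enorm_eq_ofReal_abs,
      ← Real.enorm_eq_ofReal_abs]
    exact add_le_add a b
  calc E.extNorm (fun t => e t + e' t)
      ≤ ENNReal.ofReal (E.norm (|v| + |v'|)) := extNorm_le (E.carrier.add_mem ha.1 ha'.1) hsum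
    _ ≤ ENNReal.ofReal (E.norm v + E.norm v') := ENNReal.ofReal_le_ofReal
        ((E.norm_add_le _ ha.1 _ ha'.1).trans (add_le_add ha.2 ha'.2))
    _ ≤ ENNReal.ofReal (E.norm v) + ENNReal.ofReal (E.norm v') := ENNReal.ofReal_add_le
    _ ≤ (E.extNorm e + ε / 2) + (E.extNorm e' + ε / 2) := add_le_add h2.le h2'.le
    _ = E.extNorm e + E.extNorm e' + ε := by
        rw [add_add_add_comm, ENNReal.add_halves]

theorem extNorm_sum_le {ι : Type*} (S : Finset ι) (e : ι → ℝ → ℝ≥0∞) :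
    E.extNorm (fun t => ∑ i ∈ S, e i t) ≤ ∑ i ∈ S, E.extNorm (e i) := by
  classical
  induction S using Finset.induction_on with
  | empty => simp [extNorm_zero]
  | insert a S ha ih =>
    simp only [Finset.sum_insert ha]
    exact (extNorm_add_le _ _).trans (add_le_add le_rfl ih)

theorem extNorm_const_mul_le {c : ℝ≥0∞} (hc0 : c ≠ 0) (hc : c ≠ ∞) (e : ℝ → ℝ≥0∞) :
    E.extNorm (fun t => c * e t) ≤ c * E.extNorm e := by
  rw [← ENNReal.div_le_iff' hc0 hc]
  refine le_extNorm fun v hv h => ?_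
  rw [ENNReal.div_le_iff' hc0 hc]
  have hmem := E.carrier.smul_mem c.toReal hv
  have hle : ∀ᵐ t ∂semiAxis, c * e t ≤ ‖(c.toReal • v : L0) t‖ₑ := by
    filter_upwards [h, AEEqFun.coeFn_smul c.toReal v] with t a b
    rw [b, Pi.smul_apply, enorm_smul, Real.enorm_eq_ofReal ENNReal.toReal_nonneg,
      ENNReal.ofReal_toReal hc]
    gcongr
  refine (extNorm_le hmem hle).trans ?_
  rw [E.norm_smul _ _ hv, abs_of_nonneg ENNReal.toReal_nonneg,
    ENNReal.ofReal_mul ENNReal.toReal_nonneg, ENNReal.ofReal_toReal hc]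

theorem extNorm_const_mul {c : ℝ≥0∞} (hc0 : c ≠ 0) (hc : c ≠ ∞) (e : ℝ → ℝ≥0∞) :
    E.extNorm (fun t => c * e t) = c * E.extNorm e := by
  refine le_antisymm (extNorm_const_mul_le hc0 hc e) ?_
  have := extNorm_const_mul_le (E := E) (ENNReal.inv_ne_zero.2 hc) (ENNReal.inv_ne_top.2 hc0)
    (fun t => c * e t)
  simp only [← mul_assoc, ENNReal.inv_mul_cancel hc0 hc, one_mul] at this
  calc c * E.extNorm e ≤ c * (c⁻¹ * E.extNorm fun t => c * e t) := by gcongr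
    _ = _ := by rw [← mul_assoc, ENNReal.mul_inv_cancel hc0 hc, one_mul]

/-- The indicator of `(0, 1]`. -/
noncomputable def unitIndicator : ℝ → ℝ≥0∞ := (Ioc (0 : ℝ) 1).indicator 1

theorem measurable_unitIndicator : Measurable unitIndicator :=
  measurable_one.indicator measurableSet_Ioc

theorem excess_const_mul_indicator {A : Set ℝ} (hA : MeasurableSet A) (hA0 : A ⊆ Ioi 0)
    (c s : ℝ≥0∞) :
    excess (fun t => c * A.indicator 1 t) s = (c - s) * volume A := by
  have : ∀ t, c * A.indicator 1 t - s = A.indicator (fun _ => c - s) t := by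
    intro t
    by_cases h : t ∈ A <;> simp [h]
  unfold excess
  simp only [this]
  rw [lintegral_indicator_const hA, Measure.restrict_apply hA, inter_eq_left.2 hA0]

theorem excess_const_mul_unitIndicator (c s : ℝ≥0∞) :
    excess (fun t => c * unitIndicator t) s = c - s := by
  unfold unitIndicator
  rw [excess_const_mul_indicator measurableSet_Ioc (fun u hu => hu.1)]
  simp

theorem excess_le_of_mem (hE : E.IsFullySymmetric) {u v : L0} (hv : v ∈ E.carrier)
    (hu : u ∈ L1AddLInfty) (h : ∀ s, excess (fun t => ‖u t‖ₑ) s ≤ excess (fun t => ‖v t‖ₑ) s) :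
    u ∈ E.carrier ∧ E.norm u ≤ E.norm v :=
  hE.2 v hv u hu ((submajorized_iff (hE.1.1 v hv)).2 h)

/-- If the excess of `v` were infinite at all finite levels, `v` would submajorize n times the
indicator of (0, 1] for every n, and these norms grow linearly in n. -/
theorem mem_L1AddLInfty (hE : E.IsFullySymmetric) {v : L0} (hv : v ∈ E.carrier) :
    v ∈ L1AddLInfty := by
  by_contra hcon
  have htop : ∀ s, s ≠ ∞ → excess (fun t => ‖v t‖ₑ) s = ∞ := fun s hs => by
    by_contra h
    exact hcon (mem_L1AddLInfty_of_excess hs h)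
  set χ : ℕ → L0 := fun n => classOf (fun t => n * unitIndicator t)
    (measurable_unitIndicator.const_mul _).aemeasurable with hχ
  have hχe : ∀ n, ∀ᵐ t ∂semiAxis, ‖χ n t‖ₑ = n * unitIndicator t := fun n => by
    refine enorm_classOf _ (Eventually.of_forall fun t => ENNReal.mul_ne_top (by simp) ?_)
    unfold unitIndicator
    by_cases h : t ∈ Ioc (0 : ℝ) 1 <;> simp [h]
  have hex : ∀ n s, excess (fun t => ‖χ n t‖ₑ) s = n - s := fun n s => by
    rw [excess_congr_ae (hχe n), excess_const_mul_unitIndicator]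
  have hmem : ∀ n, χ n ∈ E.carrier ∧ E.norm (χ n) ≤ E.norm v := fun n => by
    refine excess_le_of_mem hE hv (mem_L1AddLInfty_of_excess ENNReal.zero_ne_top ?_) fun s => ?_
    · rw [hex]; simp
    · by_cases hs : s = ∞
      · simp [hs, excess]
      · rw [htop s hs]; exact le_top
  have hn : ∀ n : ℕ, n ≠ 0 → ENNReal.ofReal (E.norm (χ n)) = n * E.extNorm unitIndicator := by
    intro n hn
    rw [← extNorm_enorm (hmem n).1, ← extNorm_const_mul (by simpa using hn) (by simp)]
    exact le_antisymm (extNorm_mono_ae ((hχe n).mono fun t ht => ht.le))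
      (extNorm_mono_ae ((hχe n).mono fun t ht => ht.ge))
  have hpos : E.norm (χ 1) ≠ 0 := fun h0 => by
    have h1 := E.eq_zero_of_norm_eq_zero _ (hmem 1).1 h0
    have h2 := hex 1 0
    rw [h1, excess_zero_right, lintegral_congr_ae (g := fun _ => 0)] at h2
    · simp at h2
    · filter_upwards [AEEqFun.coeFn_zero (α := ℝ) (β := ℝ) (μ := semiAxis)] with t ht
      simp [ht]
  have hpos' : 0 < E.norm (χ 1) := lt_of_le_of_ne (E.norm_nonneg _ (hmem 1).1) hpos.symm
  obtain ⟨n, hn1⟩ := exists_nat_gt (E.norm v / E.norm (χ 1))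
  have hn0 : n ≠ 0 := by
    rintro rfl
    have : 0 ≤ E.norm v / E.norm (χ 1) := div_nonneg (E.norm_nonneg _ hv) hpos'.le
    simp at hn1
    linarith
  have e1 := hn 1 one_ne_zero
  have e2 := hn n hn0
  rw [Nat.cast_one, one_mul] at e1
  rw [← e1, ← ENNReal.ofReal_natCast, ← ENNReal.ofReal_mul n.cast_nonneg] at e2
  have e3 := (ENNReal.ofReal_eq_ofReal_iff (E.norm_nonneg _ (hmem n).1)
    (mul_nonneg n.cast_nonneg hpos'.le)).1 e2
  have e4 := (hmem n).2
  rw [e3] at e4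
  rw [div_lt_iff₀ hpos'] at hn1
  linarith

/-- This is full symmetry in working form: every majorant of `e'` in E submajorizes the class of
`e`. Level 0 is spared by right continuity, level ∞ by triviality. -/
theorem extNorm_le_of_excess_le (hE : E.IsFullySymmetric) {e e' : ℝ → ℝ≥0∞}
    (he : AEMeasurable e semiAxis) (h : ∀ s, s ≠ 0 → s ≠ ∞ → excess e s ≤ excess e' s) :
    E.extNorm e ≤ E.extNorm e' := by
  refine le_extNorm fun v hv h1 => ?_
  have h2 : ∀ s, excess e s ≤ excess (fun t => ‖v t‖ₑ) s := fun s =>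
    excess_le_of_forall_lt he s fun r hr hr' =>
      (h r (pos_of_gt hr).ne' hr').trans (excess_mono_ae h1 r)
  obtain ⟨s, hs, h3⟩ := exists_excess_ne_top (mem_L1AddLInfty hE hv)
  have h4 := enorm_classOf he (ae_ne_top_of_excess he hs (ne_top_of_le_ne_top h3 (h2 s)))
  have h5 : ∀ s, excess (fun t => ‖classOf e he t‖ₑ) s = excess e s := excess_congr_ae h4
  have h6 := excess_le_of_mem hE hv (mem_L1AddLInfty_of_excess hs
    (by rw [h5]; exact ne_top_of_le_ne_top h3 (h2 s))) (fun s => by rw [h5]; exact h2 s)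
  exact (extNorm_le h6.1 (h4.mono fun t ht => ht.ge)).trans (ENNReal.ofReal_le_ofReal h6.2)

theorem extNorm_rearrangement (hE : E.IsFullySymmetric) {x : L0} (hx : x ∈ E.carrier) :
    E.extNorm (rearrangement x) = ENNReal.ofReal (E.norm x) := by
  rw [← extNorm_enorm hx]
  exact le_antisymm (extNorm_le_of_excess_le hE (measurable_rearrangement x).aemeasurable
      fun s _ _ => (excess_rearrangement x s).le)
    (extNorm_le_of_excess_le hE (aemeasurable_enorm x) fun s _ _ => (excess_rearrangement x s).ge)

theorem ae_eq_zero_of_extNorm_eq_zero {e : ℝ → ℝ≥0∞} (he : AEMeasurable e semiAxis)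
    (h : E.extNorm e = 0) : ∀ᵐ t ∂semiAxis, e t = 0 := by
  have h0 : E.extNorm e ≠ ∞ := by simp [h]
  obtain ⟨h1, h2⟩ := extNorm_classOf he h0
  rw [h, ENNReal.ofReal_eq_zero] at h2
  have h3 := E.eq_zero_of_norm_eq_zero _ h1 (le_antisymm h2 (E.norm_nonneg _ h1))
  have h4 := enorm_classOf he (ae_ne_top_of_extNorm h0)
  rw [h3] at h4
  filter_upwards [h4, AEEqFun.coeFn_zero (α := ℝ) (β := ℝ) (μ := semiAxis)] with t a b
  rw [← a, b]
  simp

/-- The excess function of an element of `L0` controls the norm from below. -/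
theorem const_mul_extNorm_unitIndicator_le (hE : E.IsFullySymmetric) {e : ℝ → ℝ≥0∞} {c : ℝ≥0∞}
    (hc0 : c ≠ 0) (hc : c ≠ ∞) (h : ∀ s, s ≠ 0 → s ≠ ∞ → c ≤ excess e s + s) :
    c * E.extNorm unitIndicator ≤ E.extNorm e := by
  rw [← extNorm_const_mul hc0 hc]
  refine extNorm_le_of_excess_le hE (measurable_unitIndicator.const_mul c).aemeasurable
    fun s hs0 hs => ?_
  rw [excess_const_mul_unitIndicator]
  exact tsub_le_iff_right.2 (h s hs0 hs)

/-- If Φ_e(s) + s ≥ d at all levels, then d times the indicator of (0, 1] would be submajorized by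
`e`. Hence smallness in norm forces smallness in excess, that is, in L₁ + L_∞. -/
theorem excess_le_of_extNorm_lt (hE : E.IsFullySymmetric) {e : ℝ → ℝ≥0∞} {d : ℝ≥0∞}
    (hd0 : d ≠ 0) (hd : d ≠ ∞) (h : E.extNorm e < d * E.extNorm unitIndicator) :
    excess e d ≤ d := by
  have : ∃ s, s ≠ 0 ∧ s ≠ ∞ ∧ excess e s + s < d := by
    by_contra! hcon
    exact absurd (const_mul_extNorm_unitIndicator_le hE hd0 hd hcon) (not_le.2 h)
  obtain ⟨s, -, -, hs⟩ := this
  have h1 : s ≤ d := le_add_self.trans hs.le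
  exact (excess_antitone e h1).trans (le_self_add.trans hs.le)

theorem extNorm_unitIndicator_ne_zero : E.extNorm unitIndicator ≠ 0 := fun h => by
  have h1 := ae_eq_zero_of_extNorm_eq_zero measurable_unitIndicator.aemeasurable h
  have h2 := excess_const_mul_unitIndicator 1 0
  simp only [one_mul] at h2
  rw [excess_zero_right, lintegral_congr_ae h1] at h2
  simp at h2

/-- The form in which the Fatou property is used: a lower bound for a norm survives a sufficiently
late truncation. -/
theorem exists_lt_extNorm_of_isFatouNorm (hF : E.IsFatouNorm) {e : ℕ → ℝ → ℝ≥0∞}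
    {e' : ℝ → ℝ≥0∞} (he : ∀ n, Measurable (e n)) (he' : Measurable e') (hmono : Monotone e)
    (hlim : ∀ᵐ t ∂semiAxis, Tendsto (fun n => e n t) atTop (𝓝 (e' t)))
    (hfin : E.extNorm e' ≠ ∞) {r : ℝ≥0∞} (hr : r < E.extNorm e') : ∃ n, r < E.extNorm (e n) := by
  have hle : ∀ᵐ t ∂semiAxis, ∀ n, e n t ≤ e' t := hlim.mono fun t ht n =>
    (show Monotone fun n => e n t from fun a b h => hmono h t).ge_of_tendsto ht n
  have hfinn : ∀ n, E.extNorm (e n) ≠ ∞ := fun n =>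
    ne_top_of_le_ne_top hfin (extNorm_mono_ae (hle.mono fun t ht => ht n))
  have hc' := extNorm_classOf he'.aemeasurable hfin
  have hc := fun n => extNorm_classOf (he n).aemeasurable (hfinn n)
  have hall : ∀ᵐ t ∂semiAxis, ∀ n, classOf (e n) (he n).aemeasurable t = (e n t).toReal :=
    ae_all_iff.2 fun n => coeFn_classOf (he n).aemeasurable
  have hfa := ae_ne_top_of_extNorm hfin
  have := hF (fun n => classOf (e n) (he n).aemeasurable) (classOf e' he'.aemeasurable) hc'.1
    (fun n => classOf_nonneg _) (fun m n hmn => by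
      dsimp only
      rw [← AEEqFun.coeFn_le]
      filter_upwards [hall, hle, hfa] with t a b c
      rw [a, a]
      exact ENNReal.toReal_mono (ne_top_of_le_ne_top c (b n)) (hmono hmn t)) (by
      filter_upwards [hall, hlim, hfa, coeFn_classOf he'.aemeasurable] with t a b c d
      simp only [a]
      rw [d]
      exact (ENNReal.tendsto_toReal c).comp b)
  have h2 := (ENNReal.continuous_ofReal.tendsto _).comp this
  rw [hc'.2] at h2
  obtain ⟨n, hn⟩ := (h2.eventually (lt_mem_nhds hr)).exists
  refine ⟨n, ?_⟩
  rw [← (hc n).2]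
  exact hn

end BanachIdealLattice

/-! ### Orbits in terms of excess, and a sufficient condition for extreme points. -/

/-- The limit at infinity of the rearrangement: the least level from which the excess is finite. -/
noncomputable def asymptote (e : ℝ → ℝ≥0∞) : ℝ≥0∞ := sInf {s | excess e s ≠ ∞}

theorem excess_ne_top_of_asymptote_lt {e : ℝ → ℝ≥0∞} {s : ℝ≥0∞} (h : asymptote e < s) :
    excess e s ≠ ∞ := by
  obtain ⟨r, hr, hrs⟩ := sInf_lt_iff.1 h
  exact ne_top_of_le_ne_top hr (excess_antitone e hrs.le)

theorem asymptote_ne_top {e : ℝ → ℝ≥0∞} {s : ℝ≥0∞} (hs : s ≠ ∞) (h : excess e s ≠ ∞) :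
    asymptote e ≠ ∞ :=
  ne_top_of_le_ne_top hs (sInf_le h)

theorem asymptote_rearrangement (x : L0) :
    asymptote (rearrangement x) = asymptote fun t => ‖x t‖ₑ := by
  unfold asymptote
  simp only [excess_rearrangement]

theorem setLIntegral_ne_top {e : ℝ → ℝ≥0∞} {s : ℝ≥0∞} (hs : s ≠ ∞) (h : excess e s ≠ ∞)
    {B : Set ℝ} (hB : B ⊆ Ioi 0) (hBf : volume B ≠ ∞) : ∫⁻ t in B, e t ≠ ∞ :=
  ne_top_of_le_ne_top (ENNReal.add_ne_top.2 ⟨h, ENNReal.mul_ne_top hs hBf⟩)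
    (setLIntegral_le_excess hB e s)

theorem asymptote_le {f : ℝ → ℝ≥0∞} (hf : Antitone f) {s : ℝ≥0∞} (hs : s ≠ ∞)
    (h : excess f s ≠ ∞) {t : ℝ} (ht : 0 < t) : asymptote f ≤ f t := by
  refine sInf_le ?_
  have h1 : excess f (f t) ≤ ∫⁻ u in Ioc 0 t, f u :=
    le_self_add.trans (excess_add_eq_primitive hf ht.le).le
  exact ne_top_of_le_ne_top (setLIntegral_ne_top hs h (fun u hu => hu.1) (by simp)) h1

/-- Finite excess at one finite level already implies membership in L₁ + L_∞, so positivity and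
excess alone cut out the orbit. -/
theorem mem_omegaPlus_iff {x y : L0} (hx : x ∈ L1AddLInfty) :
    y ∈ OmegaPlus x ↔ 0 ≤ y ∧
      ∀ s, excess (fun t => ‖y t‖ₑ) s ≤ excess (fun t => ‖x t‖ₑ) s := by
  unfold OmegaPlus
  simp only [mem_ofPred_eq, submajorized_iff (L1AddLInfty_subset_S0 hx)]
  constructor
  · rintro ⟨h1, -, h2⟩
    exact ⟨h1, h2⟩
  · rintro ⟨h1, h2⟩
    obtain ⟨s, hs, h⟩ := exists_excess_ne_top hx
    exact ⟨h1, mem_L1AddLInfty_of_excess hs (ne_top_of_le_ne_top h (h2 s)), h2⟩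

theorem nonneg_iff_ae {y : L0} : 0 ≤ y ↔ ∀ᵐ t ∂semiAxis, 0 ≤ y t := by
  rw [← AEEqFun.coeFn_le]
  constructor
  · intro h
    filter_upwards [h, AEEqFun.coeFn_zero (α := ℝ) (β := ℝ) (μ := semiAxis)] with t a b
    rwa [b] at a
  · intro h
    filter_upwards [h, AEEqFun.coeFn_zero (α := ℝ) (β := ℝ) (μ := semiAxis)] with t a b
    rwa [b]

theorem ofReal_combo {a b u w : ℝ} (ha : 0 ≤ a) (hb : 0 ≤ b) (hu : 0 ≤ u) (hw : 0 ≤ w) :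
    ‖a * u + b * w‖ₑ = ENNReal.ofReal a * ‖u‖ₑ + ENNReal.ofReal b * ‖w‖ₑ := by
  rw [Real.enorm_eq_ofReal (by positivity), Real.enorm_eq_ofReal hu, Real.enorm_eq_ofReal hw,
    ENNReal.ofReal_add (by positivity) (by positivity), ENNReal.ofReal_mul ha,
    ENNReal.ofReal_mul hb]

theorem enorm_combo_ae {u w : L0} (hu : 0 ≤ u) (hw : 0 ≤ w) {a b : ℝ} (ha : 0 ≤ a) (hb : 0 ≤ b) :
    ∀ᵐ t ∂semiAxis, ‖(a • u + b • w : L0) t‖ₑ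
      = ENNReal.ofReal a * ‖u t‖ₑ + ENNReal.ofReal b * ‖w t‖ₑ := by
  filter_upwards [AEEqFun.coeFn_add (a • u) (b • w), AEEqFun.coeFn_smul a u,
    AEEqFun.coeFn_smul b w, nonneg_iff_ae.1 hu, nonneg_iff_ae.1 hw] with t h1 h2 h3 h4 h5
  rw [h1, Pi.add_apply, h2, h3, Pi.smul_apply, Pi.smul_apply, smul_eq_mul, smul_eq_mul,
    ofReal_combo ha hb h4 h5]

theorem convex_omegaPlus {x : L0} (hx : x ∈ L1AddLInfty) : Convex ℝ (OmegaPlus x) := by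
  intro u hu w hw a b ha hb hab
  rw [mem_omegaPlus_iff hx] at hu hw ⊢
  refine ⟨nonneg_iff_ae.2 ?_, fun s => ?_⟩
  · filter_upwards [AEEqFun.coeFn_add (a • u) (b • w), AEEqFun.coeFn_smul a u,
      AEEqFun.coeFn_smul b w, nonneg_iff_ae.1 hu.1, nonneg_iff_ae.1 hw.1] with t h1 h2 h3 h4 h5
    rw [h1, Pi.add_apply, h2, h3, Pi.smul_apply, Pi.smul_apply, smul_eq_mul, smul_eq_mul]
    positivity
  · have hl : ENNReal.ofReal a + ENNReal.ofReal b = 1 := by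
      rw [← ENNReal.ofReal_add ha hb, hab, ENNReal.ofReal_one]
    rw [excess_congr_ae (enorm_combo_ae hu.1 hw.1 ha hb)]
    calc _ ≤ ENNReal.ofReal a * excess (fun t => ‖u t‖ₑ) s
          + ENNReal.ofReal b * excess (fun t => ‖w t‖ₑ) s :=
          excess_convex_left (aemeasurable_enorm u) s _ _ hl
      _ ≤ ENNReal.ofReal a * excess (fun t => ‖x t‖ₑ) s
          + ENNReal.ofReal b * excess (fun t => ‖x t‖ₑ) s := by
          gcongr
          · exact hu.2 s
          · exact hw.2 s
      _ = _ := by rw [← add_mul, hl, one_mul]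

/-- Pointwise core of the extremality criterion. -/
theorem eq_of_tsub_combo_eq {a b u w z c : ℝ} (ha : 0 < a) (hb : 0 < b) (hab : a + b = 1)
    (hu : 0 ≤ u) (hw : 0 ≤ w) (hz : z = a * u + b * w) (hz' : z = 0 ∨ c ≤ z)
    (h : ∀ q : ℚ, 0 < q → max (z - (c + q)) 0
      = a * max (u - (c + q)) 0 + b * max (w - (c + q)) 0) : u = z := by
  have hbz : ∀ s, z - s = a * (u - s) + b * (w - s) := fun s => by
    rw [hz]; linear_combination s * hab
  rcases le_or_gt z c with hzc | hzc
  -- If z ≤ c, all the positive parts vanish and u, w are at most c. As z is 0 or c, it is an end of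
  -- the interval [0, c] containing u and w, so a proper mean equal to z forces u = z.
  · have hle : ∀ q : ℚ, 0 < q → u ≤ c + q ∧ w ≤ c + q := by
      intro q hq
      have h1 := h q hq
      have hq' : (0 : ℝ) < q := by exact_mod_cast hq
      rw [max_eq_right (by linarith)] at h1
      have h2 := le_max_right (u - (c + q)) 0
      have h3 := le_max_right (w - (c + q)) 0
      constructor
      · by_contra! hcon
        have := lt_of_lt_of_le (sub_pos.2 hcon) (le_max_left (u - (c + q)) 0)
        nlinarith [mul_pos ha this, mul_nonneg hb.le h3]
      · by_contra! hcon
        have := lt_of_lt_of_le (sub_pos.2 hcon) (le_max_left (w - (c + q)) 0)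
        nlinarith [mul_pos hb this, mul_nonneg ha.le h2]
    have huc : u ≤ c := le_of_forall_pos_lt_add fun ε hε => by
      obtain ⟨q, hq0, hq⟩ := exists_rat_btwn hε
      linarith [(hle q (by exact_mod_cast hq0)).1]
    have hwc : w ≤ c := le_of_forall_pos_lt_add fun ε hε => by
      obtain ⟨q, hq0, hq⟩ := exists_rat_btwn hε
      linarith [(hle q (by exact_mod_cast hq0)).2]
    rcases hz' with h0 | h0
    · have : a * u = 0 := by nlinarith [mul_nonneg ha.le hu, mul_nonneg hb.le hw]
      rcases mul_eq_zero.1 this with h1 | h1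
      · exact absurd h1 ha.ne'
      · rw [h1, h0]
    · have h2 : a * (c - u) + b * (c - w) ≤ 0 := by
        have : a * c + b * c = c := by rw [← add_mul, hab, one_mul]
        nlinarith
      have h3 := mul_nonneg ha.le (sub_nonneg.2 huc)
      have h4 := mul_nonneg hb.le (sub_nonneg.2 hwc)
      have h5 : a * (c - u) = 0 := by linarith
      rcases mul_eq_zero.1 h5 with h6 | h6
      · exact absurd h6 ha.ne'
      · linarith
  -- If z > c, equality at a level below z means that neither u nor w lies below that level. Letting
  -- the level rise to z gives u, w ≥ z, and their mean is z.
  · have hge : ∀ q : ℚ, 0 < q → c + q < z → c + q ≤ u ∧ c + q ≤ w := by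
      intro q hq hqz
      have h1 := h q hq
      rw [max_eq_left (by linarith), hbz] at h1
      have h2 := le_max_left (u - (c + q)) 0
      have h3 := le_max_left (w - (c + q)) 0
      have h4 := mul_le_mul_of_nonneg_left h2 ha.le
      have h5 := mul_le_mul_of_nonneg_left h3 hb.le
      have h6 : a * (u - (c + q)) = a * max (u - (c + q)) 0 := by linarith
      have h7 : b * (w - (c + q)) = b * max (w - (c + q)) 0 := by linarith
      have h8 := mul_left_cancel₀ ha.ne' h6
      have h9 := mul_left_cancel₀ hb.ne' h7
      have h10 := le_max_right (u - (c + q)) 0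
      have h11 := le_max_right (w - (c + q)) 0
      constructor <;> linarith
    have hzu : z ≤ u := le_of_forall_lt fun r hr => by
      obtain ⟨q, hq0, hq⟩ := exists_rat_btwn (show max (r - c) 0 < z - c from
        max_lt (by linarith) (by linarith))
      have h0 : (0 : ℝ) < q := lt_of_le_of_lt (le_max_right _ _) hq0
      have h1 : r - c < q := lt_of_le_of_lt (le_max_left _ _) hq0
      linarith [(hge q (by exact_mod_cast h0) (by linarith)).1]
    have hzw : z ≤ w := le_of_forall_lt fun r hr => by
      obtain ⟨q, hq0, hq⟩ := exists_rat_btwn (show max (r - c) 0 < z - c from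
        max_lt (by linarith) (by linarith))
      have h0 : (0 : ℝ) < q := lt_of_le_of_lt (le_max_right _ _) hq0
      have h1 : r - c < q := lt_of_le_of_lt (le_max_left _ _) hq0
      linarith [(hge q (by exact_mod_cast h0) (by linarith)).2]
    have h0 := hbz z
    have h3 := mul_nonneg ha.le (sub_nonneg.2 hzu)
    have h4 := mul_nonneg hb.le (sub_nonneg.2 hzw)
    have h5 : a * (u - z) = 0 := by linarith
    rcases mul_eq_zero.1 h5 with h6 | h6
    · exact absurd h6 ha.ne'
    · linarith

theorem toReal_tsub_eq_max {e s : ℝ≥0∞} (he : e ≠ ∞) (hs : s ≠ ∞) :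
    (e - s).toReal = max (e.toReal - s.toReal) 0 := by
  rcases le_total s e with h | h
  · rw [ENNReal.toReal_sub_of_le h he,
      max_eq_left (sub_nonneg.2 (ENNReal.toReal_mono he h))]
  · rw [tsub_eq_zero_of_le h, max_eq_right (sub_nonpos.2 (ENNReal.toReal_mono hs h)),
      ENNReal.toReal_zero]

/-- Functions with the same excess as `x` above its asymptote `c`, with values in `{0} ∪ [c, ∞)`,
are extreme points of the positive orbit of `x`. -/
theorem mem_extremePoints_of_excess_eq {x z : L0} (hx : x ∈ L1AddLInfty) (hz0 : 0 ≤ z)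
    (h : ∀ s, asymptote (fun t => ‖x t‖ₑ) < s →
      excess (fun t => ‖z t‖ₑ) s = excess (fun t => ‖x t‖ₑ) s)
    (hzc : ∀ᵐ t ∂semiAxis, ‖z t‖ₑ = 0 ∨ asymptote (fun t => ‖x t‖ₑ) ≤ ‖z t‖ₑ) :
    z ∈ (OmegaPlus x).extremePoints ℝ := by
  set c := asymptote fun t => ‖x t‖ₑ with hc
  obtain ⟨s0, hs0, hs0'⟩ := exists_excess_ne_top hx
  have hcfin : c ≠ ∞ := asymptote_ne_top hs0 hs0'
  have hle : ∀ s, excess (fun t => ‖z t‖ₑ) s ≤ excess (fun t => ‖x t‖ₑ) s := fun s => by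
    rcases lt_or_ge c s with hs | hs
    · exact (h s hs).le
    · exact excess_le_of_forall_lt (aemeasurable_enorm z) s fun r hr hr' => by
        rcases lt_or_ge c r with hs' | hs'
        · exact (h r hs').le
        · by_cases htop : excess (fun t => ‖x t‖ₑ) r = ∞
          · simp [htop]
          -- Only the level c itself is left, in case the excess of x is finite there; it is reached
          -- by right continuity from the levels above.
          · have hrc : r = c := le_antisymm hs' (sInf_le htop)
            rw [hrc]
            exact excess_le_of_forall_lt (aemeasurable_enorm z) c fun r' hr1 _ => (h r' hr1).le
  refine ⟨(mem_omegaPlus_iff hx).2 ⟨hz0, hle⟩, fun u hu w hw hzo => ?_⟩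
  obtain ⟨a, b, ha, hb, hab, rfl⟩ := hzo
  rw [mem_omegaPlus_iff hx] at hu hw
  have hl : ENNReal.ofReal a + ENNReal.ofReal b = 1 := by
    rw [← ENNReal.ofReal_add ha.le hb.le, hab, ENNReal.ofReal_one]
  have hco := enorm_combo_ae hu.1 hw.1 ha.le hb.le
  have key : ∀ q : ℚ, 0 < q → ∀ᵐ t ∂semiAxis,
      ‖(a • u + b • w : L0) t‖ₑ - (c + ENNReal.ofReal q)
        = ENNReal.ofReal a * (‖u t‖ₑ - (c + ENNReal.ofReal q))
          + ENNReal.ofReal b * (‖w t‖ₑ - (c + ENNReal.ofReal q)) := by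
    intro q hq
    have hq' : (0 : ℝ) < q := by exact_mod_cast hq
    set s := c + ENNReal.ofReal q
    have hs : c < s := ENNReal.lt_add_right hcfin (by simpa using hq')
    have hfin := excess_ne_top_of_asymptote_lt hs
    have hG : AEMeasurable (fun t => ENNReal.ofReal a * (‖u t‖ₑ - s)
        + ENNReal.ofReal b * (‖w t‖ₑ - s)) semiAxis :=
      (((aemeasurable_enorm u).sub_const s).const_mul _).add
        (((aemeasurable_enorm w).sub_const s).const_mul _)
    -- Convexity of the positive part gives one inequality pointwise. The integrals satisfy the
    -- reverse one, because z has the full excess of x while u and w have at most that; finiteness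
    -- above the asymptote turns this into equality almost everywhere.
    refine ae_eq_of_ae_le_of_lintegral_le ?_ ?_ hG ?_
    · filter_upwards [hco] with t ht
      rw [ht]
      exact tsub_convex_left _ _ _ _ _ hl
    · exact ne_top_of_le_ne_top hfin (hle s)
    · rw [lintegral_add_left' (((aemeasurable_enorm u).sub_const s).const_mul _),
        lintegral_const_mul' _ _ ENNReal.ofReal_ne_top,
        lintegral_const_mul' _ _ ENNReal.ofReal_ne_top]
      calc _ ≤ ENNReal.ofReal a * excess (fun t => ‖x t‖ₑ) s
            + ENNReal.ofReal b * excess (fun t => ‖x t‖ₑ) s := by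
            gcongr
            · exact hu.2 s
            · exact hw.2 s
        _ = excess (fun t => ‖x t‖ₑ) s := by rw [← add_mul, hl, one_mul]
        _ = _ := (h s hs).symm
  have hall : ∀ᵐ t ∂semiAxis, ∀ q : ℚ, 0 < q →
      ‖(a • u + b • w : L0) t‖ₑ - (c + ENNReal.ofReal q)
        = ENNReal.ofReal a * (‖u t‖ₑ - (c + ENNReal.ofReal q))
          + ENNReal.ofReal b * (‖w t‖ₑ - (c + ENNReal.ofReal q)) := by
    rw [ae_all_iff]
    intro q
    by_cases hq : 0 < q
    · exact (key q hq).mono fun t ht _ => ht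
    · exact Eventually.of_forall fun t hq' => absurd hq' hq
  have hmain : ∀ᵐ t ∂semiAxis, u t = (a • u + b • w : L0) t := by
    filter_upwards [hall, hzc, AEEqFun.coeFn_add (a • u) (b • w), AEEqFun.coeFn_smul a u,
      AEEqFun.coeFn_smul b w, nonneg_iff_ae.1 hu.1, nonneg_iff_ae.1 hw.1, nonneg_iff_ae.1 hz0]
      with t h1 h2 h3 h4 h5 h6 h7 h8
    have hzt : (a • u + b • w : L0) t = a * u t + b * w t := by
      rw [h3, Pi.add_apply, h4, h5]; rfl
    refine eq_of_tsub_combo_eq (c := c.toReal) ha hb hab h6 h7 hzt ?_ ?_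
    · rcases h2 with h2 | h2
      · left; simpa using h2
      · right
        rw [Real.enorm_eq_ofReal h8] at h2
        exact ENNReal.toReal_le_of_le_ofReal h8 h2
    · intro q hq
      have hq' : (0 : ℝ) < q := by exact_mod_cast hq
      have h9 := congrArg ENNReal.toReal (h1 q hq)
      have hsf : c + ENNReal.ofReal q ≠ ∞ := by simp [hcfin]
      rw [ENNReal.toReal_add (ENNReal.mul_ne_top (by simp) (ne_top_of_le_ne_top enorm_ne_top
          tsub_le_self)) (ENNReal.mul_ne_top (by simp) (ne_top_of_le_ne_top enorm_ne_top
          tsub_le_self)), ENNReal.toReal_mul, ENNReal.toReal_mul,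
        toReal_tsub_eq_max enorm_ne_top hsf, toReal_tsub_eq_max enorm_ne_top hsf,
        toReal_tsub_eq_max enorm_ne_top hsf, ENNReal.toReal_add hcfin (by simp),
        ENNReal.toReal_ofReal hq'.le, ENNReal.toReal_ofReal ha.le, ENNReal.toReal_ofReal hb.le,
        toReal_enorm, toReal_enorm, toReal_enorm, Real.norm_of_nonneg h6, Real.norm_of_nonneg h7,
        Real.norm_of_nonneg h8] at h9
      exact h9
  exact AEEqFun.ext hmain

/-! ### Norm-closedness of the orbit. -/

namespace BanachIdealLattice

variable {E : BanachIdealLattice}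

theorem extNorm_sub_eq {y z : L0} (hy : y ∈ E.carrier) (hz : z ∈ E.carrier) :
    E.extNorm (fun t => ‖y t - z t‖ₑ) = ENNReal.ofReal (E.norm (y - z)) := by
  rw [← extNorm_enorm (E.carrier.sub_mem hy hz)]
  have : ∀ᵐ t ∂semiAxis, ‖y t - z t‖ₑ = ‖(y - z : L0) t‖ₑ := by
    filter_upwards [AEEqFun.coeFn_sub y z] with t ht
    rw [ht, Pi.sub_apply]
  exact le_antisymm (extNorm_mono_ae (this.mono fun t ht => ht.le))
    (extNorm_mono_ae (this.mono fun t ht => ht.ge))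

theorem omegaPlus_subset (hE : E.IsFullySymmetric) {x y : L0} (hx : x ∈ E.carrier)
    (hy : y ∈ OmegaPlus x) : y ∈ E.carrier :=
  (hE.2 x hx y hy.2.1 hy.2.2).1

/-- An approximant z with Φ_{|y-z|}(d) ≤ d gives Φ_|y|(s + d) ≤ Φ_|z|(s) + d ≤ Φ_|x|(s) + d, and d
tends to 0 by right continuity. Positivity passes to the limit in the same way, since (-y)⁺ ≤ |y -
z| for z ≥ 0. -/
theorem normClosure_omegaPlus_subset (hE : E.IsFullySymmetric)
    {x : L0} (hx : x ∈ E.carrier) :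
    E.normClosure (OmegaPlus x) ⊆ OmegaPlus x := by
  rintro y ⟨hyE, hy⟩
  have hx1 := mem_L1AddLInfty hE hx
  have key : ∀ d : ℝ≥0∞, d ≠ 0 → d ≠ ∞ → ∃ z ∈ OmegaPlus x,
      excess (fun t => ‖y t - z t‖ₑ) d ≤ d := by
    intro d hd0 hd
    have hpos : 0 < d * E.extNorm unitIndicator :=
      ENNReal.mul_pos hd0 extNorm_unitIndicator_ne_zero
    obtain ⟨ε, hε, hε'⟩ := ENNReal.lt_iff_exists_nnreal_btwn.1 hpos
    obtain ⟨z, hz, hzE, hyz⟩ := hy ε (by exact_mod_cast hε)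
    refine ⟨z, hz, excess_le_of_extNorm_lt hE hd0 hd (lt_of_le_of_lt ?_ hε')⟩
    rw [extNorm_sub_eq hyE hzE]
    exact (ENNReal.ofReal_le_ofReal hyz.le).trans (by simp)
  have hmeas : ∀ z : L0, AEMeasurable (fun t => ‖y t - z t‖ₑ) semiAxis := fun z =>
    (y.aestronglyMeasurable.sub z.aestronglyMeasurable).enorm
  rw [mem_omegaPlus_iff hx1]
  constructor
  · rw [nonneg_iff_ae]
    have hneg : ∀ s, s ≠ 0 → s ≠ ∞ → excess (fun t => ENNReal.ofReal (-y t)) s ≤ s := by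
      intro s hs0 hs
      obtain ⟨z, hz, h⟩ := key s hs0 hs
      refine (excess_mono_ae ?_ s).trans h
      filter_upwards [nonneg_iff_ae.1 hz.1] with t ht
      rw [Real.enorm_eq_ofReal_abs]
      exact ENNReal.ofReal_le_ofReal ((by linarith : -y t ≤ -(y t - z t)).trans (neg_le_abs _))
    have hm : AEMeasurable (fun t => ENNReal.ofReal (-y t)) semiAxis :=
      (y.measurable.neg.ennreal_ofReal).aemeasurable
    have h0 : excess (fun t => ENNReal.ofReal (-y t)) 0 = 0 := by
      have h1 := tendsto_excess hm 0 (antitone_add_inv_nat 0) (tendsto_add_inv_nat 0)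
      exact le_antisymm (le_of_tendsto_of_tendsto' h1 (tendsto_add_inv_nat 0)
        fun n => hneg _ (by simp) (by simp)) zero_le
    rw [excess_zero_right, lintegral_eq_zero_iff' hm] at h0
    filter_upwards [h0] with t ht
    simpa using ht
  · intro s
    have h1 : ∀ n : ℕ, excess (fun t => ‖y t‖ₑ) (s + (0 + ((n : ℝ≥0∞) + 1)⁻¹))
        ≤ excess (fun t => ‖x t‖ₑ) s + (0 + ((n : ℝ≥0∞) + 1)⁻¹) := by
      intro n
      obtain ⟨z, hz, h⟩ := key (0 + ((n : ℝ≥0∞) + 1)⁻¹) (by simp) (by simp)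
      have hz' := (mem_omegaPlus_iff hx1).1 hz
      calc excess (fun t => ‖y t‖ₑ) (s + (0 + ((n : ℝ≥0∞) + 1)⁻¹))
          ≤ excess (fun t => ‖z t‖ₑ + ‖y t - z t‖ₑ) (s + (0 + ((n : ℝ≥0∞) + 1)⁻¹)) := by
            refine excess_mono_ae (Eventually.of_forall fun t => ?_) _
            calc ‖y t‖ₑ = ‖z t + (y t - z t)‖ₑ := by ring_nf
              _ ≤ _ := enorm_add_le _ _
        _ ≤ _ := excess_add_le (aemeasurable_enorm z) _ _
        _ ≤ _ := add_le_add (hz'.2 s) h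
    have h2 := tendsto_excess (aemeasurable_enorm y) s (antitone_add_inv_nat s)
      (tendsto_add_inv_nat s)
    simp only [zero_add] at h1
    have h3 := (tendsto_const_nhds (x := excess (fun t => ‖x t‖ₑ) s)).add
      (tendsto_add_inv_nat 0)
    simp only [zero_add, add_zero] at h3
    exact le_of_tendsto_of_tendsto' h2 h3 h1

theorem qPlus_subset (hE : E.IsFullySymmetric) {x : L0} (hx : x ∈ E.carrier) :
    E.QPlus x ⊆ OmegaPlus x := by
  rintro y ⟨hyE, hy⟩
  refine normClosure_omegaPlus_subset hE hx ⟨hyE, fun ε hε => ?_⟩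
  obtain ⟨z, hz, h⟩ := hy ε hε
  exact ⟨z, convexHull_min extremePoints_subset (convex_omegaPlus (mem_L1AddLInfty hE hx)) hz, h⟩

end BanachIdealLattice

/-! ### Cutting windows with prescribed averages out of a decreasing function -/

/-- Remove from `f` its restriction to `[a, a + p)`. -/
noncomputable def removeWindow (f : ℝ → ℝ≥0∞) (a p : ℝ) : ℝ → ℝ≥0∞ :=
  fun t => if t < a then f t else f (t + p)

theorem removeWindow_antitone {f : ℝ → ℝ≥0∞} (hf : Antitone f) (a : ℝ) {p : ℝ} (hp : 0 ≤ p) :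
    Antitone (removeWindow f a p) := by
  intro s t hst
  unfold removeWindow
  split_ifs with h1 h2 h2
  · exact hf hst
  · linarith
  · exact hf (by linarith)
  · exact hf (by linarith)

theorem removeWindow_le {f : ℝ → ℝ≥0∞} (hf : Antitone f) (a : ℝ) {p : ℝ} (hp : 0 ≤ p) (t : ℝ) :
    removeWindow f a p t ≤ f t := by
  unfold removeWindow
  split_ifs with h1
  · exact le_rfl
  · exact hf (by linarith)

theorem setLIntegral_Ioc_comp_add (e : ℝ → ℝ≥0∞) (a p : ℝ) :
    ∫⁻ t in Ioc 0 p, e (t + a) = ∫⁻ t in Ioc a (a + p), e t := by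
  have h := (measurePreserving_add_right volume a).setLIntegral_comp_preimage_emb
    (MeasurableEquiv.addRight a).measurableEmbedding e (Ioc a (a + p))
  rw [← h]
  congr 2
  ext t
  simp only [mem_preimage, mem_Ioc]
  constructor <;> rintro ⟨h1, h2⟩ <;> constructor <;> linarith

theorem setLIntegral_Ioi_comp_add (e : ℝ → ℝ≥0∞) (a p : ℝ) :
    ∫⁻ t in Ioi a, e (t + p) = ∫⁻ t in Ioi (a + p), e t := by
  have h := (measurePreserving_add_right volume p).setLIntegral_comp_preimage_emb
    (MeasurableEquiv.addRight p).measurableEmbedding e (Ioi (a + p))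
  rw [← h]
  congr 2
  ext t
  simp

theorem excess_eq_window_add_removeWindow (f : ℝ → ℝ≥0∞) {a p : ℝ} (ha : 0 ≤ a) (hp : 0 ≤ p)
    (s : ℝ≥0∞) :
    excess f s = (∫⁻ t in Ioc a (a + p), (f t - s)) + excess (removeWindow f a p) s := by
  have hd : ∀ a b : ℝ, Disjoint (Ioc a b) (Ioi b) := fun a b =>
    Set.disjoint_left.2 fun u hu hu' => absurd hu.2 (not_le.2 hu')
  have e1 : excess f s = (∫⁻ t in Ioc 0 a, (f t - s)) + ((∫⁻ t in Ioc a (a + p), (f t - s))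
      + ∫⁻ t in Ioi (a + p), (f t - s)) := by
    rw [excess, semiAxis, ← Ioc_union_Ioi_eq_Ioi ha, lintegral_union measurableSet_Ioi (hd _ _),
      ← Ioc_union_Ioi_eq_Ioi (show a ≤ a + p by linarith),
      lintegral_union measurableSet_Ioi (hd _ _)]
  have e2 : excess (removeWindow f a p) s = (∫⁻ t in Ioc 0 a, (f t - s))
      + ∫⁻ t in Ioi (a + p), (f t - s) := by
    rw [excess, semiAxis, ← Ioc_union_Ioi_eq_Ioi ha, lintegral_union measurableSet_Ioi (hd _ _)]
    congr 1
    · rw [← setLIntegral_Ioo_eq_Ioc, ← setLIntegral_Ioo_eq_Ioc]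
      refine setLIntegral_congr_fun measurableSet_Ioo fun t ht => ?_
      simp [removeWindow, ht.2]
    · rw [← setLIntegral_Ioi_comp_add (fun t => f t - s) a p]
      refine setLIntegral_congr_fun measurableSet_Ioi fun t ht => ?_
      simp only [removeWindow, if_neg (not_lt.2 (le_of_lt (mem_Ioi.1 ht)))]
  rw [e1, e2]
  ring

theorem antitone_ne_top {f : ℝ → ℝ≥0∞} (hf : Antitone f) {s : ℝ≥0∞} (hs : s ≠ ∞)
    (h : excess f s ≠ ∞) {t : ℝ} (ht : 0 < t) : f t ≠ ∞ := by
  intro htop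
  have h1 := setLIntegral_ne_top hs h (B := Ioc 0 t) (fun u hu => hu.1) (by simp)
  rw [setLIntegral_congr_fun (g := fun _ => ∞) measurableSet_Ioc
    (fun u hu => top_le_iff.1 (htop ▸ hf hu.2)), setLIntegral_const] at h1
  simp [ENNReal.top_mul, ht] at h1

theorem exists_le_of_excess {f : ℝ → ℝ≥0∞} {s : ℝ≥0∞} (h : excess f s ≠ ∞) {r : ℝ≥0∞} (hr : s < r) :
    ∃ t : ℝ, 0 < t ∧ f t ≤ r := by
  by_contra! hcon
  refine h (top_le_iff.1 ?_)
  calc ∞ = ∫⁻ _ in Ioi (0 : ℝ), (r - s) := by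
        rw [setLIntegral_const, Real.volume_Ioi, ENNReal.mul_top (tsub_pos_of_lt hr).ne']
    _ ≤ _ := setLIntegral_mono' measurableSet_Ioi fun t ht => tsub_le_tsub_right (hcon t ht).le s

/-- The integral of `f` over (a, a + p] is continuous in a. At a = 0 its mean is at least η, by the
hypothesis at level `f p`; far out it is at most η, since finite excess at η/2 brings `f` below η.
The intermediate value theorem does the rest. -/
theorem exists_window {f : ℝ → ℝ≥0∞} (hf : Antitone f) (hfin : ∀ s, s ≠ 0 → excess f s ≠ ∞)
    {p : ℝ} (hp : 0 ≤ p) {η : ℝ≥0∞} (hη0 : η ≠ 0) (hη : η ≠ ∞)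
    (h : ∀ s, ENNReal.ofReal p * (η - s) ≤ excess f s) :
    ∃ a : ℝ, 0 ≤ a ∧ ∫⁻ t in Ioc a (a + p), f t = ENNReal.ofReal p * η := by
  rcases hp.eq_or_lt with rfl | hp'
  · exact ⟨0, le_rfl, by simp⟩
  have hfin1 := hfin 1 one_ne_zero
  have hIoc : ∀ a b : ℝ, 0 ≤ a → ∫⁻ t in Ioc a b, f t ≠ ∞ := fun a b ha =>
    setLIntegral_ne_top ENNReal.one_ne_top hfin1 (fun u hu => lt_of_le_of_lt ha hu.1) (by simp)
  set F : ℝ → ℝ := (Ioi (0 : ℝ)).indicator fun t => (f t).toReal with hF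
  have hFm : Measurable F := hf.measurable.ennreal_toReal.indicator measurableSet_Ioi
  have hFe : ∀ t, 0 < t → ‖F t‖ₑ = f t := fun t ht => by
    rw [hF, indicator_of_mem (show t ∈ Ioi (0 : ℝ) from ht),
      Real.enorm_eq_ofReal ENNReal.toReal_nonneg,
      ENNReal.ofReal_toReal (antitone_ne_top hf ENNReal.one_ne_top hfin1 ht)]
  have hFle : ∀ t, ‖F t‖ₑ ≤ (Ioi (0 : ℝ)).indicator f t := fun t => by
    by_cases ht : t ∈ Ioi (0 : ℝ)
    · rw [hFe t ht, indicator_of_mem ht]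
    · simp [hF, ht]
  have hFi : ∀ a b : ℝ, IntegrableOn F (Ioc a b) := fun a b => by
    refine ⟨hFm.aestronglyMeasurable, ?_⟩
    refine lt_of_le_of_lt (lintegral_mono fun t => hFle t) ?_
    rw [lintegral_indicator measurableSet_Ioi, Measure.restrict_restrict measurableSet_Ioi]
    refine lt_of_le_of_lt (lintegral_mono_set (t := Ioc 0 b) fun u hu => ⟨hu.1, hu.2.2⟩) ?_
    exact lt_top_iff_ne_top.2 (hIoc 0 b le_rfl)
  have hFI : ∀ a b : ℝ, IntervalIntegrable F volume a b := fun a b => ⟨hFi _ _, hFi _ _⟩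
  have hcont : Continuous fun a : ℝ => ∫ t in a..(a + p), F t := by
    have h1 := intervalIntegral.continuous_primitive hFI 0
    have h2 : (fun a : ℝ => ∫ t in a..(a + p), F t)
        = fun a => (∫ t in (0 : ℝ)..(a + p), F t) - ∫ t in (0 : ℝ)..a, F t := by
      funext a
      rw [intervalIntegral.integral_interval_sub_left (hFI _ _) (hFI _ _)]
    rw [h2]
    exact (h1.comp (continuous_add_const p)).sub h1
  have hval : ∀ a : ℝ, 0 ≤ a → ENNReal.ofReal (∫ t in a..(a + p), F t)
      = ∫⁻ t in Ioc a (a + p), f t := by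
    intro a ha
    rw [intervalIntegral.integral_of_le (by linarith), ofReal_integral_eq_lintegral_ofReal (hFi _ _)
      (Eventually.of_forall fun t => indicator_nonneg (fun _ _ => ENNReal.toReal_nonneg) t)]
    refine setLIntegral_congr_fun measurableSet_Ioc fun t ht => ?_
    have ht0 : 0 < t := lt_of_le_of_lt ha ht.1
    rw [← hFe t ht0, Real.enorm_eq_ofReal]
    exact indicator_nonneg (fun _ _ => ENNReal.toReal_nonneg) t
  have hnn : ∀ a : ℝ, 0 ≤ ∫ t in a..(a + p), F t := fun a =>
    intervalIntegral.integral_nonneg (by linarith) fun t _ =>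
      indicator_nonneg (fun _ _ => ENNReal.toReal_nonneg) t
  have hlow : (ENNReal.ofReal p * η).toReal ≤ ∫ t in (0 : ℝ)..(0 + p), F t := by
    refine ENNReal.toReal_le_of_le_ofReal (hnn 0) ?_
    rw [hval 0 le_rfl, zero_add, ← excess_add_eq_primitive hf hp]
    calc ENNReal.ofReal p * η ≤ ENNReal.ofReal p * ((η - f p) + f p) := by
          gcongr; exact le_tsub_add
      _ = ENNReal.ofReal p * (η - f p) + f p * ENNReal.ofReal p := by ring
      _ ≤ _ := by gcongr; exact h _
  obtain ⟨b, hb0, hb⟩ := exists_le_of_excess (s := η / 2)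
    (hfin _ (by simp [hη0])) (ENNReal.half_lt_self hη0 hη)
  have hup : (∫ t in b..(b + p), F t) ≤ (ENNReal.ofReal p * η).toReal := by
    rw [← ENNReal.ofReal_le_iff_le_toReal (ENNReal.mul_ne_top (by simp) hη), hval b hb0.le]
    calc ∫⁻ t in Ioc b (b + p), f t ≤ ∫⁻ _ in Ioc b (b + p), η :=
          setLIntegral_mono' measurableSet_Ioc fun t ht => (hf ht.1.le).trans hb
      _ = _ := by rw [setLIntegral_const, Real.volume_Ioc, mul_comm]; congr 2; ring
  obtain ⟨a, ha, hae⟩ := intermediate_value_Icc' hb0.le hcont.continuousOn ⟨hup, hlow⟩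
  refine ⟨a, ha.1, ?_⟩
  rw [← hval a ha.1]
  have hae' : (∫ t in a..(a + p), F t) = (ENNReal.ofReal p * η).toReal := hae
  rw [hae', ENNReal.ofReal_toReal (ENNReal.mul_ne_top (by simp) hη)]

/-- The map s ↦ (x - s)⁺ is affine on [b, a] as soon as x avoids the open interval (b, a). For
functions with a gap in their values the convexity inequality for excess thus becomes an equality.
-/
theorem tsub_affine {x a b l m : ℝ≥0∞} (hlm : l + m = 1) (hba : b ≤ a) (ha : a ≠ ∞)
    (hx : x ≤ b ∨ a ≤ x) :
    x - (l * a + m * b) = l * (x - a) + m * (x - b) := by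
  have hl : l ≠ ∞ := fun hl => by simp [hl] at hlm
  have hm : m ≠ ∞ := fun hm => by simp [hm] at hlm
  have hb : b ≠ ∞ := ne_top_of_le_ne_top ha hba
  rcases hx with hx | hx
  · have h1 : b ≤ l * a + m * b := by
      calc b = l * b + m * b := by rw [← add_mul, hlm, one_mul]
        _ ≤ _ := by gcongr
    rw [tsub_eq_zero_of_le (hx.trans h1), tsub_eq_zero_of_le hx, tsub_eq_zero_of_le (hx.trans hba)]
    simp
  · have hs : l * a + m * b ≠ ∞ :=
      ENNReal.add_ne_top.2 ⟨ENNReal.mul_ne_top hl ha, ENNReal.mul_ne_top hm hb⟩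
    refine ENNReal.sub_eq_of_eq_add_rev hs ?_
    calc x = l * x + m * x := by rw [← add_mul, hlm, one_mul]
      _ = l * (a + (x - a)) + m * (b + (x - b)) := by
          rw [add_tsub_cancel_of_le hx, add_tsub_cancel_of_le (hba.trans hx)]
      _ = _ := by ring

theorem exists_convex_combo {a b s : ℝ≥0∞} (hbs : b ≤ s) (hsa : s ≤ a) (ha : a ≠ ∞) :
    ∃ l m : ℝ≥0∞, l + m = 1 ∧ s = l * a + m * b := by
  have hs : s ≠ ∞ := ne_top_of_le_ne_top ha hsa
  have hb : b ≠ ∞ := ne_top_of_le_ne_top hs hbs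
  have hmem : s.toReal ∈ segment ℝ b.toReal a.toReal := by
    rw [segment_eq_Icc (ENNReal.toReal_mono ha (hbs.trans hsa))]
    exact ⟨ENNReal.toReal_mono hs hbs, ENNReal.toReal_mono ha hsa⟩
  obtain ⟨m, l, hm, hl, hlm, h⟩ := hmem
  refine ⟨ENNReal.ofReal l, ENNReal.ofReal m, ?_, ?_⟩
  · rw [← ENNReal.ofReal_add hl hm, add_comm, hlm, ENNReal.ofReal_one]
  · rw [← ENNReal.ofReal_toReal hs, ← h, ENNReal.ofReal_add (by simp; positivity)
      (by simp; positivity), smul_eq_mul, smul_eq_mul, ENNReal.ofReal_mul hm,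
      ENNReal.ofReal_mul hl, ENNReal.ofReal_toReal ha, ENNReal.ofReal_toReal hb, add_comm]

/-- After a window has been removed from `f` and its average from the competing distribution,
the domination of the excess persists. -/
theorem le_excess_removeWindow {f : ℝ → ℝ≥0∞} (hf : Antitone f)
    (hfin : ∀ s, s ≠ 0 → excess f s ≠ ∞) {p : ℝ} (hp : 0 ≤ p) {η : ℝ≥0∞} (hη : η ≠ ∞)
    {T : ℝ≥0∞ → ℝ≥0∞} (hT : Antitone T)
    (hTc : ∀ a b l m : ℝ≥0∞, l + m = 1 → T (l * a + m * b) ≤ l * T a + m * T b)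
    (h : ∀ s, ENNReal.ofReal p * (η - s) + T s ≤ excess f s)
    {a : ℝ} (ha : 0 ≤ a) (hwin : ∫⁻ t in Ioc a (a + p), f t = ENNReal.ofReal p * η) (s : ℝ≥0∞) :
    T s ≤ excess (removeWindow f a p) s := by
  rcases hp.eq_or_lt with rfl | hp'
  · have := excess_eq_window_add_removeWindow f ha le_rfl s
    simp only [add_zero, Ioc_self, Measure.restrict_empty, lintegral_zero_measure, zero_add] at this
    rw [← this]
    exact le_add_self.trans (h s)
  have hfa : ∀ t, 0 < t → f t ≠ ∞ := fun t ht =>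
    antitone_ne_top hf ENNReal.one_ne_top (hfin 1 one_ne_zero) ht
  have hpη : ENNReal.ofReal p * η ≠ ∞ := ENNReal.mul_ne_top (by simp) hη
  have hsplit := excess_eq_window_add_removeWindow f ha hp
  -- Below all values of the window, its contribution is its integral minus ps, hence at most p(η -
  -- s)⁺, and can be cancelled from the hypothesis.
  have hlow : ∀ s, s ≤ f (a + p) → T s ≤ excess (removeWindow f a p) s := by
    intro s hs
    have hsf : s ≠ ∞ := ne_top_of_le_ne_top (hfa _ (by linarith)) hs
    have h1 := setLIntegral_tsub_add (B := Ioc a (a + p)) (e := f) (s := s) measurableSet_Ioc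
      fun t ht => hs.trans (hf ht.2)
    rw [hwin, Real.volume_Ioc, add_sub_cancel_left] at h1
    have h2 : ∫⁻ t in Ioc a (a + p), (f t - s) ≤ ENNReal.ofReal p * (η - s) := by
      refine (ENNReal.add_le_add_iff_right (a := s * ENNReal.ofReal p)
        (ENNReal.mul_ne_top hsf (by simp))).1 ?_
      rw [h1]
      calc ENNReal.ofReal p * η ≤ ENNReal.ofReal p * ((η - s) + s) := by
            gcongr; exact le_tsub_add
        _ = _ := by ring
    have h3 := h s
    rw [hsplit s] at h3
    have h4 : (∫⁻ t in Ioc a (a + p), (f t - s)) ≠ ∞ :=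
      ne_top_of_le_ne_top hpη (by rw [← h1]; exact le_self_add)
    exact (ENNReal.add_le_add_iff_left h4).1 ((add_le_add h2 le_rfl).trans h3)
  rcases le_total s (f (a + p)) with hs | hs
  · exact hlow s hs
  have hafter : ∀ t, a ≤ t → removeWindow f a p t ≤ f (a + p) := fun t ht => by
    simp only [removeWindow, not_lt.2 ht, if_false]
    exact hf (by linarith)
  rcases ha.eq_or_lt with rfl | ha'
  · have h0 : excess (removeWindow f 0 p) (f (0 + p)) = 0 := by
      unfold excess
      rw [setLIntegral_congr_fun (g := fun _ => 0) measurableSet_Ioi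
        fun t ht => tsub_eq_zero_of_le (hafter t (le_of_lt ht))]
      simp
    exact ((hT hs).trans (hlow _ le_rfl)).trans (h0.le.trans zero_le)
  rcases le_total (f a) s with hs' | hs'
  · have h1 := h s
    rw [hsplit s, setLIntegral_congr_fun (s := Ioc a (a + p)) (g := fun _ => 0) measurableSet_Ioc
      fun t ht => tsub_eq_zero_of_le ((hf ht.1.le).trans hs')] at h1
    simp only [lintegral_zero, zero_add] at h1
    exact le_add_self.trans h1
  have hhigh : T (f a) ≤ excess (removeWindow f a p) (f a) := by
    have h1 := h (f a)
    rw [hsplit (f a), setLIntegral_congr_fun (s := Ioc a (a + p)) (g := fun _ => 0)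
      measurableSet_Ioc fun t ht => tsub_eq_zero_of_le (hf ht.1.le)] at h1
    simp only [lintegral_zero, zero_add] at h1
    exact le_add_self.trans h1
  -- The rest takes no values strictly between f(a + p) and f(a), so its excess is affine on that
  -- range of levels, whereas T is convex: the two endpoints decide.
  obtain ⟨l, m, hlm, rfl⟩ := exists_convex_combo hs hs' (hfa a ha')
  have hl : l ≠ ∞ := fun hl => by simp [hl] at hlm
  have hm : m ≠ ∞ := fun hm => by simp [hm] at hlm
  have hmeas : Measurable (removeWindow f a p) := (removeWindow_antitone hf a hp).measurable
  calc T (l * f a + m * f (a + p)) ≤ l * T (f a) + m * T (f (a + p)) := hTc _ _ _ _ hlm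
    _ ≤ l * excess (removeWindow f a p) (f a) + m * excess (removeWindow f a p) (f (a + p)) := by
        gcongr
        exact hlow _ le_rfl
    _ = _ := by
        unfold excess
        rw [← lintegral_const_mul' l _ hl, ← lintegral_const_mul' m _ hm,
          ← lintegral_add_left ((hmeas.sub_const _).const_mul l)]
        refine lintegral_congr fun t => (tsub_affine hlm (hf (by linarith)) (hfa a ha') ?_).symm
        rcases lt_or_ge t a with ht | ht
        · right
          simp only [removeWindow, ht, if_true]
          exact hf ht.le
        · exact Or.inl (hafter t ht)

/-- A decreasing function dominating the distribution `∑ pⱼ δ_{ηⱼ}` splits into windows with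
averages `ηⱼ` and a decreasing remainder. -/
theorem exists_windows {f : ℝ → ℝ≥0∞} (hf : Antitone f) (hfin : ∀ s, s ≠ 0 → excess f s ≠ ∞)
    {p : ℕ → ℝ} (hp : ∀ j, 0 ≤ p j) {η : ℕ → ℝ≥0∞} (hη0 : ∀ j, η j ≠ 0) (hη : ∀ j, η j ≠ ∞)
    (h : ∀ s, ∑' j, ENNReal.ofReal (p j) * (η j - s) ≤ excess f s) :
    ∃ (w : ℕ → ℝ → ℝ≥0∞) (g : ℝ → ℝ≥0∞), (∀ j, Antitone (w j)) ∧ Antitone g ∧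
      (∀ j, ∫⁻ t in Ioc 0 (p j), w j t = ENNReal.ofReal (p j) * η j) ∧
      ∀ s, s ≠ 0 → (∑' j, ∫⁻ t in Ioc 0 (p j), (w j t - s)) + excess g s = excess f s := by
  -- Invariant of the greedy construction: after n windows have been removed, the decreasing rest
  -- still dominates the distribution formed by the remaining lengths and averages.
  let P : ℕ → (ℝ → ℝ≥0∞) → Prop := fun n x => Antitone x ∧ (∀ s, s ≠ 0 → excess x s ≠ ∞) ∧
    ∀ s, ∑' j, ENNReal.ofReal (p (j + n)) * (η (j + n) - s) ≤ excess x s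
  have step : ∀ n (x : ℝ → ℝ≥0∞), P n x → ∃ a : ℝ, 0 ≤ a ∧
      (∫⁻ t in Ioc a (a + p n), x t = ENNReal.ofReal (p n) * η n) ∧
      P (n + 1) (removeWindow x a (p n)) := by
    rintro n x ⟨hx1, hx2, hx3⟩
    have hT : ∀ s, ENNReal.ofReal (p n) * (η n - s)
        + ∑' j, ENNReal.ofReal (p (j + (n + 1))) * (η (j + (n + 1)) - s) ≤ excess x s := by
      intro s
      refine le_trans (le_of_eq ?_) (hx3 s)
      rw [tsum_eq_zero_add' (f := fun j => ENNReal.ofReal (p (j + n)) * (η (j + n) - s))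
        ENNReal.summable]
      simp only [zero_add, add_assoc, add_comm 1 n]
    obtain ⟨a, ha, hwin⟩ := exists_window hx1 hx2 (hp n) (hη0 n) (hη n)
      fun s => le_self_add.trans (hT s)
    refine ⟨a, ha, hwin, removeWindow_antitone hx1 a (hp n), fun s hs => ?_, fun s => ?_⟩
    · refine ne_top_of_le_ne_top (hx2 s hs) ?_
      rw [excess_eq_window_add_removeWindow x ha (hp n) s]
      exact le_add_self
    · refine le_excess_removeWindow hx1 hx2 (hp n) (hη n) ?_ ?_ hT ha hwin s
      · intro s s' hss
        dsimp only
        gcongr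
      · intro a b l m hlm
        rw [← ENNReal.tsum_mul_left, ← ENNReal.tsum_mul_left, ← ENNReal.tsum_add]
        refine ENNReal.tsum_le_tsum fun j => ?_
        calc _ ≤ ENNReal.ofReal (p (j + (n + 1))) * (l * (η (j + (n + 1)) - a)
              + m * (η (j + (n + 1)) - b)) := by
              gcongr; exact tsub_convex _ _ _ _ _ hlm
          _ = _ := by ring
  choose! a ha hwin hnext using step
  let x : ℕ → ℝ → ℝ≥0∞ := fun n => Nat.rec f (fun n x => removeWindow x (a n x) (p n)) n
  have hx0 : x 0 = f := rfl
  have hxs : ∀ n, x (n + 1) = removeWindow (x n) (a n (x n)) (p n) := fun n => rfl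
  have hP : ∀ n, P n (x n) := by
    intro n
    induction n with
    | zero => exact ⟨hf, hfin, h⟩
    | succ n ih => rw [hxs]; exact hnext n (x n) ih
  have hanti : Antitone x := antitone_nat_of_succ_le fun n t => by
    rw [hxs]
    exact removeWindow_le (hP n).1 _ (hp n) t
  refine ⟨fun j t => x j (t + a j (x j)), fun t => ⨅ n, x n t, fun j s t hst =>
    (hP j).1 (by linarith), fun s t hst => iInf_mono fun n => (hP n).1 hst, fun j => ?_,
    fun s hs => ?_⟩
  · rw [setLIntegral_Ioc_comp_add]
    exact hwin j _ (hP j)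
  · have hsum : ∀ n, (∑ j ∈ Finset.range n, ∫⁻ t in Ioc 0 (p j), (x j (t + a j (x j)) - s))
        + excess (x n) s = excess f s := by
      intro n
      induction n with
      | zero => simp [hx0]
      | succ n ih =>
        rw [← ih, Finset.sum_range_succ, hxs,
          excess_eq_window_add_removeWindow (x n) (ha n _ (hP n)) (hp n) s,
          setLIntegral_Ioc_comp_add (fun t => x n t - s), add_assoc]
    have hlim1 := ENNReal.tendsto_nat_tsum
      fun j => ∫⁻ t in Ioc 0 (p j), (x j (t + a j (x j)) - s)
    -- The rests decrease to the final remainder. Monotone convergence from above needs finite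
    -- excess, whence the restriction to s ≠ 0.
    have hlim2 : Tendsto (fun n => excess (x n) s) atTop (𝓝 (excess (fun t => ⨅ n, x n t) s)) := by
      have e1 : excess (fun t => ⨅ n, x n t) s = ⨅ n, excess (x n) s := by
        unfold excess
        rw [← lintegral_iInf (fun n => (hP n).1.measurable.sub_const s)
          (fun m n hmn t => tsub_le_tsub_right (hanti hmn t) s)
          (by exact hfin s hs)]
        exact lintegral_congr fun t => Monotone.map_ciInf_of_continuousAt
          (ENNReal.continuous_sub_right s).continuousAt
          (fun a b hab => tsub_le_tsub_right hab s) (OrderBot.bddBelow _)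
      rw [e1]
      exact tendsto_atTop_iInf fun m n hmn => lintegral_mono fun t =>
        tsub_le_tsub_right (hanti hmn t) s
    have := hlim1.add hlim2
    simp only [hsum] at this
    exact tendsto_nhds_unique this tendsto_const_nhds

/-! ### Transport of functions from intervals to measurable sets -/

/-- `|R ∩ (0, t]|`. As a map from `R` onto an interval it preserves the measure. -/
noncomputable def cumul (R : Set ℝ) (t : ℝ) : ℝ := (volume (R ∩ Ioc 0 t)).toReal

theorem volume_inter_Ioc_ne_top (R : Set ℝ) (a t : ℝ) : volume (R ∩ Ioc a t) ≠ ∞ :=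
  ne_top_of_le_ne_top (by simp) (measure_mono (t := Ioc a t) inter_subset_right)

theorem ofReal_cumul (R : Set ℝ) (t : ℝ) : ENNReal.ofReal (cumul R t) = volume (R ∩ Ioc 0 t) :=
  ENNReal.ofReal_toReal (volume_inter_Ioc_ne_top R 0 t)

theorem cumul_nonneg (R : Set ℝ) (t : ℝ) : 0 ≤ cumul R t := ENNReal.toReal_nonneg

theorem cumul_mono (R : Set ℝ) : Monotone (cumul R) := fun _ t hst =>
  ENNReal.toReal_mono (volume_inter_Ioc_ne_top R 0 t)
    (measure_mono (inter_subset_inter_right _ (Ioc_subset_Ioc_right hst)))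

theorem cumul_le_add (R : Set ℝ) {s t : ℝ} (hst : s ≤ t) : cumul R t ≤ cumul R s + (t - s) := by
  rw [← ENNReal.ofReal_le_ofReal_iff (add_nonneg (cumul_nonneg R s) (by linarith)),
    ENNReal.ofReal_add (cumul_nonneg R s) (by linarith), ofReal_cumul, ofReal_cumul,
    ← Real.volume_Ioc]
  refine le_trans (measure_mono ?_) (measure_union_le _ _)
  rintro u ⟨hu, h0, h1⟩
  rcases le_or_gt u s with h | h
  · exact Or.inl ⟨hu, h0, h⟩
  · exact Or.inr ⟨h, h1⟩

theorem continuous_cumul (R : Set ℝ) : Continuous (cumul R) := by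
  refine (LipschitzWith.of_le_add fun t s => ?_).continuous
  rcases le_total s t with h | h
  · refine (cumul_le_add R h).trans ?_
    rw [Real.dist_eq, abs_of_nonneg (by linarith)]
  · exact (cumul_mono R h).trans (le_add_of_nonneg_right dist_nonneg)

theorem tendsto_volume_inter_Ioc {R : Set ℝ} (hR : R ⊆ Ioi 0) :
    Tendsto (fun n : ℕ => volume (R ∩ Ioc 0 (n : ℝ))) atTop (𝓝 (volume R)) := by
  have hU : R = ⋃ n : ℕ, R ∩ Ioc 0 (n : ℝ) := by
    ext u
    simp only [mem_iUnion, mem_inter_iff, mem_Ioc]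
    constructor
    · intro hu
      obtain ⟨n, hn⟩ := exists_nat_ge u
      exact ⟨n, hu, hR hu, hn⟩
    · rintro ⟨n, hn⟩
      exact hn.1
  have hm : Monotone fun n : ℕ => R ∩ Ioc 0 (n : ℝ) := fun m n hmn =>
    inter_subset_inter_right _ (Ioc_subset_Ioc_right (by exact_mod_cast hmn))
  have := tendsto_measure_iUnion_atTop (μ := volume) hm
  rwa [← hU] at this

/-- By continuity the value `a` is attained when |R| > a, so that the sublevel set meets R in R ∩
(0, b] with |R ∩ (0, b]| = a. -/
theorem volume_cumul_le {R : Set ℝ} (hR : R ⊆ Ioi 0) {a : ℝ} (ha : 0 ≤ a) :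
    volume (R ∩ {t | cumul R t ≤ a}) = min (volume R) (ENNReal.ofReal a) := by
  rcases le_or_gt (volume R) (ENNReal.ofReal a) with h | h
  · rw [min_eq_left h, inter_eq_left.2]
    intro t _
    refine (ENNReal.ofReal_le_ofReal_iff ha).1 ?_
    rw [ofReal_cumul]
    exact (measure_mono inter_subset_left).trans h
  · rw [min_eq_right h.le]
    obtain ⟨n, hn⟩ := ((tendsto_volume_inter_Ioc hR).eventually (lt_mem_nhds h)).exists
    rw [← ofReal_cumul, ENNReal.ofReal_lt_ofReal_iff_of_nonneg ha] at hn
    have hbdd : BddAbove {t | cumul R t ≤ a} := ⟨n, fun t ht => by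
      by_contra! hcon
      have : cumul R t ≤ a := ht
      linarith [cumul_mono R hcon.le]⟩
    have h0 : cumul R 0 = 0 := by simp [cumul]
    have hne : {t | cumul R t ≤ a}.Nonempty := ⟨0, by simp [h0, ha]⟩
    have hcl : IsClosed {t | cumul R t ≤ a} := isClosed_le (continuous_cumul R) continuous_const
    have hg := hcl.isGreatest_csSup hne hbdd
    set b := sSup {t | cumul R t ≤ a}
    have hb : cumul R b = a := by
      obtain ⟨b', -, hb'⟩ := intermediate_value_Icc (f := cumul R) (a := (0 : ℝ)) (b := (n : ℝ))
        n.cast_nonneg (continuous_cumul R).continuousOn ⟨by rw [h0]; exact ha, hn.le⟩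
      refine le_antisymm hg.1 ?_
      rw [← hb']
      exact cumul_mono R (hg.2 (show cumul R b' ≤ a from hb'.le))
    have : R ∩ {t | cumul R t ≤ a} = R ∩ Ioc 0 b := by
      ext t
      constructor
      · rintro ⟨h1, h2⟩
        exact ⟨h1, hR h1, hg.2 h2⟩
      · rintro ⟨h1, h2, h3⟩
        refine ⟨h1, ?_⟩
        have : cumul R t ≤ a := hb ▸ cumul_mono R h3
        exact this
    rw [this, ← ofReal_cumul, hb]

theorem measure_ext_of_Iic_ne_top {μ ν : Measure ℝ} (h : ∀ a, μ (Iic a) = ν (Iic a))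
    (hfin : ∀ a, μ (Iic a) ≠ ∞) : μ = ν := by
  have key : ∀ (ρ : Measure ℝ) (a b : ℝ), a < b → ρ (Iic a) ≠ ∞ →
      ρ (Ioc a b) = ρ (Iic b) - ρ (Iic a) := fun ρ a b hab hρ => by
    rw [← Iic_sdiff_Iic, measure_sdiff (Iic_subset_Iic.2 hab.le) measurableSet_Iic.nullMeasurableSet hρ]
  refine Measure.ext_of_Ioc' μ ν (fun a b _ => ?_) (fun a b hab => ?_)
  · exact ne_top_of_le_ne_top (hfin b) (measure_mono fun u hu => hu.2)
  · rw [key μ a b hab (hfin a), key ν a b hab (h a ▸ hfin a), h, h]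

/-- Both measures agree on half-lines. The condition on `A` covers the two cases in use, A = (0,
|R|] for finite |R| and A = (0, ∞) otherwise. -/
theorem map_cumul {R : Set ℝ} (hR : R ⊆ Ioi 0) {A : Set ℝ}
    (hA : ∀ a, 0 ≤ a → volume (Iic a ∩ A) = min (volume R) (ENNReal.ofReal a))
    (hA0 : A ⊆ Ioi 0) :
    (volume.restrict R).map (cumul R) = volume.restrict A := by
  have hmeas : Measurable (cumul R) := (continuous_cumul R).measurable
  have h1 : ∀ a, 0 ≤ a → (volume.restrict R).map (cumul R) (Iic a)
      = min (volume R) (ENNReal.ofReal a) := fun a ha => by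
    rw [Measure.map_apply hmeas measurableSet_Iic,
      Measure.restrict_apply (hmeas measurableSet_Iic), inter_comm]
    exact volume_cumul_le hR ha
  have h2 : ∀ a, a < 0 → (volume.restrict R).map (cumul R) (Iic a) = 0 := fun a ha => by
    rw [Measure.map_apply hmeas measurableSet_Iic]
    convert measure_empty (μ := volume.restrict R)
    ext t
    simp only [mem_preimage, mem_Iic, mem_empty_iff_false, iff_false, not_le]
    exact lt_of_lt_of_le ha (cumul_nonneg R t)
  refine measure_ext_of_Iic_ne_top (fun a => ?_) (fun a => ?_)
  · rw [Measure.restrict_apply measurableSet_Iic]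
    rcases lt_or_ge a 0 with ha | ha
    · rw [h2 a ha]
      convert (measure_empty (μ := volume)).symm
      ext t
      simp only [mem_inter_iff, mem_Iic, mem_empty_iff_false, iff_false, not_and]
      intro h h'
      exact absurd (hA0 h') (not_lt.2 (h.trans ha.le))
    · rw [h1 a ha, hA a ha]
  · rcases lt_or_ge a 0 with ha | ha
    · simp [h2 a ha]
    · rw [h1 a ha]
      exact ne_top_of_le_ne_top (by simp) (min_le_right _ _)

theorem setLIntegral_comp_cumul {R : Set ℝ} (hR : R ⊆ Ioi 0) {p : ℝ}
    (hRp : volume R = ENNReal.ofReal p) {F : ℝ → ℝ≥0∞} (hF : Measurable F) :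
    ∫⁻ t in R, F (cumul R t) = ∫⁻ u in Ioc 0 p, F u := by
  rw [← map_cumul hR (A := Ioc 0 p) (fun a ha => ?_) (fun u hu => hu.1),
    lintegral_map hF (continuous_cumul R).measurable]
  have : Iic a ∩ Ioc 0 p = Ioc 0 (min p a) := by
    ext t
    simp only [mem_inter_iff, mem_Iic, mem_Ioc, le_min_iff]
    tauto
  rw [this, hRp, Real.volume_Ioc, sub_zero]
  rcases le_total p a with h | h
  · rw [min_eq_left h, min_eq_left (ENNReal.ofReal_le_ofReal h)]
  · rw [min_eq_right h, min_eq_right (ENNReal.ofReal_le_ofReal h)]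

theorem setLIntegral_comp_cumul_top {R : Set ℝ} (hR : R ⊆ Ioi 0)
    (hRp : volume R = ∞) {F : ℝ → ℝ≥0∞} (hF : Measurable F) :
    ∫⁻ t in R, F (cumul R t) = ∫⁻ u in Ioi 0, F u := by
  rw [← map_cumul hR (A := Ioi 0) (fun a ha => ?_) (fun u hu => hu),
    lintegral_map hF (continuous_cumul R).measurable]
  rw [inter_comm, Ioi_inter_Iic, Real.volume_Ioc, sub_zero, hRp, min_eq_right le_top]

/-- The `i`-th of the consecutive parts of `R` of measure `h`. -/
def part (R : Set ℝ) (h : ℝ) (i : ℕ) : Set ℝ := R ∩ cumul R ⁻¹' Ioc (i * h) ((i + 1) * h)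

theorem measurableSet_part {R : Set ℝ} (hR : MeasurableSet R) (h : ℝ) (i : ℕ) :
    MeasurableSet (part R h i) :=
  hR.inter ((continuous_cumul R).measurable measurableSet_Ioc)

theorem volume_part {R : Set ℝ} (hR : R ⊆ Ioi 0) {h : ℝ} (hh : 0 ≤ h)
    {N i : ℕ} (hi : i < N) (hRp : volume R = ENNReal.ofReal (N * h)) :
    volume (part R h i) = ENNReal.ofReal h := by
  have h1 := setLIntegral_comp_cumul hR hRp
    (F := (Ioc (i * h) ((i + 1) * h)).indicator 1) (measurable_one.indicator measurableSet_Ioc)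
  have h2 : ∀ t, (Ioc (i * h) ((i + 1) * h)).indicator (1 : ℝ → ℝ≥0∞) (cumul R t)
      = (cumul R ⁻¹' Ioc (i * h) ((i + 1) * h)).indicator 1 t := fun t => rfl
  simp only [h2] at h1
  have hm : MeasurableSet (cumul R ⁻¹' Ioc (i * h) ((i + 1) * h)) :=
    (continuous_cumul R).measurable measurableSet_Ioc
  rw [lintegral_indicator_one hm, lintegral_indicator_one measurableSet_Ioc,
    Measure.restrict_apply hm, Measure.restrict_apply measurableSet_Ioc, inter_comm] at h1
  have hsub : Ioc (i * h) ((i + 1) * h) ⊆ Ioc 0 (N * h) := by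
    intro u hu
    refine ⟨lt_of_le_of_lt (by positivity) hu.1, hu.2.trans ?_⟩
    have : ((i : ℝ) + 1) ≤ N := by exact_mod_cast hi
    gcongr
  rw [part, h1, inter_eq_left.2 hsub, Real.volume_Ioc]
  congr 1
  ring

theorem part_disjoint (R : Set ℝ) {h : ℝ} (hh : 0 ≤ h) {i j : ℕ} (hij : i ≠ j) :
    Disjoint (part R h i) (part R h j) := by
  wlog hlt : i < j generalizing i j
  · exact (this hij.symm (by omega)).symm
  refine Set.disjoint_left.2 fun t ht ht' => ?_
  have h1 := ht.2.2
  have h2 := ht'.2.1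
  have : ((i : ℝ) + 1) ≤ j := by exact_mod_cast hlt
  have := mul_le_mul_of_nonneg_right this hh
  linarith

theorem ae_mem_part {R : Set ℝ} (hR : R ⊆ Ioi 0) (hRm : MeasurableSet R) {h : ℝ} (hh : 0 ≤ h)
    {N : ℕ} (hRp : volume R = ENNReal.ofReal (N * h)) :
    ∀ᵐ t, t ∈ R → ∃ i : Fin N, t ∈ part R h i := by
  have hsub : (⋃ i : Fin N, part R h i) ⊆ R := iUnion_subset fun i => inter_subset_left
  have hvol : volume (⋃ i : Fin N, part R h i) = volume R := by
    rw [measure_iUnion (fun i j hij => part_disjoint R hh fun h => hij (Fin.ext h))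
      fun i => measurableSet_part hRm h i, tsum_fintype,
      Finset.sum_congr rfl fun i _ => volume_part hR hh i.2 hRp, Finset.sum_const,
      Finset.card_univ, Fintype.card_fin, hRp, ENNReal.ofReal_mul N.cast_nonneg,
      ENNReal.ofReal_natCast, nsmul_eq_mul]
  have h0 : volume (R \ ⋃ i : Fin N, part R h i) = 0 := by
    rw [measure_sdiff hsub (MeasurableSet.iUnion fun i : Fin N =>
      measurableSet_part hRm h i).nullMeasurableSet (by rw [hvol, hRp]; exact ENNReal.ofReal_ne_top), hvol, tsub_self]
  have h1 : ∀ᵐ t, t ∉ R \ ⋃ i : Fin N, part R h i := measure_eq_zero_iff_ae_notMem.1 h0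
  filter_upwards [h1] with t ht htR
  by_contra hcon
  exact ht ⟨htR, fun hU => hcon (mem_iUnion.1 hU)⟩

/-! ### Functions assembled from disjoint pieces -/

theorem tsum_indicator_apply {ι : Type*} {R : ι → Set ℝ}
    (hd : Pairwise fun i j => Disjoint (R i) (R j)) (u : ι → ℝ → ℝ≥0∞) {i : ι} {t : ℝ}
    (ht : t ∈ R i) : ∑' j, (R j).indicator (u j) t = u i t := by
  rw [tsum_eq_single i fun j hj => indicator_of_notMem
    (fun h => (Set.disjoint_left.1 (hd hj) h) ht) _, indicator_of_mem ht]

theorem tsum_indicator_eq_zero {ι : Type*} {R : ι → Set ℝ} (u : ι → ℝ → ℝ≥0∞) {t : ℝ}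
    (ht : ∀ i, t ∉ R i) : ∑' j, (R j).indicator (u j) t = 0 := by
  simp [ht]

theorem measurable_tsum_indicator {ι : Type*} [Countable ι] {R : ι → Set ℝ}
    (hR : ∀ i, MeasurableSet (R i)) {u : ι → ℝ → ℝ≥0∞} (hu : ∀ i, Measurable (u i)) :
    Measurable fun t => ∑' j, (R j).indicator (u j) t :=
  Measurable.tsum fun i => (hu i).indicator (hR i)

theorem excess_tsum_indicator {ι : Type*} [Countable ι] {R : ι → Set ℝ}
    (hR : ∀ i, MeasurableSet (R i)) (hR0 : ∀ i, R i ⊆ Ioi 0)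
    (hd : Pairwise fun i j => Disjoint (R i) (R j)) {u : ι → ℝ → ℝ≥0∞}
    (hu : ∀ i, Measurable (u i)) (s : ℝ≥0∞) :
    excess (fun t => ∑' j, (R j).indicator (u j) t) s = ∑' j, ∫⁻ t in R j, (u j t - s) := by
  have h1 : ∀ t, (∑' j, (R j).indicator (u j) t) - s
      = ∑' j, (R j).indicator (fun t => u j t - s) t := by
    intro t
    by_cases h : ∃ i, t ∈ R i
    · obtain ⟨i, hi⟩ := h
      rw [tsum_indicator_apply hd u hi, tsum_indicator_apply hd (fun j t => u j t - s) hi]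
    · push Not at h
      rw [tsum_indicator_eq_zero u h, tsum_indicator_eq_zero _ h, zero_tsub]
  unfold excess
  simp only [h1]
  rw [lintegral_tsum fun i => (((hu i).sub_const s).indicator (hR i)).aemeasurable]
  refine tsum_congr fun i => ?_
  rw [lintegral_indicator (hR i), Measure.restrict_restrict (hR i), inter_eq_left.2 (hR0 i)]

theorem excess_add_of_disjoint {a b : ℝ → ℝ≥0∞} (ha : Measurable a)
    (h : ∀ t, a t = 0 ∨ b t = 0) (s : ℝ≥0∞) :
    excess (fun t => a t + b t) s = excess a s + excess b s := by
  unfold excess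
  rw [← lintegral_add_left (ha.sub_const s)]
  refine lintegral_congr fun t => ?_
  rcases h t with h | h <;> simp [h]

theorem sum_setLIntegral_Ioc (e : ℝ → ℝ≥0∞) {h : ℝ} (hh : 0 ≤ h) (a : ℝ) (n : ℕ) :
    ∑ i ∈ Finset.range n, ∫⁻ t in Ioc (a + i * h) (a + (i + 1) * h), e t
      = ∫⁻ t in Ioc a (a + n * h), e t := by
  induction n with
  | zero => simp
  | succ n ih =>
    have h0 : 0 ≤ n * h := by positivity
    rw [Finset.sum_range_succ, ih, ← lintegral_union measurableSet_Ioc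
      (Set.disjoint_left.2 fun u hu hu' => absurd hu.2 (not_le.2 hu'.1)),
      Ioc_union_Ioc_eq_Ioc (by linarith) (by linarith)]
    push_cast
    rfl

/-- Jensen's inequality for the positive part: flattening a function to a constant not above its
mean does not increase the excess. -/
theorem measure_mul_average_tsub_le {B : Set ℝ} {m : ℝ≥0∞}
    (e : ℝ → ℝ≥0∞) (hm : volume B * m ≤ ∫⁻ t in B, e t)
    (hB0 : volume B ≠ ∞) (s : ℝ≥0∞) :
    volume B * (m - s) ≤ ∫⁻ t in B, (e t - s) := by
  by_cases hs : s = ∞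
  · simp [hs]
  rw [ENNReal.mul_sub (fun _ _ => hB0), tsub_le_iff_right]
  calc volume B * m ≤ ∫⁻ t in B, e t := hm
    _ ≤ ∫⁻ t in B, ((e t - s) + s) := lintegral_mono fun t => le_tsub_add
    _ = _ := by rw [lintegral_add_right _ measurable_const, setLIntegral_const, mul_comm s]

/-- The average of the values of a decreasing function along an arithmetic progression differs
little from its mean. -/
theorem sum_antitone_le {w : ℝ → ℝ≥0∞} (hw : Antitone w) {h : ℝ} (hh : 0 < h) {N : ℕ}
    {η : ℝ≥0∞} (hη : ∫⁻ t in Ioc 0 (N * h), w t = ENNReal.ofReal (N * h) * η) {τ : ℝ}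
    (hτ : τ ∈ Ioc 0 h) :
    ∑ i ∈ Finset.range N, w (τ + i * h) ≤ N * η + w τ := by
  rcases Nat.eq_zero_or_pos N with rfl | hN
  · simp
  obtain ⟨M, rfl⟩ : ∃ M, N = M + 1 := ⟨N - 1, by omega⟩
  rw [Finset.sum_range_succ']
  simp only [Nat.cast_zero, zero_mul, add_zero]
  gcongr
  have hh' : ENNReal.ofReal h ≠ 0 := by simpa using hh
  refine (ENNReal.mul_le_mul_iff_right hh' ENNReal.ofReal_ne_top).1 ?_
  calc ENNReal.ofReal h * ∑ i ∈ Finset.range M, w (τ + (i + 1 : ℕ) * h)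
      = ∑ i ∈ Finset.range M, ∫⁻ _ in Ioc (τ + i * h) (τ + (i + 1) * h), w (τ + (i + 1) * h) := by
        rw [Finset.mul_sum]
        refine Finset.sum_congr rfl fun i _ => ?_
        rw [setLIntegral_const, Real.volume_Ioc, mul_comm]
        push_cast
        congr 2
        ring
    _ ≤ ∑ i ∈ Finset.range M, ∫⁻ t in Ioc (τ + i * h) (τ + (i + 1) * h), w t :=
        Finset.sum_le_sum fun i _ => setLIntegral_mono' measurableSet_Ioc fun t ht => hw ht.2
    _ = ∫⁻ t in Ioc τ (τ + M * h), w t := sum_setLIntegral_Ioc w hh.le τ M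
    _ ≤ ∫⁻ t in Ioc 0 ((M + 1 : ℕ) * h), w t := by
        refine lintegral_mono_set fun u hu => ⟨hτ.1.trans hu.1, hu.2.trans ?_⟩
        push_cast
        linarith [hτ.2]
    _ = _ := by
        rw [hη, ENNReal.ofReal_mul (Nat.cast_nonneg _), ENNReal.ofReal_natCast]
        ring

/-- Each term w(τ + ih) is at least the mean of w over the next interval of length h. These
intervals cover (τ, Nh], and what precedes τ lies in the first cell, hence the correction by the
mean over (0, h]. -/
theorem le_sum_antitone {w : ℝ → ℝ≥0∞} (hw : Antitone w) {h : ℝ} (hh : 0 < h) {N : ℕ}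
    {η : ℝ≥0∞} (hη : ∫⁻ t in Ioc 0 (N * h), w t = ENNReal.ofReal (N * h) * η) {τ : ℝ}
    (hτ : τ ∈ Ioc 0 h) :
    N * η ≤ (∑ i ∈ Finset.range N, w (τ + i * h))
      + (∫⁻ t in Ioc 0 h, w t) / ENNReal.ofReal h := by
  have hh' : ENNReal.ofReal h ≠ 0 := by simpa using hh
  refine (ENNReal.mul_le_mul_iff_right hh' ENNReal.ofReal_ne_top).1 ?_
  rw [mul_add, ENNReal.mul_div_cancel hh' ENNReal.ofReal_ne_top]
  calc ENNReal.ofReal h * (N * η) = ∫⁻ t in Ioc 0 (N * h), w t := by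
        rw [hη, ENNReal.ofReal_mul (Nat.cast_nonneg _), ENNReal.ofReal_natCast]
        ring
    _ ≤ ∫⁻ t in Ioc τ (τ + N * h) ∪ Ioc 0 h, w t := by
        refine lintegral_mono_set fun u hu => ?_
        rcases le_or_gt u τ with h1 | h1
        · exact Or.inr ⟨hu.1, h1.trans hτ.2⟩
        · exact Or.inl ⟨h1, by linarith [hu.2, hτ.1]⟩
    _ ≤ (∫⁻ t in Ioc τ (τ + N * h), w t) + ∫⁻ t in Ioc 0 h, w t := lintegral_union_le _ _ _
    _ ≤ _ := by
        gcongr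
        rw [← sum_setLIntegral_Ioc w hh.le τ N, Finset.mul_sum]
        refine Finset.sum_le_sum fun i _ => ?_
        calc ∫⁻ t in Ioc (τ + i * h) (τ + (i + 1) * h), w t
            ≤ ∫⁻ _ in Ioc (τ + i * h) (τ + (i + 1) * h), w (τ + i * h) :=
              setLIntegral_mono' measurableSet_Ioc fun t ht => hw ht.1.le
          _ = _ := by
              rw [setLIntegral_const, Real.volume_Ioc, mul_comm]
              congr 2
              ring

theorem sum_range_setLIntegral_comp_add (e : ℝ → ℝ≥0∞) {h : ℝ} (hh : 0 ≤ h) (N : ℕ) :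
    ∑ i : Fin N, ∫⁻ u in Ioc 0 h, e (u + (i : ℕ) * h) = ∫⁻ u in Ioc 0 (N * h), e u := by
  have h1 := sum_setLIntegral_Ioc e hh 0 N
  simp only [zero_add] at h1
  rw [← h1, ← Fin.sum_univ_eq_sum_range (fun i => ∫⁻ t in Ioc (i * h) ((i + 1) * h), e t)]
  refine Finset.sum_congr rfl fun i _ => ?_
  rw [setLIntegral_Ioc_comp_add]
  congr 3
  ring

/-- Given disjoint sets `P j` and levels `η j` dominated by a decreasing function `f`, and a set `Q`
of infinite measure, there are `N` rearrangements of `f` whose average is close to `η j` on `P j`. -/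
theorem exists_averaging_family {f : ℝ → ℝ≥0∞} (hf : Antitone f)
    (hfin : ∀ s, s ≠ 0 → excess f s ≠ ∞) {N : ℕ} [NeZero N] {Q : Set ℝ} (hQm : MeasurableSet Q)
    (hQ0 : Q ⊆ Ioi 0) (hQ : volume Q = ∞) {P : ℕ → Set ℝ} (hPm : ∀ j, MeasurableSet (P j))
    (hP0 : ∀ j, P j ⊆ Ioi 0) (hPd : Pairwise fun i j => Disjoint (P i) (P j))
    (hPQ : ∀ j, Disjoint (P j) Q) (hPf : ∀ j, volume (P j) ≠ ∞) {η : ℕ → ℝ≥0∞}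
    (hη0 : ∀ j, η j ≠ 0) (hη : ∀ j, η j ≠ ∞)
    (h : ∀ s, ∑' j, volume (P j) * (η j - s) ≤ excess f s) :
    ∃ (z : Fin N → ℝ → ℝ≥0∞) (g e₁ e₂ : ℝ → ℝ≥0∞),
      (∀ l, Measurable (z l)) ∧ Measurable g ∧ Measurable e₁ ∧ Measurable e₂ ∧
      (∀ l s, s ≠ 0 → excess (z l) s = excess f s) ∧
      (∀ l t, t ∉ Q → (∀ j, t ∉ P j) → z l t = 0) ∧
      (∀ t, t ∉ Q → g t = 0) ∧ (∀ s, s ≠ 0 → excess g s ≤ excess f s) ∧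
      (∀ s, s ≠ 0 → excess e₁ s ≤ N * excess f s) ∧
      (∀ s, s ≠ 0 → excess e₂ s ≤ N * excess f s) ∧
      ∀ᵐ t ∂semiAxis,
        (∑ l, z l t ≤ N * (∑' j, (P j).indicator (fun _ => η j) t) + N * g t + e₁ t) ∧
        (N * (∑' j, (P j).indicator (fun _ => η j) t) ≤ ∑ l, z l t + e₂ t) := by
  have hN : (N : ℝ) ≠ 0 := Nat.cast_ne_zero.2 (NeZero.ne N)
  have hN' : (0 : ℝ) < N := Nat.cast_pos.2 (Nat.pos_of_ne_zero (NeZero.ne N))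
  obtain ⟨w, g, hw, hg, hwint, hsplit⟩ := exists_windows hf hfin
    (p := fun j => (volume (P j)).toReal) (fun j => ENNReal.toReal_nonneg) hη0 hη (by
      intro s
      simpa only [ENNReal.ofReal_toReal (hPf _)] using h s)
  -- Every set `P j` and every window is cut into N parts of this length.
  set b : ℕ → ℝ := fun j => (volume (P j)).toReal / N with hb
  have hb0 : ∀ j, 0 ≤ b j := fun j => by positivity
  have hbN : ∀ j, (volume (P j)).toReal = N * b j := fun j => by
    simp only [hb]; field_simp
  have hvolP : ∀ j, volume (P j) = ENNReal.ofReal (N * b j) := fun j => by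
    rw [← hbN, ENNReal.ofReal_toReal (hPf j)]
  simp only [hbN] at hwint hsplit
  -- the cells
  set R : ℕ × Fin N → Set ℝ := fun q => part (P q.1) (b q.1) q.2 with hR
  have hRP : ∀ q, R q ⊆ P q.1 := fun q => inter_subset_left
  have hRm : ∀ q, MeasurableSet (R q) := fun q => measurableSet_part (hPm _) _ _
  have hR0 : ∀ q, R q ⊆ Ioi 0 := fun q => (hRP q).trans (hP0 _)
  have hRv : ∀ q, volume (R q) = ENNReal.ofReal (b q.1) := fun q =>
    volume_part (hP0 _) (hb0 _) q.2.2 (hvolP _)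
  have hRd : Pairwise fun q q' => Disjoint (R q) (R q') := by
    rintro ⟨j, i⟩ ⟨j', i'⟩ hne
    by_cases hjj : j = j'
    · subst hjj
      exact part_disjoint _ (hb0 _) fun hii => hne (Prod.ext rfl (Fin.ext hii))
    · exact (hPd hjj).mono (hRP _) (hRP _)
  have hRQ : ∀ q t, t ∈ R q → t ∉ Q := fun q t ht =>
    Set.disjoint_left.1 (hPQ q.1) (hRP q ht)
  have hcov : ∀ᵐ t ∂semiAxis, ∀ j, t ∈ P j → ∃ i, t ∈ R (j, i) :=
    ae_restrict_of_ae (ae_all_iff.2 fun j => ae_mem_part (hP0 j) (hPm j) (hb0 j) (hvolP j))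
  have hpos : ∀ᵐ t ∂semiAxis, ∀ q, t ∈ R q → 0 < cumul (R q) t := by
    refine ae_restrict_of_ae (ae_all_iff.2 fun q => ?_)
    have h0 := volume_cumul_le (hR0 q) le_rfl
    rw [ENNReal.ofReal_zero, min_eq_right zero_le] at h0
    filter_upwards [measure_eq_zero_iff_ae_notMem.1 h0] with t ht htR
    by_contra! hcon
    exact ht ⟨htR, hcon⟩
  -- the functions
  have hum : ∀ (q : ℕ × Fin N) (a : ℝ), Measurable fun t => w q.1 (cumul (R q) t + a) :=
    fun q a => (hw q.1).measurable.comp ((continuous_cumul _).measurable.add_const a)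
  -- On cell i of P j, the l-th function copies part l + i of the window, the sum being taken modulo
  -- N. For fixed l every part is used once, which preserves the distribution; for a fixed cell
  -- every part appears once as l varies, which produces the average.
  set y : Fin N → ℝ → ℝ≥0∞ := fun l t => ∑' q, (R q).indicator
    (fun t => w q.1 (cumul (R q) t + ((l + q.2 : Fin N) : ℕ) * b q.1)) t with hy
  set G : ℝ → ℝ≥0∞ := Q.indicator fun t => g (cumul Q t) with hG
  -- The errors put the first part of each window (here), or its mean (in e₂), on all N cells, so
  -- their excess is at most N times that of f.
  set e₁ : ℝ → ℝ≥0∞ := fun t => ∑' q, (R q).indicator (fun t => w q.1 (cumul (R q) t + 0)) t with he₁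
  set m : ℕ → ℝ≥0∞ := fun j => (∫⁻ t in Ioc 0 (b j), w j t) / ENNReal.ofReal (b j) with hm
  set e₂ : ℝ → ℝ≥0∞ := fun t => ∑' q : ℕ × Fin N, (R q).indicator (fun _ => m q.1) t with he₂
  have hGm : Measurable G :=
    (hg.measurable.comp (continuous_cumul Q).measurable).indicator hQm
  have hym : ∀ l, Measurable (y l) := fun l => measurable_tsum_indicator hRm fun q => hum q _
  have hyout : ∀ l t, (∀ j, t ∉ P j) → y l t = 0 := fun l t ht =>
    tsum_indicator_eq_zero _ fun q hq => ht _ (hRP q hq)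
  have hexG : ∀ s, excess G s = excess g s := by
    intro s
    have h1 : ∀ t, G t - s = Q.indicator (fun t => g (cumul Q t) - s) t := fun t => by
      by_cases ht : t ∈ Q <;> simp [hG, ht]
    have h2 := setLIntegral_comp_cumul_top hQ0 hQ (F := fun u => g u - s)
      (hg.measurable.sub_const s)
    unfold excess
    simp only [h1]
    rw [lintegral_indicator hQm, Measure.restrict_restrict hQm, inter_eq_left.2 hQ0, h2]
  have hgle : ∀ s, s ≠ 0 → excess g s ≤ excess f s := fun s hs => by
    rw [← hsplit s hs]; exact le_add_self
  have hcell : ∀ (q : ℕ × Fin N) (a : ℝ) (s : ℝ≥0∞),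
      ∫⁻ t in R q, (w q.1 (cumul (R q) t + a) - s)
        = ∫⁻ u in Ioc 0 (b q.1), (w q.1 (u + a) - s) := fun q a s =>
    setLIntegral_comp_cumul (hR0 q) (hRv q) (F := fun u => w q.1 (u + a) - s)
      (((hw q.1).measurable.comp (measurable_id.add_const a)).sub_const s)
  have hexy : ∀ l s, excess (y l) s = ∑' j, ∫⁻ t in Ioc 0 (N * b j), (w j t - s) := by
    intro l s
    rw [hy, excess_tsum_indicator hRm hR0 hRd (fun q => hum q _), ENNReal.tsum_prod']
    refine tsum_congr fun j => ?_
    rw [tsum_fintype]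
    simp only [hcell]
    rw [← sum_range_setLIntegral_comp_add (fun t => w j t - s) (hb0 j) N]
    exact Equiv.sum_comp (Equiv.addLeft l)
      fun i : Fin N => ∫⁻ u in Ioc 0 (b j), (w j (u + (i : ℕ) * b j) - s)
  have hfirst : ∀ j s, ∫⁻ u in Ioc 0 (b j), (w j u - s) ≤ ∫⁻ u in Ioc 0 (N * b j), (w j u - s) :=
    fun j s => lintegral_mono_set (Ioc_subset_Ioc_right (by
      have : (1 : ℝ) ≤ N := by exact_mod_cast Nat.pos_of_ne_zero (NeZero.ne N)
      nlinarith [hb0 j]))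
  have hexe₁ : ∀ s, excess e₁ s = N * ∑' j, ∫⁻ u in Ioc 0 (b j), (w j u - s) := by
    intro s
    rw [he₁, excess_tsum_indicator hRm hR0 hRd (fun q => hum q _), ENNReal.tsum_prod',
      ← ENNReal.tsum_mul_left]
    refine tsum_congr fun j => ?_
    rw [tsum_fintype]
    simp only [hcell]
    simp
  have hexe₂ : ∀ s, excess e₂ s ≤ N * ∑' j, ∫⁻ u in Ioc 0 (b j), (w j u - s) := by
    intro s
    rw [he₂, excess_tsum_indicator hRm hR0 hRd (fun q => measurable_const), ENNReal.tsum_prod',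
      ← ENNReal.tsum_mul_left]
    refine ENNReal.tsum_le_tsum fun j => ?_
    rw [tsum_fintype]
    simp only [setLIntegral_const, hRv]
    have hj : (m j - s) * ENNReal.ofReal (b j) ≤ ∫⁻ u in Ioc 0 (b j), (w j u - s) := by
      have := measure_mul_average_tsub_le (B := Ioc 0 (b j)) (m := m j) (w j) (by
        rw [Real.volume_Ioc, sub_zero]
        exact ENNReal.mul_div_le) (by simp) s
      rwa [Real.volume_Ioc, sub_zero, mul_comm] at this
    calc _ ≤ ∑ _ : Fin N, ∫⁻ u in Ioc 0 (b j), (w j u - s) := Finset.sum_le_sum fun i _ => hj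
      _ = _ := by simp
  have hNle : ∀ s, s ≠ 0 → N * ∑' j, ∫⁻ u in Ioc 0 (b j), (w j u - s) ≤ N * excess f s := by
    intro s hs
    gcongr
    rw [← hsplit s hs]
    exact (ENNReal.tsum_le_tsum fun j => hfirst j s).trans le_self_add
  have hdisj : ∀ l t, y l t = 0 ∨ G t = 0 := by
    intro l t
    by_cases ht : t ∈ Q
    · exact Or.inl (hyout l t fun j hj => Set.disjoint_left.1 (hPQ j) hj ht)
    · exact Or.inr (indicator_of_notMem ht _)
  refine ⟨fun l t => y l t + G t, G, e₁, e₂, fun l => (hym l).add hGm, hGm,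
    measurable_tsum_indicator hRm fun q => hum q _,
    measurable_tsum_indicator hRm fun q => measurable_const, fun l s hs => ?_, fun l t ht ht' => ?_,
    fun t ht => indicator_of_notMem ht _, fun s hs => (hexG s).trans_le (hgle s hs),
    fun s hs => (hexe₁ s).trans_le (hNle s hs), fun s hs => (hexe₂ s).trans (hNle s hs), ?_⟩
  · rw [excess_add_of_disjoint (hym l) (hdisj l), hexy, hexG, hsplit s hs]
  · simp only [hyout l t ht', zero_add]
    exact indicator_of_notMem ht _
  · filter_upwards [hcov, hpos] with t ht ht0
    by_cases hex : ∃ j, t ∈ P j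
    · obtain ⟨j, hj⟩ := hex
      obtain ⟨i, hi⟩ := ht j hj
      have hGt : G t = 0 := indicator_of_notMem (hRQ _ _ hi) _
      set τ := cumul (R (j, i)) t with hτdef
      have hτ : τ ∈ Ioc 0 (b j) := by
        refine ⟨ht0 (j, i) hi, ?_⟩
        rw [← ENNReal.ofReal_le_ofReal_iff (hb0 j), ofReal_cumul, ← hRv (j, i)]
        exact measure_mono inter_subset_left
      have hbj : 0 < b j := hτ.1.trans_le hτ.2
      have hYt : ∑' j, (P j).indicator (fun _ => η j) t = η j :=
        tsum_indicator_apply hPd (fun j _ => η j) hj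
      have hyt : ∀ l : Fin N, y l t = w j (τ + ((l + i : Fin N) : ℕ) * b j) := fun l =>
        tsum_indicator_apply hRd (fun q t => w q.1 (cumul (R q) t
          + ((l + q.2 : Fin N) : ℕ) * b q.1)) hi
      have he₁t : e₁ t = w j τ := by
        have := tsum_indicator_apply hRd (fun q t => w q.1 (cumul (R q) t + 0)) hi
        rw [add_zero] at this
        exact this
      have he₂t : e₂ t = m j := tsum_indicator_apply hRd (fun q _ => m q.1) hi
      have hsum : ∑ l, (y l t + G t) = ∑ i ∈ Finset.range N, w j (τ + i * b j) := by
        simp only [hyt, hGt, add_zero]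
        rw [← Fin.sum_univ_eq_sum_range (fun i => w j (τ + i * b j))]
        exact Equiv.sum_comp (Equiv.addRight i) fun i : Fin N => w j (τ + (i : ℕ) * b j)
      rw [hsum, hYt, hGt, mul_zero, add_zero, he₁t, he₂t]
      exact ⟨sum_antitone_le (hw j) hbj (hwint j) hτ, le_sum_antitone (hw j) hbj (hwint j) hτ⟩
    · push Not at hex
      have h1 : ∑' j, (P j).indicator (fun _ => η j) t = 0 := tsum_indicator_eq_zero _ hex
      have h2 : ∀ l, y l t = 0 := fun l => hyout l t hex
      simp only [h1, h2, zero_add, mul_zero, Finset.sum_const, Finset.card_univ, Fintype.card_fin,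
        nsmul_eq_mul]
      exact ⟨le_self_add, zero_le⟩

/-! ### Dilations -/

/-- The dilation of a `[0, ∞]`-valued function. -/
noncomputable def stretch (τ : ℝ) (e : ℝ → ℝ≥0∞) : ℝ → ℝ≥0∞ := fun t => e (t / τ)

theorem measurable_stretch {e : ℝ → ℝ≥0∞} (he : Measurable e) (τ : ℝ) :
    Measurable (stretch τ e) :=
  he.comp (measurable_id.div_const τ)

theorem excess_stretch {e : ℝ → ℝ≥0∞} (he : Measurable e) {τ : ℝ} (hτ : 0 < τ) (s : ℝ≥0∞) :
    excess (stretch τ e) s = ENNReal.ofReal τ * excess e s := by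
  set G : ℝ → ℝ≥0∞ := (Ioi (0 : ℝ)).indicator fun t => e t - s
  have hG : Measurable G := (he.sub_const s).indicator measurableSet_Ioi
  have h1 : excess (stretch τ e) s = ∫⁻ t, G (τ⁻¹ * t) := by
    unfold excess
    rw [← lintegral_indicator measurableSet_Ioi]
    refine lintegral_congr fun t => ?_
    by_cases ht : 0 < t
    · have ht' : 0 < τ⁻¹ * t := by positivity
      simp only [G, indicator_of_mem (mem_Ioi.2 ht), indicator_of_mem (mem_Ioi.2 ht'), stretch]
      rw [div_eq_inv_mul]
    · have ht' : ¬ 0 < τ⁻¹ * t := by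
        rw [not_lt] at ht ⊢
        exact mul_nonpos_of_nonneg_of_nonpos (by positivity) ht
      simp only [G, indicator_of_notMem (show t ∉ Ioi (0 : ℝ) from ht),
        indicator_of_notMem (show τ⁻¹ * t ∉ Ioi (0 : ℝ) from ht')]
  rw [h1, ← lintegral_map hG (measurable_const_mul τ⁻¹), Real.map_volume_mul_left (by positivity),
    lintegral_smul_measure, inv_inv, abs_of_pos hτ, smul_eq_mul, lintegral_indicator measurableSet_Ioi]
  rfl

theorem enorm_sub_toReal_le {a b w : ℝ≥0∞} (ha : a ≠ ∞) (hb : b ≠ ∞) (h1 : a ≤ b + w)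
    (h2 : b ≤ a + w) : ‖a.toReal - b.toReal‖ₑ ≤ w := by
  by_cases hw : w = ∞
  · simp [hw]
  have h1' := ENNReal.toReal_mono (ENNReal.add_ne_top.2 ⟨hb, hw⟩) h1
  have h2' := ENNReal.toReal_mono (ENNReal.add_ne_top.2 ⟨ha, hw⟩) h2
  rw [ENNReal.toReal_add hb hw] at h1'
  rw [ENNReal.toReal_add ha hw] at h2'
  rw [Real.enorm_eq_ofReal_abs, ← ENNReal.ofReal_toReal hw]
  exact ENNReal.ofReal_le_ofReal (abs_le.2 ⟨by linarith, by linarith⟩)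

/-- Layer sums of a level approximate it. -/
theorem sum_threshold_le (c a : ℝ≥0∞) (n : ℕ) :
    ∑ i ∈ Finset.range n, (if c * (i + 1) < a then c else 0) ≤ min a (n * c) := by
  induction n with
  | zero => simp
  | succ n ih =>
    rw [Finset.sum_range_succ]
    push_cast
    have h2 := ih.trans (min_le_right _ _)
    split_ifs with h
    · refine (add_le_add h2 le_rfl).trans (le_min ?_ (by rw [add_mul, one_mul]))
      calc n * c + c = c * (n + 1) := by ring
        _ ≤ a := h.le
    · rw [add_zero]
      refine ih.trans (min_le_min le_rfl ?_)
      gcongr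
      exact le_self_add

theorem le_sum_threshold (c a : ℝ≥0∞) (n : ℕ) :
    min a (n * c) ≤ (∑ i ∈ Finset.range n, (if c * (i + 1) < a then c else 0)) + c := by
  induction n with
  | zero => simp
  | succ n ih =>
    rw [Finset.sum_range_succ]
    have hall : c * n < a → ∑ i ∈ Finset.range n, (if c * (i + 1) < a then c else 0) = n * c := by
      intro h
      rw [Finset.sum_congr rfl (g := fun _ => c) fun i hi => if_pos (lt_of_le_of_lt ?_ h)]
      · simp
      · have : (i : ℝ≥0∞) + 1 ≤ n := by exact_mod_cast Finset.mem_range.1 hi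
        gcongr
    push_cast
    by_cases h0 : c * n < a
    · rw [hall h0]
      calc min a ((n + 1) * c) ≤ n * c + c := (min_le_right _ _).trans (by rw [add_mul, one_mul])
        _ ≤ _ := by gcongr; exact le_self_add
    · have h1 : a ≤ n * c := by rw [mul_comm]; exact not_lt.1 h0
      rw [min_eq_left h1] at ih
      refine (min_le_left _ _).trans (ih.trans ?_)
      gcongr
      exact le_self_add

/-- Those `t > 0` whose integer part is congruent to `k` modulo `N`. -/
def residueSet (N k : ℕ) : Set ℝ := {t | 0 < t ∧ ⌊t⌋₊ % N = k}

theorem measurableSet_residueSet (N k : ℕ) : MeasurableSet (residueSet N k) := by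
  refine measurableSet_Ioi.inter ?_
  have : Measurable fun t : ℝ => ⌊t⌋₊ % N :=
    (measurable_of_countable fun n : ℕ => n % N).comp Nat.measurable_floor
  exact this (measurableSet_singleton k)

theorem volume_residueSet {N k : ℕ} (hk : k < N) : volume (residueSet N k) = ∞ := by
  have hsub : (⋃ m : ℕ, Ioo ((k + N * m : ℕ) : ℝ) ((k + N * m : ℕ) + 1)) ⊆ residueSet N k := by
    refine iUnion_subset fun m t ht => ⟨lt_of_le_of_lt (Nat.cast_nonneg _) ht.1, ?_⟩
    have : ⌊t⌋₊ = k + N * m := (Nat.floor_eq_iff ((Nat.cast_nonneg _).trans ht.1.le)).2 ⟨ht.1.le, ht.2⟩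
    rw [this, Nat.add_mul_mod_self_left, Nat.mod_eq_of_lt hk]
  refine top_le_iff.1 (le_trans (le_of_eq ?_) (measure_mono hsub))
  rw [measure_iUnion ?_ fun m => measurableSet_Ioo]
  · simp only [Real.volume_Ioo, add_sub_cancel_left, ENNReal.ofReal_one]
    exact (ENNReal.tsum_const_eq_top_of_ne_zero one_ne_zero).symm
  · intro m m' hmm
    refine Set.disjoint_left.2 fun t ht ht' => hmm ?_
    have h1 := (Nat.floor_eq_iff ((Nat.cast_nonneg _).trans ht.1.le)).2 ⟨ht.1.le, ht.2⟩
    have h2 := (Nat.floor_eq_iff ((Nat.cast_nonneg _).trans ht'.1.le)).2 ⟨ht'.1.le, ht'.2⟩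
    have h3 : k + N * m = k + N * m' := h1.symm.trans h2
    exact Nat.eq_of_mul_eq_mul_left (by omega : 0 < N) (Nat.add_left_cancel h3)

theorem sum_indicator_residueSet {N : ℕ} [NeZero N] {t : ℝ} (ht : 0 < t) (a : ℝ≥0∞) :
    ∑ k : Fin N, (residueSet N k).indicator (fun _ => a) t = a := by
  have hN : 0 < N := Nat.pos_of_ne_zero (NeZero.ne N)
  rw [Finset.sum_eq_single (⟨⌊t⌋₊ % N, Nat.mod_lt _ hN⟩ : Fin N)]
  · exact indicator_of_mem (show t ∈ residueSet N _ from ⟨ht, rfl⟩) _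
  · intro k _ hk
    refine indicator_of_notMem (fun hmem => hk ?_) _
    exact Fin.ext hmem.2.symm
  · simp

theorem excess_sum_of_disjoint {N : ℕ} {g : Fin N → ℝ → ℝ≥0∞} (hg : ∀ k, Measurable (g k))
    (hd : ∀ t k k', g k t ≠ 0 → g k' t ≠ 0 → k = k') (s : ℝ≥0∞) :
    excess (fun t => ∑ k, g k t) s = ∑ k, excess (g k) s := by
  unfold excess
  rw [← lintegral_finsetSum _ fun k _ => (hg k).sub_const s]
  refine lintegral_congr fun t => ?_
  by_cases h : ∃ k, g k t ≠ 0
  · obtain ⟨k, hk⟩ := h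
    have h0 : ∀ k', k' ≠ k → g k' t = 0 := fun k' hk' => by
      by_contra hne
      exact hk' (hd t k' k hne hk)
    dsimp only
    rw [Finset.sum_eq_single k (fun k' _ hk' => h0 k' hk') (by simp),
      Finset.sum_eq_single k (fun k' _ hk' => by rw [h0 k' hk', zero_tsub]) (by simp)]
  · push Not at h
    simp [h]

/-! ### Discretization of levels -/

/-- The levels `r ^ n`, `n ∈ ℤ`, enumerated by the natural numbers. -/
noncomputable def level (r : ℝ≥0∞) (j : ℕ) : ℝ≥0∞ := r ^ (Equiv.intEquivNat.symm j)

/-- The set where `e` lies between two consecutive levels. -/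
def levelSet (r : ℝ≥0∞) (e : ℝ → ℝ≥0∞) (j : ℕ) : Set ℝ :=
  {t | 0 < t ∧ level r j ≤ e t ∧ e t < r * level r j}

theorem level_ne_zero {r : ℝ≥0∞} (hr : 1 < r) (hr' : r ≠ ∞) (j : ℕ) : level r j ≠ 0 :=
  (ENNReal.zpow_pos (zero_lt_one.trans hr).ne' hr' _).ne'

theorem level_ne_top {r : ℝ≥0∞} (hr : 1 < r) (hr' : r ≠ ∞) (j : ℕ) : level r j ≠ ∞ :=
  (ENNReal.zpow_lt_top (zero_lt_one.trans hr).ne' hr' _).ne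

theorem measurableSet_levelSet (r : ℝ≥0∞) {e : ℝ → ℝ≥0∞} (he : Measurable e) (j : ℕ) :
    MeasurableSet (levelSet r e j) :=
  measurableSet_Ioi.inter ((measurableSet_le measurable_const he).inter
    (measurableSet_lt he measurable_const))

theorem levelSet_disjoint {r : ℝ≥0∞} (hr : 1 < r) (hr' : r ≠ ∞) (e : ℝ → ℝ≥0∞) :
    Pairwise fun i j => Disjoint (levelSet r e i) (levelSet r e j) := by
  have key : ∀ i j, Equiv.intEquivNat.symm i < Equiv.intEquivNat.symm j →
      Disjoint (levelSet r e i) (levelSet r e j) := by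
    intro i j hij
    refine Set.disjoint_left.2 fun t ht ht' => ?_
    have h1 : r * level r i ≤ level r j := by
      unfold level
      calc r * r ^ (Equiv.intEquivNat.symm i) = r ^ (Equiv.intEquivNat.symm i + 1) := by
            rw [ENNReal.zpow_add (zero_lt_one.trans hr).ne' hr', zpow_one, mul_comm]
        _ ≤ _ := ENNReal.zpow_le_of_le hr.le (by omega)
    exact absurd (ht.2.2.trans_le (h1.trans ht'.2.1)) (lt_irrefl _)
  intro i j hij
  rcases lt_trichotomy (Equiv.intEquivNat.symm i) (Equiv.intEquivNat.symm j) with h | h | h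
  · exact key i j h
  · exact absurd (Equiv.intEquivNat.symm.injective h) hij
  · exact (key j i h).symm

/-- The largest function with values in the set of levels below `e`. -/
noncomputable def discretize (r : ℝ≥0∞) (e : ℝ → ℝ≥0∞) (t : ℝ) : ℝ≥0∞ :=
  ∑' j, (levelSet r e j).indicator (fun _ => level r j) t

theorem discretize_le {r : ℝ≥0∞} (hr : 1 < r) (hr' : r ≠ ∞) (e : ℝ → ℝ≥0∞) (t : ℝ) :
    discretize r e t ≤ e t := by
  by_cases h : ∃ j, t ∈ levelSet r e j
  · obtain ⟨j, hj⟩ := h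
    exact (tsum_indicator_apply (levelSet_disjoint hr hr' e) (fun j _ => level r j) hj).le.trans
      hj.2.1
  · push Not at h
    exact (tsum_indicator_eq_zero _ h).le.trans zero_le

theorem le_discretize {r : ℝ≥0∞} (hr : 1 < r) (hr' : r ≠ ∞) (e : ℝ → ℝ≥0∞) {t : ℝ} (ht : 0 < t)
    (het : e t ≠ ∞) : e t ≤ r * discretize r e t := by
  by_cases h0 : e t = 0
  · simp [h0]
  obtain ⟨n, hn1, hn2⟩ := ENNReal.exists_mem_Ico_zpow h0 het hr hr'
  have hmem : t ∈ levelSet r e (Equiv.intEquivNat n) := by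
    refine ⟨ht, ?_, ?_⟩
    · simpa [level] using hn1
    · rw [ENNReal.zpow_add (zero_lt_one.trans hr).ne' hr', zpow_one, mul_comm] at hn2
      simpa [level] using hn2
  have := tsum_indicator_apply (levelSet_disjoint hr hr' e) (fun j _ => level r j) hmem
  rw [discretize, this]
  exact hmem.2.2.le

/-! ### Approximation by averages of extreme points -/

theorem excess_add_const_indicator {z : ℝ → ℝ≥0∞} {S : Set ℝ} {c : ℝ≥0∞}
    (h : ∀ t, t ∉ S → z t = 0) {s : ℝ≥0∞} (hs : c ≤ s) (hc : c ≠ ∞) :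
    excess (fun t => z t + S.indicator (fun _ => c) t) s = excess z (s - c) := by
  unfold excess
  refine lintegral_congr fun t => ?_
  dsimp only
  by_cases ht : t ∈ S
  · rw [indicator_of_mem ht]
    nth_rewrite 1 [← tsub_add_cancel_of_le hs]
    exact ENNReal.add_sub_add_eq_sub_right hc
  · rw [indicator_of_notMem ht, h t ht]
    simp

/-- The raw approximation: every element of the positive orbit is, up to an explicit error, an
average of `N ^ 2` extreme points. -/
theorem exists_average_extremePoints {x y : L0} (hx : x ∈ L1AddLInfty) (hy : y ∈ OmegaPlus x)
    (N : ℕ) [NeZero N] :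
    ∃ (A : Fin N × Fin N → L0) (W : Fin N → ℝ → ℝ≥0∞) (g : ℝ → ℝ≥0∞),
      (∀ q, A q ∈ (OmegaPlus x).extremePoints ℝ) ∧
      (∀ k, Measurable (W k)) ∧ Measurable g ∧
      (∀ k, ∃ e₁ e₂, W k = (fun t => e₁ t + e₂ t) ∧ Measurable e₁ ∧ Measurable e₂ ∧
        (∀ s, s ≠ 0 → excess e₁ s ≤ N * excess (fun t => ‖x t‖ₑ) s) ∧
        (∀ s, s ≠ 0 → excess e₂ s ≤ N * excess (fun t => ‖x t‖ₑ) s)) ∧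
      (∀ s, s ≠ 0 → excess g s ≤ N * excess (fun t => ‖x t‖ₑ) s) ∧
      ∀ᵐ t ∂semiAxis, ((N : ℝ≥0∞) ^ 2 * ‖y t‖ₑ ≤ ∑ q, ‖A q t‖ₑ + (N * g t + ∑ k, W k t
          + 2 * N * ‖y t‖ₑ + N * asymptote fun t => ‖x t‖ₑ)) ∧
        (∑ q, ‖A q t‖ₑ ≤ (N : ℝ≥0∞) ^ 2 * ‖y t‖ₑ + (N * g t + ∑ k, W k t
          + 2 * N * ‖y t‖ₑ + N * asymptote fun t => ‖x t‖ₑ)) := by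
  have hN0 : (N : ℝ≥0∞) ≠ 0 := Nat.cast_ne_zero.2 (NeZero.ne N)
  have hNt : (N : ℝ≥0∞) ≠ ∞ := ENNReal.natCast_ne_top N
  set c := asymptote fun t => ‖x t‖ₑ with hc
  obtain ⟨s0, hs0, hs0'⟩ := exists_excess_ne_top hx
  have hcfin : c ≠ ∞ := asymptote_ne_top hs0 hs0'
  rw [mem_omegaPlus_iff hx] at hy
  set f : ℝ → ℝ≥0∞ := fun t => rearrangement x t - c with hf
  have hfa : Antitone f := fun s t hst => tsub_le_tsub_right (rearrangement_antitone x hst) c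
  have hexf : ∀ s, excess f s = excess (fun t => ‖x t‖ₑ) (c + s) := fun s => by
    rw [hf, excess_tsub, excess_rearrangement]
  have hfin : ∀ s, s ≠ 0 → excess f s ≠ ∞ := fun s hs => by
    rw [hexf]
    exact excess_ne_top_of_asymptote_lt (ENNReal.lt_add_right hcfin hs)
  have hfle : ∀ s, excess f s ≤ excess (fun t => ‖x t‖ₑ) s := fun s => by
    rw [hexf]; exact excess_antitone _ le_add_self
  set Y : ℝ → ℝ≥0∞ := fun t => ‖y t‖ₑ with hY
  have hYm : Measurable Y := measurable_enorm_L0 y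
  set Y₁ : ℝ → ℝ≥0∞ := fun t => Y t - c with hY₁
  have hY₁m : Measurable Y₁ := hYm.sub_const c
  have hexY₁ : ∀ s, excess Y₁ s ≤ excess f s := fun s => by
    rw [hexf, hY₁, excess_tsub]; exact hy.2 _
  -- With this ratio of consecutive levels, rounding a value down to D loses at most D/N.
  set r : ℝ≥0∞ := 1 + (N : ℝ≥0∞)⁻¹ with hr
  have hr1 : 1 < r := ENNReal.lt_add_right ENNReal.one_ne_top (ENNReal.inv_ne_zero.2 hNt)
  have hrt : r ≠ ∞ := ENNReal.add_ne_top.2 ⟨ENNReal.one_ne_top, ENNReal.inv_ne_top.2 hN0⟩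
  have hdis := levelSet_disjoint hr1 hrt Y₁
  have hlm := measurableSet_levelSet r hY₁m
  -- The remainder of the k-th family is stored on the k-th residue set, of infinite measure. These
  -- sets partition the half-line, so at a given point only one of the N families gives up
  -- approximating y.
  set Q : Fin N → Set ℝ := fun k => residueSet N k with hQ
  have hQm : ∀ k, MeasurableSet (Q k) := fun k => measurableSet_residueSet N k
  set P : Fin N → ℕ → Set ℝ := fun k j => levelSet r Y₁ j \ Q k with hP
  have hPm : ∀ k j, MeasurableSet (P k j) := fun k j => (hlm j).diff (hQm k)
  have hPd : ∀ k, Pairwise fun i j => Disjoint (P k i) (P k j) := fun k i j hij =>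
    (hdis hij).mono sdiff_subset sdiff_subset
  have hP0 : ∀ k j, P k j ⊆ Ioi 0 := fun k j t ht => ht.1.1
  have hη0 := level_ne_zero hr1 hrt
  have hηt := level_ne_top hr1 hrt
  have hsum : ∀ k s, ∑' j, volume (P k j) * (level r j - s) ≤ excess f s := by
    intro k s
    have h1 := excess_tsum_indicator (hPm k) (hP0 k) (hPd k)
      (u := fun j _ => level r j) (fun j => measurable_const) s
    simp only [setLIntegral_const] at h1
    simp only [mul_comm (volume _)]
    rw [← h1]
    refine (excess_mono_ae (Eventually.of_forall fun t => ?_) s).trans (hexY₁ s)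
    refine le_trans (ENNReal.tsum_le_tsum fun j => ?_) (discretize_le hr1 hrt Y₁ t)
    exact indicator_le_indicator_of_subset sdiff_subset (fun _ => zero_le) t
  -- A piece of infinite measure would make the excess of f infinite at half its level.
  have hPf : ∀ k j, volume (P k j) ≠ ∞ := by
    intro k j htop
    have h1 := (ENNReal.le_tsum j).trans (hsum k (level r j / 2))
    rw [htop, ENNReal.sub_half (hηt j), ENNReal.top_mul (by simp [hη0 j])] at h1
    exact hfin _ (by simp [hη0 j]) (top_le_iff.1 h1)
  have hfam := fun k : Fin N => exists_averaging_family (N := N) hfa hfin (hQm k) (fun t ht => ht.1)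
    (volume_residueSet k.2) (hPm k) (hP0 k) (hPd k) (fun j => disjoint_sdiff_left) (hPf k) hη0 hηt
    (hsum k)
  choose z g e₁ e₂ hzm hgm he₁m he₂m hzex hz0 hg0 hgex he₁ex he₂ex hae using hfam
  -- Layers of N|y| at heights c, 2c, …, Nc: the mean of c·1_T over the N layers is within c/N of
  -- min(|y|, c), the part of y lost in passing to (|y| - c)⁺.
  set T : Fin N → Set ℝ := fun l => {t | c * ((l : ℕ) + 1) < N * Y t} with hT
  have hTm : ∀ l, MeasurableSet (T l) := fun l => measurableSet_lt measurable_const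
    (hYm.const_mul _)
  set S : Fin N × Fin N → Set ℝ := fun q => Q q.1 ∪ T q.2 with hS
  have hSm : ∀ q, MeasurableSet (S q) := fun q => (hQm _).union (hTm _)
  -- Since z vanishes off S, adding c on S gives values in {0} ∪ [c, ∞) and merely shifts the excess
  -- by c, as the extremality criterion demands.
  have hzS : ∀ q t, t ∉ S q → z q.1 q.2 t = 0 := by
    intro q t ht
    refine hz0 _ _ _ (fun h => ht (Or.inl h)) fun j hj => ht (Or.inr ?_)
    have h1 : level r j ≤ Y t - c := hj.1.2.1
    have h2 : c < Y t := tsub_pos_iff_lt.1 (lt_of_lt_of_le (pos_iff_ne_zero.2 (hη0 j)) h1)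
    have h3 : ((q.2 : ℕ) : ℝ≥0∞) + 1 ≤ N := by exact_mod_cast q.2.2
    calc c * ((q.2 : ℕ) + 1) ≤ c * N := by gcongr
      _ = N * c := mul_comm _ _
      _ < N * Y t := ENNReal.mul_lt_mul_right hN0 hNt h2
  set B : Fin N × Fin N → ℝ → ℝ≥0∞ :=
    fun q t => z q.1 q.2 t + (S q).indicator (fun _ => c) t with hB
  have hBm : ∀ q, Measurable (B q) := fun q =>
    (hzm _ _).add (measurable_const.indicator (hSm q))
  have hBex : ∀ q s, c < s → excess (B q) s = excess (fun t => ‖x t‖ₑ) s := by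
    intro q s hs
    rw [hB, excess_add_const_indicator (hzS q) hs.le hcfin, hzex _ _ _ (tsub_pos_of_lt hs).ne',
      hexf, add_tsub_cancel_of_le hs.le]
  have hc1 : c < c + 1 := ENNReal.lt_add_right hcfin one_ne_zero
  have hBfin : ∀ q, ∀ᵐ t ∂semiAxis, B q t ≠ ∞ := fun q =>
    ae_ne_top_of_excess (hBm q).aemeasurable (s := c + 1) (by simp [hcfin]) (by
      rw [hBex q _ hc1]; exact excess_ne_top_of_asymptote_lt hc1)
  have hBe : ∀ q, ∀ᵐ t ∂semiAxis, ‖classOf (B q) (hBm q).aemeasurable t‖ₑ = B q t := fun q =>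
    enorm_classOf _ (hBfin q)
  refine ⟨fun q => classOf (B q) (hBm q).aemeasurable, fun k t => e₁ k t + e₂ k t,
    fun t => ∑ k, g k t, fun q => ?_, fun k => (he₁m k).add (he₂m k),
    Finset.measurable_fun_sum _ fun k _ => hgm k, fun k => ⟨e₁ k, e₂ k, rfl, he₁m k, he₂m k,
      fun s hs => (he₁ex k s hs).trans (by gcongr; exact hfle s),
      fun s hs => (he₂ex k s hs).trans (by gcongr; exact hfle s)⟩, fun s hs => ?_, ?_⟩
  · refine mem_extremePoints_of_excess_eq hx (classOf_nonneg _) (fun s hs => ?_) ?_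
    · rw [excess_congr_ae (hBe q), hBex q s hs]
    · filter_upwards [hBe q] with t ht
      rw [ht]
      by_cases h : t ∈ S q
      · right
        simp only [hB, indicator_of_mem h]
        exact le_add_self
      · left
        simp only [hB, indicator_of_notMem h, hzS q t h, add_zero]
  · rw [excess_sum_of_disjoint hgm (fun t k k' hk hk' => ?_)]
    · calc ∑ k, excess (g k) s ≤ ∑ _ : Fin N, excess (fun t => ‖x t‖ₑ) s :=
            Finset.sum_le_sum fun k _ => (hgex k s hs).trans (hfle s)
        _ = _ := by simp
    · have h1 : t ∈ Q k := by
        by_contra h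
        exact hk (hg0 k t h)
      have h2 : t ∈ Q k' := by
        by_contra h
        exact hk' (hg0 k' t h)
      exact Fin.ext (h1.2.symm.trans h2.2)
  · filter_upwards [ae_all_iff.2 hae, ae_all_iff.2 hBe, ae_restrict_mem measurableSet_Ioi]
      with t hat hBt ht0
    simp only [hBt]
    set D := discretize r Y₁ t with hD
    have hYt : Y t ≠ ∞ := enorm_ne_top
    have hD1 : D ≤ Y₁ t := discretize_le hr1 hrt Y₁ t
    have hDY : D ≤ Y t := hD1.trans tsub_le_self
    have hD2 : N * Y₁ t ≤ N * D + D := by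
      calc N * Y₁ t ≤ N * (r * D) := by
            gcongr
            exact le_discretize hr1 hrt Y₁ ht0 (ne_top_of_le_ne_top hYt tsub_le_self)
        _ = N * D + (N * (N : ℝ≥0∞)⁻¹) * D := by rw [hr]; ring
        _ = _ := by rw [ENNReal.mul_inv_cancel hN0 hNt, one_mul]
    set d : Fin N → ℝ≥0∞ := fun k => ∑' j, (P k j).indicator (fun _ => level r j) t with hd
    have hdk : ∀ k, d k + (Q k).indicator (fun _ => D) t = D := by
      intro k
      by_cases htk : t ∈ Q k
      · rw [indicator_of_mem htk, hd]
        dsimp only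
        rw [tsum_indicator_eq_zero _ fun j hj => hj.2 htk, zero_add]
      · rw [indicator_of_notMem htk, add_zero]
        refine tsum_congr fun j => ?_
        by_cases hj : t ∈ levelSet r Y₁ j
        · rw [indicator_of_mem hj, indicator_of_mem (show t ∈ P k j from ⟨hj, htk⟩)]
        · rw [indicator_of_notMem hj, indicator_of_notMem fun h => hj h.1]
    -- Each d k equals D, except for the one k with t in Q k, where it vanishes.
    have hds : ∑ k, d k + D = N * D := by
      calc ∑ k, d k + D = ∑ k, d k + ∑ k : Fin N, (Q k).indicator (fun _ => D) t := by
            rw [sum_indicator_residueSet ht0]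
        _ = ∑ k : Fin N, D := by rw [← Finset.sum_add_distrib]; simp only [hdk]
        _ = _ := by simp
    set Z := ∑ q : Fin N × Fin N, z q.1 q.2 t with hZ
    set C := ∑ q : Fin N × Fin N, (S q).indicator (fun _ => c) t with hC
    have hBs : ∑ q, B q t = Z + C := Finset.sum_add_distrib
    have hZ1 : Z ≤ N * ∑ k, d k + N * ∑ k, g k t + ∑ k, e₁ k t := by
      rw [hZ, Fintype.sum_prod_type, Finset.mul_sum, Finset.mul_sum, ← Finset.sum_add_distrib,
        ← Finset.sum_add_distrib]
      exact Finset.sum_le_sum fun k _ => (hat k).1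
    have hZ2 : N * ∑ k, d k ≤ Z + ∑ k, e₂ k t := by
      rw [hZ, Fintype.sum_prod_type, Finset.mul_sum, ← Finset.sum_add_distrib]
      exact Finset.sum_le_sum fun k _ => (hat k).2
    set U := ∑ l, (T l).indicator (fun _ => c) t with hU
    have hUr : U = ∑ i ∈ Finset.range N, (if c * (i + 1) < N * Y t then c else 0) := by
      rw [← Fin.sum_univ_eq_sum_range (fun i => if c * (i + 1) < N * Y t then c else 0)]
      refine Finset.sum_congr rfl fun l _ => ?_
      rw [indicator_apply]
      rfl
    have hmin : (N : ℝ≥0∞) * min (Y t) c = min (N * Y t) (N * c) :=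
      Monotone.map_min (f := fun a => (N : ℝ≥0∞) * a) fun a b hab => by dsimp only; gcongr
    have hU1 : U ≤ N * min (Y t) c := by
      rw [hUr, hmin]
      exact sum_threshold_le c (N * Y t) N
    have hU2 : N * min (Y t) c ≤ U + c := by
      rw [hUr, hmin]
      exact le_sum_threshold c (N * Y t) N
    have hC1 : C ≤ N * U + N * c := by
      have h1 : ∀ q : Fin N × Fin N, (S q).indicator (fun _ => c) t
          ≤ (T q.2).indicator (fun _ => c) t + (Q q.1).indicator (fun _ => c) t := by
        intro q
        by_cases h1 : t ∈ Q q.1 <;> by_cases h2 : t ∈ T q.2 <;> simp [hS, h1, h2]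
      refine (Finset.sum_le_sum fun q _ => h1 q).trans ?_
      rw [Finset.sum_add_distrib, Fintype.sum_prod_type, Fintype.sum_prod_type_right]
      have h2 : ∑ k : Fin N, (Q k).indicator (fun _ => c) t = c := sum_indicator_residueSet ht0 _
      simp [hU, h2]
    have hC2 : N * U ≤ C := by
      have h1 : N * U = ∑ q : Fin N × Fin N, (T q.2).indicator (fun _ => c) t := by
        rw [Fintype.sum_prod_type]; simp [hU]
      rw [h1]
      exact Finset.sum_le_sum fun q _ =>
        indicator_le_indicator_of_subset subset_union_right (fun _ => zero_le) t
    have hYsplit : Y₁ t + min (Y t) c = Y t := tsub_add_min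
    rw [hBs]
    set m := min (Y t) c
    have hsumW : ∑ k, (e₁ k t + e₂ k t) = ∑ k, e₁ k t + ∑ k, e₂ k t := Finset.sum_add_distrib
    rw [hsumW]
    set E₁ := ∑ k, e₁ k t
    set E₂ := ∑ k, e₂ k t
    set g' := ∑ k, g k t
    set d' := ∑ k, d k
    change (N : ℝ≥0∞) ^ 2 * Y t ≤ Z + C + (N * g' + (E₁ + E₂) + 2 * N * Y t + N * c)
      ∧ Z + C ≤ (N : ℝ≥0∞) ^ 2 * Y t + (N * g' + (E₁ + E₂) + 2 * N * Y t + N * c)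
    constructor
    · calc (N : ℝ≥0∞) ^ 2 * Y t = N * (N * Y₁ t) + N * (N * m) := by rw [← hYsplit]; ring
        _ ≤ N * (N * D + D) + N * (U + c) := by gcongr
        _ = N * d' + 2 * N * D + N * U + N * c := by rw [← hds]; ring
        _ ≤ (Z + E₂) + 2 * N * Y t + C + N * c := by gcongr
        _ = Z + C + (E₂ + 2 * N * Y t + N * c) := by ring
        _ ≤ _ := by
          gcongr
          exact le_add_self.trans le_add_self
    · calc Z + C ≤ (N * d' + N * g' + E₁) + (N * U + N * c) := by gcongr
        _ ≤ (N * (N * Y₁ t) + N * g' + E₁) + (N * (N * m) + N * c) := by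
          gcongr
          calc d' ≤ N * D := by rw [← hds]; exact le_self_add
            _ ≤ _ := by gcongr
        _ = (N : ℝ≥0∞) ^ 2 * Y t + (N * g' + E₁ + N * c) := by rw [← hYsplit]; ring
        _ ≤ (N : ℝ≥0∞) ^ 2 * Y t + (N * g' + (E₁ + (E₂ + 2 * N * Y t)) + N * c) := by
          gcongr
          exact le_self_add
        _ = _ := by ring

/-! ### Normalized dilations and the dilation functional -/

/-- The normalized dilation `τ⁻¹ σ_τ e`. -/
noncomputable def spread (τ : ℝ) (e : ℝ → ℝ≥0∞) : ℝ → ℝ≥0∞ :=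
  fun t => (ENNReal.ofReal τ)⁻¹ * stretch τ e t

theorem measurable_spread {e : ℝ → ℝ≥0∞} (he : Measurable e) (τ : ℝ) : Measurable (spread τ e) :=
  (measurable_stretch he τ).const_mul _

/-- Dilation multiplies the excess by τ; division by τ rescales the level and cancels this factor.
Since excess decreases in the level, normalized dilations decrease with τ. -/
theorem excess_spread {e : ℝ → ℝ≥0∞} (he : Measurable e) {τ : ℝ} (hτ : 0 < τ) (s : ℝ≥0∞) :
    excess (spread τ e) s = excess e (ENNReal.ofReal τ * s) := by
  have h0 : ENNReal.ofReal τ ≠ 0 := by simpa using hτ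
  have ht : ENNReal.ofReal τ ≠ ∞ := ENNReal.ofReal_ne_top
  have h1 := excess_const_mul (stretch τ e) (ENNReal.inv_ne_top.2 h0) (ENNReal.ofReal τ * s)
  rw [← mul_assoc, ENNReal.inv_mul_cancel h0 ht, one_mul, excess_stretch he hτ, ← mul_assoc,
    ENNReal.inv_mul_cancel h0 ht, one_mul] at h1
  exact h1

namespace BanachIdealLattice

variable {E : BanachIdealLattice}

theorem extNorm_spread_antitone (hE : E.IsFullySymmetric) {e : ℝ → ℝ≥0∞} (he : Measurable e)
    {τ τ' : ℝ} (hτ : 0 < τ) (h : τ ≤ τ') : E.extNorm (spread τ' e) ≤ E.extNorm (spread τ e) :=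
  extNorm_le_of_excess_le hE (measurable_spread he τ').aemeasurable fun s _ _ => by
    rw [excess_spread he hτ, excess_spread he (hτ.trans_le h)]
    exact excess_antitone _ (by gcongr)

theorem extNorm_spread_le (hE : E.IsFullySymmetric) {e : ℝ → ℝ≥0∞} (he : Measurable e)
    {τ : ℝ} (h : 1 ≤ τ) : E.extNorm (spread τ e) ≤ E.extNorm e :=
  extNorm_le_of_excess_le hE (measurable_spread he τ).aemeasurable fun s _ _ => by
    rw [excess_spread he (zero_lt_one.trans_le h)]
    refine excess_antitone _ ?_
    calc s = 1 * s := (one_mul s).symm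
      _ ≤ _ := by gcongr; simpa using h

theorem extNorm_stretch {e : ℝ → ℝ≥0∞} {τ : ℝ} (hτ : 0 < τ) :
    E.extNorm (stretch τ e) = ENNReal.ofReal τ * E.extNorm (spread τ e) := by
  have h0 : ENNReal.ofReal τ ≠ 0 := by simpa using hτ
  have ht : ENNReal.ofReal τ ≠ ∞ := ENNReal.ofReal_ne_top
  have h1 := extNorm_const_mul (E := E) (ENNReal.inv_ne_zero.2 ht) (ENNReal.inv_ne_top.2 h0)
    (stretch τ e)
  change E.extNorm (spread τ e) = _ at h1
  rw [h1, ← mul_assoc, ENNReal.mul_inv_cancel h0 ht, one_mul]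

theorem extNorm_rearrangement_ne_top (hE : E.IsFullySymmetric) {x : L0} (hx : x ∈ E.carrier) :
    E.extNorm (rearrangement x) ≠ ∞ := by
  rw [extNorm_rearrangement hE hx]
  exact ENNReal.ofReal_ne_top

theorem extNorm_dilatedRearrangement (hE : E.IsFullySymmetric) {x : L0} (hx : x ∈ E.carrier)
    {τ : ℝ} (hτ0 : 0 < τ) : E.extNorm (fun t => ‖dilatedRearrangement τ x t‖ₑ)
      = E.extNorm (stretch τ (rearrangement x)) := by
  have h1 : ∀ᵐ t ∂semiAxis, ‖dilatedRearrangement τ x t‖ₑ = stretch τ (rearrangement x) t := by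
    filter_upwards [AEEqFun.coeFn_mk _ (dilation_rearrangement_measurable τ x),
      ae_restrict_mem measurableSet_Ioi] with t h1 h2
    have h3 : rearrangement x (t / τ) ≠ ∞ :=
      rearrangement_ne_top (hE.1.1 x hx) (div_pos h2 hτ0)
    rw [dilatedRearrangement, h1, dilation, stretch,
      Real.enorm_of_nonneg ENNReal.toReal_nonneg, ENNReal.ofReal_toReal h3]
  exact le_antisymm (extNorm_mono_ae (h1.mono fun t ht => ht.le))
    (extNorm_mono_ae (h1.mono fun t ht => ht.ge))

theorem dilatedRearrangement_mem (hE : E.IsFullySymmetric) {x : L0} (hx : x ∈ E.carrier)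
    {τ : ℝ} (hτ : 1 ≤ τ) : dilatedRearrangement τ x ∈ E.carrier := by
  have hτ0 : 0 < τ := zero_lt_one.trans_le hτ
  refine mem_of_extNorm_ne_top ?_
  rw [extNorm_dilatedRearrangement hE hx hτ0, extNorm_stretch hτ0]
  exact ENNReal.mul_ne_top ENNReal.ofReal_ne_top (ne_top_of_le_ne_top
    (extNorm_rearrangement_ne_top hE hx) (extNorm_spread_le hE (measurable_rearrangement x) hτ))

theorem extNorm_spread_rearrangement (hE : E.IsFullySymmetric) {x : L0} (hx : x ∈ E.carrier)
    {τ : ℝ} (hτ : 1 ≤ τ) : E.extNorm (spread τ (rearrangement x))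
      = ENNReal.ofReal (1 / τ * E.norm (dilatedRearrangement τ x)) := by
  have hτ0 : 0 < τ := zero_lt_one.trans_le hτ
  rw [one_div, ENNReal.ofReal_mul (by positivity), ENNReal.ofReal_inv_of_pos hτ0,
    ← extNorm_enorm (dilatedRearrangement_mem hE hx hτ), extNorm_dilatedRearrangement hE hx hτ0,
    extNorm_stretch hτ0, ← mul_assoc, ENNReal.inv_mul_cancel (by simpa using hτ0)
    ENNReal.ofReal_ne_top, one_mul]

/-- Monotonicity of the normalized dilation in its parameter allows passage between real and integer
parameters. -/
theorem dilationFunctionalEq_zero_iff (hE : E.IsFullySymmetric) {x : L0} (hx : x ∈ E.carrier) :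
    E.DilationFunctionalEq x 0 ↔
      Tendsto (fun n : ℕ => E.extNorm (spread n (rearrangement x))) atTop (𝓝 0) := by
  have hm := measurable_rearrangement x
  constructor
  · intro h
    have h1 := (ENNReal.tendsto_ofReal h).comp tendsto_natCast_atTop_atTop
    rw [ENNReal.ofReal_zero] at h1
    refine h1.congr' ?_
    filter_upwards [eventually_ge_atTop 1] with n hn
    rw [extNorm_spread_rearrangement hE hx (by exact_mod_cast hn)]
    rfl
  · intro h
    have h1 : Tendsto (fun τ : ℝ => E.extNorm (spread τ (rearrangement x))) atTop (𝓝 0) := by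
      rw [ENNReal.tendsto_atTop_zero] at h ⊢
      intro ε hε
      obtain ⟨n, hn⟩ := h ε hε
      refine ⟨((n + 1 : ℕ) : ℝ), fun τ hτ => ?_⟩
      exact (extNorm_spread_antitone hE hm (by positivity) hτ).trans (hn _ (Nat.le_succ n))
    have h2 : Tendsto (fun τ : ℝ => (E.extNorm (spread τ (rearrangement x))).toReal) atTop
        (𝓝 0) := by
      have h3 := (ENNReal.tendsto_toReal ENNReal.zero_ne_top).comp h1
      rwa [ENNReal.toReal_zero] at h3
    refine h2.congr' ?_
    filter_upwards [eventually_ge_atTop 1] with τ hτ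
    rw [extNorm_spread_rearrangement hE hx hτ, ENNReal.toReal_ofReal]
    exact mul_nonneg (by positivity) (E.norm_nonneg _ (dilatedRearrangement_mem hE hx hτ))

end BanachIdealLattice

/-! ### Sufficiency: norm estimate for the average of extreme points. -/

theorem coeFn_smul_sum_ae {ι : Type*} (S : Finset ι) (a : ℝ) (A : ι → L0) :
    ∀ᵐ t ∂semiAxis, (∑ q ∈ S, a • A q : L0) t = a * ∑ q ∈ S, A q t := by
  have h1 : ∀ᵐ t ∂semiAxis, ∀ q ∈ S, (a • A q : L0) t = a * A q t := by
    rw [eventually_all_finset]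
    exact fun q _ => AEEqFun.coeFn_smul a (A q)
  filter_upwards [AEEqFun.coeFn_finsetSum S (fun q => a • A q), h1] with t h2 h3
  rw [h2, Finset.mul_sum]
  simpa using Finset.sum_congr rfl h3

namespace BanachIdealLattice

variable {E : BanachIdealLattice}

theorem extNorm_const_ne_top (hE : E.IsFullySymmetric) {x : L0} (hx : x ∈ E.carrier) :
    E.extNorm (fun _ => asymptote fun t => ‖x t‖ₑ) ≠ ∞ := by
  obtain ⟨s, hs, hs'⟩ := exists_excess_ne_top (mem_L1AddLInfty hE hx)
  refine ne_top_of_le_ne_top (extNorm_rearrangement_ne_top hE hx) (extNorm_mono_ae ?_)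
  filter_upwards [ae_restrict_mem measurableSet_Ioi] with t ht
  rw [← asymptote_rearrangement]
  exact asymptote_le (rearrangement_antitone x) hs (by rwa [excess_rearrangement]) ht

theorem extNorm_nat_mul {n : ℕ} (hn : n ≠ 0) (e : ℝ → ℝ≥0∞) :
    E.extNorm (fun t => n * e t) = n * E.extNorm e :=
  extNorm_const_mul (Nat.cast_ne_zero.2 hn) (ENNReal.natCast_ne_top n) e

/-- N times the excess of `x` is the excess of σ_N(x*), whose norm is N times that of the normalized
dilation. -/
theorem extNorm_le_nat_mul_spread (hE : E.IsFullySymmetric) {x : L0} {N : ℕ} (hN : N ≠ 0)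
    {e : ℝ → ℝ≥0∞} (he : Measurable e)
    (h : ∀ s, s ≠ 0 → excess e s ≤ N * excess (fun t => ‖x t‖ₑ) s) :
    E.extNorm e ≤ N * E.extNorm (spread N (rearrangement x)) := by
  have hN0 : (0 : ℝ) < N := Nat.cast_pos.2 (Nat.pos_of_ne_zero hN)
  have h1 := extNorm_stretch (E := E) (e := rearrangement x) hN0
  rw [ENNReal.ofReal_natCast] at h1
  rw [← h1]
  refine extNorm_le_of_excess_le hE he.aemeasurable fun s hs _ => ?_
  rw [excess_stretch (measurable_rearrangement x) hN0, excess_rearrangement,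
    ENNReal.ofReal_natCast]
  exact h s hs

/-- Every element of the orbit is close to an average of extreme points. -/
theorem exists_convexHull_extNorm_le (hE : E.IsFullySymmetric) {x y : L0} (hx : x ∈ E.carrier)
    (hy : y ∈ OmegaPlus x) {N : ℕ} (hN : N ≠ 0) :
    ∃ z ∈ convexHull ℝ ((OmegaPlus x).extremePoints ℝ), E.extNorm (fun t => ‖y t - z t‖ₑ)
      ≤ 5 * E.extNorm (spread N (rearrangement x)) + (N : ℝ≥0∞)⁻¹ *
        (2 * E.extNorm (fun t => ‖y t‖ₑ) + E.extNorm fun _ => asymptote fun t => ‖x t‖ₑ) := by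
  have hx1 := mem_L1AddLInfty hE hx
  have : NeZero N := ⟨hN⟩
  have hN0 : (N : ℝ≥0∞) ≠ 0 := Nat.cast_ne_zero.2 hN
  have hNt : (N : ℝ≥0∞) ≠ ∞ := ENNReal.natCast_ne_top N
  obtain ⟨A, W, g, hA, hWm, hgm, hW, hg, hae⟩ := exists_average_extremePoints hx1 hy N
  set c := asymptote fun t => ‖x t‖ₑ with hc
  set ψ := E.extNorm (spread N (rearrangement x)) with hψ
  set R : ℝ → ℝ≥0∞ := fun t => N * g t + ∑ k, W k t + 2 * N * ‖y t‖ₑ + N * c with hR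
  refine ⟨∑ q, ((N : ℝ) ^ 2)⁻¹ • A q, ?_, ?_⟩
  · refine (convex_convexHull ℝ _).sum_mem (fun _ _ => by positivity) ?_
      fun q _ => subset_convexHull ℝ _ (hA q)
    have : (N : ℝ) ≠ 0 := Nat.cast_ne_zero.2 hN
    simp only [Finset.sum_const, Finset.card_univ, Fintype.card_prod, Fintype.card_fin,
      nsmul_eq_mul]
    push_cast
    field_simp
  have hy0 := nonneg_iff_ae.1 hy.1
  have hA0 : ∀ᵐ t ∂semiAxis, ∀ q, 0 ≤ A q t := ae_all_iff.2 fun q => nonneg_iff_ae.1 (hA q).1.1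
  have hpt : ∀ᵐ t ∂semiAxis,
      ‖y t - (∑ q, ((N : ℝ) ^ 2)⁻¹ • A q : L0) t‖ₑ ≤ ((N : ℝ≥0∞) ^ 2)⁻¹ * R t := by
    filter_upwards [hae, hy0, hA0, coeFn_smul_sum_ae Finset.univ ((N : ℝ) ^ 2)⁻¹ A]
      with t h1 h2 h3 h4
    have hNR : (0 : ℝ) < (N : ℝ) ^ 2 := by positivity
    have h5 : ∑ q, ‖A q t‖ₑ = ENNReal.ofReal (∑ q, A q t) := by
      rw [ENNReal.ofReal_sum_of_nonneg fun q _ => h3 q]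
      exact Finset.sum_congr rfl fun q _ => Real.enorm_of_nonneg (h3 q)
    have h6 : (N : ℝ≥0∞) ^ 2 * ‖y t‖ₑ = ENNReal.ofReal ((N : ℝ) ^ 2 * y t) := by
      rw [ENNReal.ofReal_mul hNR.le, Real.enorm_of_nonneg h2, ENNReal.ofReal_pow (by positivity),
        ENNReal.ofReal_natCast]
    rw [h5, h6] at h1
    have h7 := enorm_sub_toReal_le ENNReal.ofReal_ne_top ENNReal.ofReal_ne_top h1.1 h1.2
    rw [ENNReal.toReal_ofReal (mul_nonneg hNR.le h2),
      ENNReal.toReal_ofReal (Finset.sum_nonneg fun q _ => h3 q)] at h7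
    have h8 : y t - (∑ q, ((N : ℝ) ^ 2)⁻¹ • A q : L0) t
        = ((N : ℝ) ^ 2)⁻¹ * ((N : ℝ) ^ 2 * y t - ∑ q, A q t) := by
      rw [h4]
      field_simp
    rw [h8, enorm_mul]
    refine mul_le_mul' (le_of_eq ?_) h7
    rw [Real.enorm_of_nonneg (by positivity), ENNReal.ofReal_inv_of_pos hNR,
      ENNReal.ofReal_pow (by positivity), ENNReal.ofReal_natCast]
  refine (extNorm_mono_ae hpt).trans ?_
  rw [extNorm_const_mul (by simp [hNt]) (by simp [hN0])]
  have hWk : ∀ k, E.extNorm (W k) ≤ N * ψ + N * ψ := by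
    intro k
    obtain ⟨e₁, e₂, h, he₁, he₂, h1, h2⟩ := hW k
    rw [h]
    exact (extNorm_add_le _ _).trans (add_le_add (extNorm_le_nat_mul_spread hE hN he₁ h1)
      (extNorm_le_nat_mul_spread hE hN he₂ h2))
  have hRn : E.extNorm R ≤ N * (N * ψ) + N * (N * ψ + N * ψ)
      + (2 * N : ℕ) * E.extNorm (fun t => ‖y t‖ₑ) + N * E.extNorm (fun _ => c) := by
    have e1 : E.extNorm (fun t => N * g t) ≤ N * (N * ψ) := by
      rw [extNorm_nat_mul hN]
      gcongr
      exact extNorm_le_nat_mul_spread hE hN hgm hg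
    have e2 : E.extNorm (fun t => ∑ k, W k t) ≤ N * (N * ψ + N * ψ) := by
      refine (extNorm_sum_le _ _).trans ((Finset.sum_le_sum fun k _ => hWk k).trans ?_)
      simp [mul_add]
    have e3 := extNorm_nat_mul (E := E) (n := 2 * N) (by positivity) (fun t => ‖y t‖ₑ)
    have e4 := extNorm_nat_mul (E := E) hN (fun _ => c)
    rw [← e3, ← e4]
    push_cast
    refine (extNorm_add_le _ _).trans (add_le_add ?_ le_rfl)
    refine (extNorm_add_le _ _).trans (add_le_add ?_ le_rfl)
    exact (extNorm_add_le _ _).trans (add_le_add e1 e2)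
  refine (mul_le_mul_right hRn _).trans ?_
  have hii : ((N : ℝ≥0∞) ^ 2)⁻¹ = (N : ℝ≥0∞)⁻¹ * (N : ℝ≥0∞)⁻¹ := by
    rw [sq, ENNReal.mul_inv (Or.inl hN0) (Or.inl hNt)]
  have hi : (N : ℝ≥0∞)⁻¹ * N = 1 := ENNReal.inv_mul_cancel hN0 hNt
  rw [hii]
  push_cast
  -- The parked remainders contribute one ψ and the two kinds of averaging errors one ψ each; the
  -- constant 5 of the statement has slack.
  calc (N : ℝ≥0∞)⁻¹ * (N : ℝ≥0∞)⁻¹ * (N * (N * ψ) + N * (N * ψ + N * ψ)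
        + 2 * N * E.extNorm (fun t => ‖y t‖ₑ) + N * E.extNorm (fun _ => c))
      = ((N : ℝ≥0∞)⁻¹ * N) * ((N : ℝ≥0∞)⁻¹ * N) * (3 * ψ) + (N : ℝ≥0∞)⁻¹ * ((N : ℝ≥0∞)⁻¹ * N)
        * (2 * E.extNorm (fun t => ‖y t‖ₑ) + E.extNorm (fun _ => c)) := by ring
    _ = 3 * ψ + (N : ℝ≥0∞)⁻¹ * (2 * E.extNorm (fun t => ‖y t‖ₑ) + E.extNorm (fun _ => c)) := by
      rw [hi]; ring
    _ ≤ _ := by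
      gcongr
      norm_num

theorem omegaPlus_subset_qPlus (hE : E.IsFullySymmetric) {x : L0} (hx : x ∈ E.carrier)
    (h : E.DilationFunctionalEq x 0) : OmegaPlus x ⊆ E.QPlus x := by
  intro y hy
  have hyE := omegaPlus_subset hE hx hy
  rw [dilationFunctionalEq_zero_iff hE hx] at h
  have hyfin : E.extNorm (fun t => ‖y t‖ₑ) ≠ ∞ := by
    rw [extNorm_enorm hyE]; exact ENNReal.ofReal_ne_top
  have hcfin := extNorm_const_ne_top hE hx
  have hlim : Tendsto (fun N : ℕ => 5 * E.extNorm (spread N (rearrangement x)) + (N : ℝ≥0∞)⁻¹ *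
        (2 * E.extNorm (fun t => ‖y t‖ₑ) + E.extNorm fun _ => asymptote fun t => ‖x t‖ₑ))
        atTop (𝓝 0) := by
    have h1 := ENNReal.Tendsto.const_mul (a := 5) h (Or.inr (by simp))
    have h2 := ENNReal.Tendsto.mul_const ENNReal.tendsto_inv_nat_nhds_zero
      (Or.inr (ENNReal.add_ne_top.2 ⟨ENNReal.mul_ne_top (by simp) hyfin, hcfin⟩) :
        (0 : ℝ≥0∞) ≠ 0 ∨ 2 * E.extNorm (fun t => ‖y t‖ₑ)
          + E.extNorm (fun _ => asymptote fun t => ‖x t‖ₑ) ≠ ∞)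
    simpa using h1.add h2
  refine ⟨hyE, fun ε hε => ?_⟩
  obtain ⟨N, hN, hN0⟩ := ((hlim.eventually (gt_mem_nhds (ENNReal.ofReal_pos.2 hε))).and
    (eventually_ne_atTop 0)).exists
  obtain ⟨z, hz, hyz⟩ := exists_convexHull_extNorm_le hE hx hy hN0
  have hzE : z ∈ E.carrier := by
    have h1 : convexHull ℝ ((OmegaPlus x).extremePoints ℝ) ⊆ OmegaPlus x :=
      convexHull_min extremePoints_subset (convex_omegaPlus (mem_L1AddLInfty hE hx))
    exact omegaPlus_subset hE hx (h1 hz)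
  refine ⟨z, hz, hzE, ?_⟩
  have h2 := hyz.trans_lt hN
  rw [extNorm_sub_eq hyE hzE] at h2
  exact (ENNReal.ofReal_lt_ofReal_iff hε).1 h2

end BanachIdealLattice

/-! ### Necessary conditions for extreme points -/

/-- A finite convex function on an open half-line is continuous, and excess is convex in the level.
-/
theorem continuousOn_excess {e : ℝ → ℝ≥0∞} (he : AEMeasurable e semiAxis) {a : ℝ} (ha : 0 ≤ a)
    (hfin : ∀ σ, a < σ → excess e (ENNReal.ofReal σ) ≠ ∞) :
    ContinuousOn (fun σ => excess e (ENNReal.ofReal σ)) (Ioi a) := by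
  have hconv : ConvexOn ℝ (Ioi a) fun σ => (excess e (ENNReal.ofReal σ)).toReal := by
    refine ⟨convex_Ioi a, fun σ hσ τ hτ l m hl hm hlm => ?_⟩
    have hσ0 : 0 ≤ σ := ha.trans (le_of_lt hσ)
    have hτ0 : 0 ≤ τ := ha.trans (le_of_lt hτ)
    have h1 : ENNReal.ofReal l + ENNReal.ofReal m = 1 := by
      rw [← ENNReal.ofReal_add hl hm, hlm, ENNReal.ofReal_one]
    have h2 := excess_convex he (ENNReal.ofReal σ) (ENNReal.ofReal τ) _ _ h1
    rw [← ENNReal.ofReal_mul hl, ← ENNReal.ofReal_mul hm,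
      ← ENNReal.ofReal_add (by positivity) (by positivity)] at h2
    have f1 := ENNReal.mul_ne_top (ENNReal.ofReal_ne_top (r := l)) (hfin σ hσ)
    have f2 := ENNReal.mul_ne_top (ENNReal.ofReal_ne_top (r := m)) (hfin τ hτ)
    have h3 := ENNReal.toReal_mono (ENNReal.add_ne_top.2 ⟨f1, f2⟩) h2
    rw [ENNReal.toReal_add f1 f2, ENNReal.toReal_mul, ENNReal.toReal_mul,
      ENNReal.toReal_ofReal hl, ENNReal.toReal_ofReal hm] at h3
    exact h3
  refine (ENNReal.continuous_ofReal.comp_continuousOn (hconv.continuousOn isOpen_Ioi)).congr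
    fun σ hσ => ?_
  exact (ENNReal.ofReal_toReal (hfin σ hσ)).symm

theorem measurable_L0 (z : L0) : Measurable (z : ℝ → ℝ) := z.stronglyMeasurable.measurable

/-- Transferring a little mass upwards on `A` and downwards on `B`, two sets of equal measure where
`z` is close to `σ`, does not leave the orbit, provided that there is some room near `σ`. -/
theorem perturbation_mem_omegaPlus {x z w : L0} (hx : x ∈ L1AddLInfty) (hz : z ∈ OmegaPlus x)
    {σ ε : ℝ} (hε : 0 < ε) (hσ : 0 ≤ σ - 2 * ε)
    (hroom : excess (fun t => ‖z t‖ₑ) (ENNReal.ofReal (σ - 2 * ε))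
      ≤ excess (fun t => ‖x t‖ₑ) (ENNReal.ofReal (σ + 2 * ε)))
    {A B : Set ℝ} (hA : MeasurableSet A) (hB : MeasurableSet B) (hA0 : A ⊆ Ioi 0) (hB0 : B ⊆ Ioi 0)
    (hAB : Disjoint A B) (hv : volume A = volume B) (hBf : volume B ≠ ∞)
    (hzA : ∀ t ∈ A ∪ B, |z t - σ| < ε)
    (hw : ∀ᵐ t ∂semiAxis, w t = z t + (A.indicator (fun _ => ε) t - B.indicator (fun _ => ε) t)) :
    w ∈ OmegaPlus x := by
  rw [mem_omegaPlus_iff hx] at hz ⊢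
  have hz0 := nonneg_iff_ae.1 hz.1
  have hcase : ∀ᵐ t ∂semiAxis, 0 ≤ z t ∧ ((t ∈ A ∧ t ∉ B ∧ w t = z t + ε) ∨
      (t ∉ A ∧ t ∈ B ∧ w t = z t - ε) ∨ (t ∉ A ∧ t ∉ B ∧ w t = z t)) := by
    filter_upwards [hz0, hw] with t h0 h1
    refine ⟨h0, ?_⟩
    by_cases h2 : t ∈ A
    · have h3 : t ∉ B := Set.disjoint_left.1 hAB h2
      exact Or.inl ⟨h2, h3, by simp [h1, h2, h3]⟩
    · by_cases h3 : t ∈ B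
      · exact Or.inr (Or.inl ⟨h2, h3, by simp [h1, h2, h3, sub_eq_add_neg]⟩)
      · exact Or.inr (Or.inr ⟨h2, h3, by simp [h1, h2, h3]⟩)
  have hw0 : ∀ᵐ t ∂semiAxis, 0 ≤ w t := by
    filter_upwards [hcase] with t ht
    rcases ht with ⟨h0, ⟨h1, h2, h3⟩ | ⟨h1, h2, h3⟩ | ⟨h1, h2, h3⟩⟩
    · rw [h3]; linarith
    · have := abs_lt.1 (hzA t (Or.inr h2))
      rw [h3]; linarith
    · rwa [h3]
  refine ⟨nonneg_iff_ae.2 hw0, fun s => ?_⟩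
  -- At such levels both z and w are above s on A ∪ B, so moving equal masses up on A and down on B
  -- leaves the excess unchanged.
  have hlow : ∀ s, s ≤ ENNReal.ofReal (σ - 2 * ε) →
      excess (fun t => ‖w t‖ₑ) s = excess (fun t => ‖z t‖ₑ) s := by
    intro s hs
    have hst : s ≠ ∞ := ne_top_of_le_ne_top ENNReal.ofReal_ne_top hs
    obtain ⟨r, hr0, rfl⟩ : ∃ r : ℝ, 0 ≤ r ∧ s = ENNReal.ofReal r :=
      ⟨s.toReal, ENNReal.toReal_nonneg, (ENNReal.ofReal_toReal hst).symm⟩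
    rw [ENNReal.ofReal_le_ofReal_iff hσ] at hs
    have hpt : ∀ᵐ t ∂semiAxis, (‖w t‖ₑ - ENNReal.ofReal r)
          + B.indicator (fun _ => ENNReal.ofReal ε) t
        = (‖z t‖ₑ - ENNReal.ofReal r) + A.indicator (fun _ => ENNReal.ofReal ε) t := by
      filter_upwards [hcase, hw0] with t ht htw
      have htz := ht.1
      rw [Real.enorm_of_nonneg htz, Real.enorm_of_nonneg htw, ← ENNReal.ofReal_sub _ hr0,
        ← ENNReal.ofReal_sub _ hr0]
      rcases ht with ⟨h0, ⟨h1, h2, h3⟩ | ⟨h1, h2, h3⟩ | ⟨h1, h2, h3⟩⟩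
      · have := abs_lt.1 (hzA t (Or.inl h1))
        rw [indicator_of_mem h1, indicator_of_notMem h2, add_zero, h3,
          ← ENNReal.ofReal_add (by linarith) hε.le]
        congr 1; ring
      · have := abs_lt.1 (hzA t (Or.inr h2))
        rw [indicator_of_mem h2, indicator_of_notMem h1, add_zero, h3,
          ← ENNReal.ofReal_add (by linarith) hε.le]
        congr 1; ring
      · rw [indicator_of_notMem h1, indicator_of_notMem h2, h3]
    have hint := lintegral_congr_ae hpt
    rw [lintegral_add_right _ (measurable_const.indicator hB),
      lintegral_add_right _ (measurable_const.indicator hA), lintegral_indicator_const hA,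
      lintegral_indicator_const hB, Measure.restrict_apply hA, Measure.restrict_apply hB,
      inter_eq_left.2 hA0, inter_eq_left.2 hB0, hv] at hint
    exact (ENNReal.add_left_inj (ENNReal.mul_ne_top ENNReal.ofReal_ne_top hBf)).1 hint
  rcases le_total s (ENNReal.ofReal (σ - 2 * ε)) with hs | hs
  · rw [hlow s hs]; exact hz.2 s
  -- At intermediate levels monotonicity and the assumed room suffice; above σ + 2ε neither z nor w
  -- has any excess on A ∪ B.
  rcases le_total s (ENNReal.ofReal (σ + 2 * ε)) with hs' | hs'
  · calc _ ≤ excess (fun t => ‖w t‖ₑ) (ENNReal.ofReal (σ - 2 * ε)) := excess_antitone _ hs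
      _ = _ := hlow _ le_rfl
      _ ≤ _ := hroom
      _ ≤ _ := excess_antitone _ hs'
  · refine le_trans (le_of_eq (lintegral_congr_ae ?_)) (hz.2 s)
    filter_upwards [hcase, hw0] with t ht htw
    have hle : ∀ u : ℝ, u ≤ σ + 2 * ε → ENNReal.ofReal u - s = 0 := fun u hu =>
      tsub_eq_zero_of_le ((ENNReal.ofReal_le_ofReal hu).trans hs')
    have htz := ht.1
    rw [Real.enorm_of_nonneg htz, Real.enorm_of_nonneg htw]
    rcases ht with ⟨h0, ⟨h1, h2, h3⟩ | ⟨h1, h2, h3⟩ | ⟨h1, h2, h3⟩⟩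
    · have := abs_lt.1 (hzA t (Or.inl h1))
      rw [hle _ (by linarith), hle _ (by linarith)]
    · have := abs_lt.1 (hzA t (Or.inr h2))
      rw [hle _ (by linarith), hle _ (by linarith)]
    · rw [h3]

/-- An extreme point avoids a neighbourhood of each level at which its excess is not maximal. -/
theorem exists_forall_not_abs_sub_lt {x z : L0} (hx : x ∈ L1AddLInfty)
    (hz : z ∈ (OmegaPlus x).extremePoints ℝ) {a : ℝ} (ha : 0 ≤ a)
    (hfin : ∀ σ, a < σ → excess (fun t => ‖x t‖ₑ) (ENNReal.ofReal σ) ≠ ∞) {σ : ℝ} (hσ : a < σ)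
    (hlt : excess (fun t => ‖z t‖ₑ) (ENNReal.ofReal σ)
      < excess (fun t => ‖x t‖ₑ) (ENNReal.ofReal σ)) :
    ∃ ε, 0 < ε ∧ ∀ᵐ t ∂semiAxis, ¬ |z t - σ| < ε := by
  have hzΩ := hz.1
  have hle := ((mem_omegaPlus_iff hx).1 hz.1).2
  have hfinz : ∀ σ, a < σ → excess (fun t => ‖z t‖ₑ) (ENNReal.ofReal σ) ≠ ∞ := fun σ hσ =>
    ne_top_of_le_ne_top (hfin σ hσ) (hle _)
  have hF := (continuousOn_excess (aemeasurable_enorm z) ha hfinz).continuousAt (Ioi_mem_nhds hσ)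
  have hG := (continuousOn_excess (aemeasurable_enorm x) ha hfin).continuousAt (Ioi_mem_nhds hσ)
  have l1 : Tendsto (fun ε : ℝ => σ - 2 * ε) (𝓝[>] 0) (𝓝 σ) :=
    ((Continuous.tendsto' (by fun_prop) _ _ (by simp)).mono_left nhdsWithin_le_nhds)
  have l2 : Tendsto (fun ε : ℝ => σ + 2 * ε) (𝓝[>] 0) (𝓝 σ) :=
    ((Continuous.tendsto' (by fun_prop) _ _ (by simp)).mono_left nhdsWithin_le_nhds)
  -- By continuity the strict inequality at σ persists between the level σ - 2ε for z and σ + 2ε for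
  -- x; this is the room required by the perturbation.
  obtain ⟨ε, ⟨hroom, hεa⟩, hε⟩ := (((hF.tendsto.comp l1).eventually_lt (hG.tendsto.comp l2)
    hlt).and (l1.eventually (lt_mem_nhds hσ)) |>.and self_mem_nhdsWithin).exists
  simp only [Function.comp_apply] at hroom
  have hε' : 0 < ε := hε
  refine ⟨ε, hε', ?_⟩
  set R : Set ℝ := Ioi 0 ∩ {t | |z t - σ| < ε} with hR
  have hRm : MeasurableSet R := measurableSet_Ioi.inter
    (measurableSet_lt ((measurable_L0 z).sub_const σ).abs measurable_const)
  have hR0 : R ⊆ Ioi 0 := inter_subset_left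
  have hRf : volume R ≠ ∞ := by
    have h1 : ENNReal.ofReal ε * volume R
        ≤ excess (fun t => ‖z t‖ₑ) (ENNReal.ofReal (σ - 2 * ε)) := by
      calc ENNReal.ofReal ε * volume R = ∫⁻ _ in R, ENNReal.ofReal ε := by rw [setLIntegral_const]
        _ ≤ ∫⁻ t in R, (‖z t‖ₑ - ENNReal.ofReal (σ - 2 * ε)) := by
            refine setLIntegral_mono' hRm fun t ht => ?_
            have := abs_lt.1 (show |z t - σ| < ε from ht.2)
            rw [Real.enorm_of_nonneg (by linarith), ← ENNReal.ofReal_sub _ (by linarith)]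
            exact ENNReal.ofReal_le_ofReal (by linarith)
        _ ≤ _ := lintegral_mono' (Measure.restrict_mono hR0 le_rfl) le_rfl
    intro htop
    rw [htop, ENNReal.mul_top (by simpa using hε')] at h1
    exact hfinz _ hεa (top_le_iff.1 h1)
  suffices h : volume R = 0 by
    rw [ae_restrict_iff' measurableSet_Ioi]
    filter_upwards [measure_eq_zero_iff_ae_notMem.1 h] with t ht ht0 hcon
    exact ht ⟨ht0, hcon⟩
  by_contra hRne
  -- If the set where z is within ε of σ had positive measure, shifting z by ε in opposite
  -- directions on its two halves would exhibit z as the midpoint of two distinct points of the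
  -- orbit.
  set h := (volume R).toReal / 2 with hh
  have hh0 : 0 < h := half_pos (ENNReal.toReal_pos hRne hRf)
  have hRp : volume R = ENNReal.ofReal ((2 : ℕ) * h) := by
    rw [hh, Nat.cast_ofNat, mul_div_cancel₀ _ two_ne_zero, ENNReal.ofReal_toReal hRf]
  have hA := measurableSet_part hRm h 0
  have hB := measurableSet_part hRm h 1
  have hAR : part R h 0 ⊆ R := inter_subset_left
  have hBR : part R h 1 ⊆ R := inter_subset_left
  have hAv := volume_part hR0 hh0.le (N := 2) (i := 0) (by norm_num) hRp
  have hBv := volume_part hR0 hh0.le (N := 2) (i := 1) (by norm_num) hRp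
  have hAB : Disjoint (part R h 0) (part R h 1) := part_disjoint R hh0.le zero_ne_one
  set A := part R h 0
  set B := part R h 1
  have hζm : AEStronglyMeasurable
      (fun t => A.indicator (fun _ => ε) t - B.indicator (fun _ => ε) t) semiAxis :=
    ((measurable_const.indicator hA).sub (measurable_const.indicator hB)).aestronglyMeasurable
  set d : L0 := AEEqFun.mk _ hζm with hd
  have hdt := AEEqFun.coeFn_mk _ hζm
  have h1 : z + d ∈ OmegaPlus x := by
    refine perturbation_mem_omegaPlus hx hzΩ hε' (by linarith) hroom.le hA hB (hAR.trans hR0)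
      (hBR.trans hR0) hAB (hAv.trans hBv.symm) (by simp [hBv])
      (fun t ht => (union_subset hAR hBR ht).2) ?_
    filter_upwards [AEEqFun.coeFn_add z d, hdt] with t e1 e2
    rw [e1, Pi.add_apply, hd, e2]
  have h2 : z - d ∈ OmegaPlus x := by
    refine perturbation_mem_omegaPlus hx hzΩ hε' (by linarith) hroom.le hB hA (hBR.trans hR0)
      (hAR.trans hR0) hAB.symm (hBv.trans hAv.symm) (by simp [hAv])
      (fun t ht => (union_subset hBR hAR ht).2) ?_
    filter_upwards [AEEqFun.coeFn_sub z d, hdt] with t e1 e2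
    rw [e1, Pi.sub_apply, hd, e2]
    ring
  have h3 := (mem_extremePoints.1 hz).2 _ h1 _ h2
    ⟨1 / 2, 1 / 2, by norm_num, by norm_num, by norm_num, by module⟩
  have h4 : d = 0 := by simpa using h3.1
  have h5 : ∀ᵐ t ∂semiAxis, t ∉ A := by
    filter_upwards [hdt, AEEqFun.coeFn_zero (α := ℝ) (β := ℝ) (μ := semiAxis)] with t e1 e2 htA
    rw [← hd, h4, e2] at e1
    simp only [indicator_of_mem htA, indicator_of_notMem (Set.disjoint_left.1 hAB htA)] at e1
    simp only [Pi.zero_apply, sub_zero] at e1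
    exact hε'.ne e1
  have h6 := measure_eq_zero_iff_ae_notMem.2 h5
  rw [Measure.restrict_apply hA, inter_eq_left.2 (hAR.trans hR0), hAv] at h6
  simp only [ENNReal.ofReal_eq_zero] at h6
  linarith

/-- Every level in S has a neighbourhood that is null for the distribution of z; the line being
second countable, S itself is null. -/
theorem ae_notMem_of_excess_lt {x z : L0} (hx : x ∈ L1AddLInfty)
    (hz : z ∈ (OmegaPlus x).extremePoints ℝ) {a : ℝ} (ha : 0 ≤ a)
    (hfin : ∀ σ, a < σ → excess (fun t => ‖x t‖ₑ) (ENNReal.ofReal σ) ≠ ∞) {S : Set ℝ}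
    (hS : MeasurableSet S) (hSa : S ⊆ Ioi a)
    (hlt : ∀ σ ∈ S, excess (fun t => ‖z t‖ₑ) (ENNReal.ofReal σ)
      < excess (fun t => ‖x t‖ₑ) (ENNReal.ofReal σ)) :
    ∀ᵐ t ∂semiAxis, z t ∉ S := by
  have h1 : semiAxis.map z S = 0 := by
    refine measure_null_of_locally_null S fun σ hσ => ?_
    obtain ⟨ε, hε, h⟩ := exists_forall_not_abs_sub_lt hx hz ha hfin (hSa hσ) (hlt σ hσ)
    refine ⟨Metric.ball σ ε, mem_nhdsWithin_of_mem_nhds (Metric.ball_mem_nhds σ hε), ?_⟩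
    rw [Measure.map_apply (measurable_L0 z) measurableSet_ball, measure_eq_zero_iff_ae_notMem]
    filter_upwards [h] with t ht ht'
    exact ht (by rwa [mem_preimage, Metric.mem_ball, Real.dist_eq] at ht')
  rwa [Measure.map_apply (measurable_L0 z) hS, measure_eq_zero_iff_ae_notMem] at h1

/-- For extreme points the set of levels with maximal excess is upward closed. -/
theorem excess_eq_of_le {x z : L0} (hx : x ∈ L1AddLInfty)
    (hz : z ∈ (OmegaPlus x).extremePoints ℝ) {a : ℝ} (ha : 0 ≤ a)
    (hfin : ∀ σ, a < σ → excess (fun t => ‖x t‖ₑ) (ENNReal.ofReal σ) ≠ ∞) {σ τ : ℝ} (hσ : a < σ)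
    (hστ : σ ≤ τ) (h : excess (fun t => ‖z t‖ₑ) (ENNReal.ofReal σ)
      = excess (fun t => ‖x t‖ₑ) (ENNReal.ofReal σ)) :
    excess (fun t => ‖z t‖ₑ) (ENNReal.ofReal τ) = excess (fun t => ‖x t‖ₑ) (ENNReal.ofReal τ) := by
  set F := fun σ => excess (fun t => ‖z t‖ₑ) (ENNReal.ofReal σ) with hF
  set G := fun σ => excess (fun t => ‖x t‖ₑ) (ENNReal.ofReal σ) with hG
  change F τ = G τ
  have hle : ∀ σ, F σ ≤ G σ := fun σ => ((mem_omegaPlus_iff hx).1 hz.1).2 _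
  have hFc : ContinuousOn F (Ioi a) := continuousOn_excess (aemeasurable_enorm z) ha fun σ hσ =>
    ne_top_of_le_ne_top (hfin σ hσ) (hle _)
  have hGc : ContinuousOn G (Ioi a) := continuousOn_excess (aemeasurable_enorm x) ha hfin
  by_contra hne
  have hcl : ∀ {b d : ℝ}, a < b → IsCompact (Icc b d ∩ {r | F r = G r}) := by
    intro b d hb
    have hsub : Icc b d ⊆ Ioi a := fun r hr => lt_of_lt_of_le hb hr.1
    have h1 := ((hFc.mono hsub).prodMk (hGc.mono hsub)).preimage_isClosed_of_isClosed
      isClosed_Icc isClosed_diagonal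
    exact isCompact_Icc.of_isClosed_subset h1 inter_subset_left
  -- Here u is the last level before τ with maximal excess; below, v is the first one after τ, if
  -- there is any.
  obtain ⟨u, ⟨⟨huσ, huτ⟩, hu⟩, hu'⟩ := (hcl (d := τ) hσ).exists_isGreatest
    ⟨σ, ⟨le_rfl, hστ⟩, h⟩
  have hau : a < u := hσ.trans_le huσ
  have huτ' : u < τ := lt_of_le_of_ne huτ fun h => hne (h ▸ hu)
  have hz0 := nonneg_iff_ae.1 hz.1.1
  have hu0 : 0 ≤ u := ha.trans hau.le
  by_cases hv : ∃ d, τ ≤ d ∧ F d = G d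
  · obtain ⟨d, hτd, hd⟩ := hv
    obtain ⟨v, ⟨⟨hτv, hvd⟩, hv⟩, hv'⟩ := (hcl (d := d) (hau.trans huτ')).exists_isLeast
      ⟨d, ⟨hτd, le_rfl⟩, hd⟩
    have hτv' : τ < v := lt_of_le_of_ne hτv fun h => hne (h ▸ hv)
    have hlt : ∀ r ∈ Ioo u v, F r < G r := by
      refine fun r hr => lt_of_le_of_ne (hle r) fun heq => ?_
      rcases le_total r τ with hrτ | hrτ
      · exact absurd (hu' ⟨⟨huσ.trans hr.1.le, hrτ⟩, heq⟩) (not_le.2 hr.1)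
      · exact absurd (hv' ⟨⟨hrτ, hr.2.le.trans hvd⟩, heq⟩) (not_le.2 hr.2)
    have hav := ae_notMem_of_excess_lt hx hz ha hfin measurableSet_Ioo
      (fun r hr => hau.trans hr.1) hlt
    obtain ⟨l, m, hl, hm, hlm, hτe⟩ : ∃ l m : ℝ, 0 ≤ l ∧ 0 ≤ m ∧ l + m = 1 ∧ l * v + m * u = τ := by
      have : 0 < v - u := by linarith
      refine ⟨(τ - u) / (v - u), (v - τ) / (v - u), div_nonneg (by linarith) this.le,
        div_nonneg (by linarith) this.le, ?_, ?_⟩ <;> field_simp <;> ring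
    have hlm' : ENNReal.ofReal l + ENNReal.ofReal m = 1 := by
      rw [← ENNReal.ofReal_add hl hm, hlm, ENNReal.ofReal_one]
    have hτe' : ENNReal.ofReal τ = ENNReal.ofReal l * ENNReal.ofReal v
        + ENNReal.ofReal m * ENNReal.ofReal u := by
      rw [← ENNReal.ofReal_mul hl, ← ENNReal.ofReal_mul hm, ← ENNReal.ofReal_add
        (mul_nonneg hl (by linarith)) (mul_nonneg hm hu0), hτe]
    -- As z avoids (u, v), its excess is affine between two levels of equality, so at τ it cannot be
    -- smaller than the convex excess of x.
    have hFaff : F τ = ENNReal.ofReal l * F v + ENNReal.ofReal m * F u := by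
      simp only [hF, excess]
      rw [← lintegral_const_mul' _ _ ENNReal.ofReal_ne_top,
        ← lintegral_const_mul' _ _ ENNReal.ofReal_ne_top,
        ← lintegral_add_left' (((aemeasurable_enorm z).sub_const _).const_mul _)]
      refine lintegral_congr_ae ?_
      filter_upwards [hav, hz0] with t ht ht0
      rw [hτe']
      refine tsub_affine hlm' (ENNReal.ofReal_le_ofReal (by linarith)) ENNReal.ofReal_ne_top ?_
      rw [Real.enorm_of_nonneg ht0]
      by_cases htu : z t ≤ u
      · exact Or.inl (ENNReal.ofReal_le_ofReal htu)
      · exact Or.inr (ENNReal.ofReal_le_ofReal (by_contra fun h => ht ⟨not_le.1 htu, not_le.1 h⟩))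
    have hGconv : G τ ≤ ENNReal.ofReal l * G v + ENNReal.ofReal m * G u := by
      simp only [hG]
      rw [hτe']
      exact excess_convex (aemeasurable_enorm x) _ _ _ _ hlm'
    rw [← hv, ← hu, ← hFaff] at hGconv
    exact hne (le_antisymm (hle τ) hGconv)
  · push Not at hv
    have hlt : ∀ r ∈ Ioi u, F r < G r := by
      refine fun r hr => lt_of_le_of_ne (hle r) fun heq => ?_
      rcases le_total r τ with hrτ | hrτ
      · exact absurd (hu' ⟨⟨huσ.trans (le_of_lt hr), hrτ⟩, heq⟩) (not_le.2 hr)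
      · exact hv r hrτ heq
    have hav := ae_notMem_of_excess_lt hx hz ha hfin measurableSet_Ioi
      (fun r hr => hau.trans hr) hlt
    -- Without equality after u, z takes no values above u; the common excess at u is then 0, and so
    -- is that of x at all higher levels.
    have hFu : F u = 0 := by
      refine (lintegral_congr_ae ?_).trans lintegral_zero
      filter_upwards [hav, hz0] with t ht ht0
      rw [Real.enorm_of_nonneg ht0]
      exact tsub_eq_zero_of_le (ENNReal.ofReal_le_ofReal (not_lt.1 ht))
    have hGτ : G τ ≤ G u := excess_antitone _ (ENNReal.ofReal_le_ofReal huτ)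
    rw [← hu, hFu] at hGτ
    exact hne (le_antisymm (hle τ) (hGτ.trans zero_le))

theorem excess_top (e : ℝ → ℝ≥0∞) : excess e ∞ = 0 := by simp [excess]

/-- An extreme point has maximal excess at all high levels, or does not exceed the asymptote. -/
theorem eventually_excess_eq_or_le_asymptote {x z : L0} (hx : x ∈ L1AddLInfty)
    (hz : z ∈ (OmegaPlus x).extremePoints ℝ) :
    (∃ r : ℝ≥0∞, r ≠ ∞ ∧ ∀ s, r ≤ s →
      excess (fun t => ‖z t‖ₑ) s = excess (fun t => ‖x t‖ₑ) s) ∨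
    ∀ᵐ t ∂semiAxis, ‖z t‖ₑ ≤ asymptote fun t => ‖x t‖ₑ := by
  obtain ⟨s0, hs0, hs0'⟩ := exists_excess_ne_top hx
  have hcfin := asymptote_ne_top hs0 hs0'
  set c := asymptote fun t => ‖x t‖ₑ with hc
  have hfin : ∀ σ, c.toReal < σ → excess (fun t => ‖x t‖ₑ) (ENNReal.ofReal σ) ≠ ∞ := fun σ hσ =>
    excess_ne_top_of_asymptote_lt ((ENNReal.lt_ofReal_iff_toReal_lt hcfin).2 hσ)
  have hle := ((mem_omegaPlus_iff hx).1 hz.1).2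
  by_cases h : ∃ σ, c.toReal < σ ∧ excess (fun t => ‖z t‖ₑ) (ENNReal.ofReal σ)
      = excess (fun t => ‖x t‖ₑ) (ENNReal.ofReal σ)
  · obtain ⟨σ, hσ, hσe⟩ := h
    refine Or.inl ⟨ENNReal.ofReal σ, ENNReal.ofReal_ne_top, fun s hs => ?_⟩
    by_cases hst : s = ∞
    · simp [hst, excess_top]
    rw [← ENNReal.ofReal_toReal hst]
    exact excess_eq_of_le hx hz ENNReal.toReal_nonneg hfin hσ
      ((ENNReal.ofReal_le_iff_le_toReal hst).1 hs) hσe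
  · push Not at h
    right
    have hav := ae_notMem_of_excess_lt hx hz ENNReal.toReal_nonneg hfin measurableSet_Ioi
      (fun r hr => hr) fun r hr => lt_of_le_of_ne (hle _) (h r hr)
    filter_upwards [hav, nonneg_iff_ae.1 hz.1.1] with t ht ht0
    rw [Real.enorm_of_nonneg ht0, ← ENNReal.ofReal_toReal hcfin]
    exact ENNReal.ofReal_le_ofReal (not_lt.1 ht)

/-- If `x` vanishes at infinity, an extreme point has maximal excess at all levels or is
integrable. -/
theorem excess_eq_or_lintegral_ne_top {x z : L0} (hx : x ∈ L1AddLInfty)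
    (hz : z ∈ (OmegaPlus x).extremePoints ℝ) (hc : asymptote (fun t => ‖x t‖ₑ) = 0) :
    (∀ s, s ≠ 0 → excess (fun t => ‖z t‖ₑ) s = excess (fun t => ‖x t‖ₑ) s) ∨
    ∫⁻ t, ‖z t‖ₑ ∂semiAxis ≠ ∞ := by
  have hfin : ∀ σ, (0 : ℝ) < σ → excess (fun t => ‖x t‖ₑ) (ENNReal.ofReal σ) ≠ ∞ := fun σ hσ =>
    excess_ne_top_of_asymptote_lt (by simpa [hc] using hσ)
  have hle := ((mem_omegaPlus_iff hx).1 hz.1).2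
  by_cases h : ∀ σ : ℝ, 0 < σ → excess (fun t => ‖z t‖ₑ) (ENNReal.ofReal σ)
      = excess (fun t => ‖x t‖ₑ) (ENNReal.ofReal σ)
  · refine Or.inl fun s hs => ?_
    by_cases hst : s = ∞
    · simp [hst, excess_top]
    rw [← ENNReal.ofReal_toReal hst]
    exact h _ (ENNReal.toReal_pos hs hst)
  · push Not at h
    obtain ⟨σ, hσ, hne⟩ := h
    right
    -- Maximal excess is inherited upwards, so its failure at σ entails failure on (0, σ]. Then z
    -- avoids (0, σ] and is at most 2(z - σ/2)⁺, which is integrable.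
    have hav := ae_notMem_of_excess_lt hx hz le_rfl hfin (S := Ioc 0 σ) measurableSet_Ioc
      (fun r hr => hr.1) fun r hr => lt_of_le_of_ne (hle _) fun heq =>
        hne (excess_eq_of_le hx hz le_rfl hfin hr.1 hr.2 heq)
    have hpt : ∀ᵐ t ∂semiAxis, ‖z t‖ₑ ≤ 2 * (‖z t‖ₑ - ENNReal.ofReal (σ / 2)) := by
      filter_upwards [hav, nonneg_iff_ae.1 hz.1.1] with t ht ht0
      rcases ht0.eq_or_lt with h0 | h0
      · simp [← h0]
      · rw [Real.enorm_of_nonneg ht0, ← ENNReal.ofReal_sub _ (by positivity),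
          ← ENNReal.ofReal_ofNat, ← ENNReal.ofReal_mul (by norm_num)]
        refine ENNReal.ofReal_le_ofReal ?_
        have : σ < z t := by
          by_contra hcon
          exact ht ⟨h0, not_lt.1 hcon⟩
        linarith
    refine ne_top_of_le_ne_top ?_ (lintegral_mono_ae hpt)
    rw [lintegral_const_mul' _ _ (by simp)]
    exact ENNReal.mul_ne_top (by simp) (ne_top_of_le_ne_top (hfin _ (half_pos hσ)) (hle _))

/-! ### Lower bounds for norms -/

theorem tsub_add_tsub_le (a b s : ℝ≥0∞) : (a - s) + (b - s) ≤ (a + b) - s := by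
  by_cases hs : s = ∞
  · simp [hs]
  rcases le_total a s with ha | ha
  · rw [tsub_eq_zero_of_le ha, zero_add]
    exact tsub_le_tsub_right le_add_self s
  · calc (a - s) + (b - s) ≤ (a - s) + b := by gcongr; exact tsub_le_self
      _ = (a + b) - s := (ENNReal.cancel_of_ne hs).tsub_add_eq_add_tsub ha

theorem sum_tsub_le {ι : Type*} (S : Finset ι) (a : ι → ℝ≥0∞) (s : ℝ≥0∞) :
    ∑ i ∈ S, (a i - s) ≤ (∑ i ∈ S, a i) - s := by
  classical
  induction S using Finset.induction_on with
  | empty => simp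
  | insert i S hi ih =>
    rw [Finset.sum_insert hi, Finset.sum_insert hi]
    exact (add_le_add le_rfl ih).trans (tsub_add_tsub_le _ _ _)

/-- At a fixed level positive parts are superadditive. This bounds the excess of a sum from below
without any disjointness. -/
theorem sum_excess_le {ι : Type*} (S : Finset ι) {a : ι → ℝ → ℝ≥0∞}
    (ha : ∀ i, Measurable (a i)) (s : ℝ≥0∞) :
    ∑ i ∈ S, excess (a i) s ≤ excess (fun t => ∑ i ∈ S, a i t) s := by
  unfold excess
  rw [← lintegral_finsetSum S fun i _ => (ha i).sub_const s]
  exact lintegral_mono fun t => sum_tsub_le S (fun i => a i t) s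

theorem excess_indicator {A : Set ℝ} (hA : MeasurableSet A) (hA0 : A ⊆ Ioi 0) (e : ℝ → ℝ≥0∞)
    (s : ℝ≥0∞) : excess (A.indicator e) s = ∫⁻ t in A, (e t - s) := by
  have h1 : ∀ t, A.indicator e t - s = A.indicator (fun t => e t - s) t := fun t => by
    by_cases ht : t ∈ A <;> simp [ht]
  unfold excess
  simp only [h1]
  rw [lintegral_indicator hA, Measure.restrict_restrict hA, inter_eq_left.2 hA0]

theorem excess_eq_setLIntegral_add (e : ℝ → ℝ≥0∞) (s : ℝ≥0∞) {p : ℝ} (hp : 0 ≤ p) :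
    excess e s = (∫⁻ t in Ioc 0 p, (e t - s)) + ∫⁻ t in Ioi p, (e t - s) := by
  rw [excess, semiAxis, ← Ioc_union_Ioi_eq_Ioi hp, lintegral_union measurableSet_Ioi
    (Set.disjoint_left.2 fun u hu hu' => absurd hu.2 (not_le.2 hu'))]

theorem setLIntegral_Ioc_tsub_le {e f : ℝ → ℝ≥0∞} (hf : Antitone f)
    (h : ∀ s, excess e s ≤ excess f s) {p : ℝ} (hp : 0 ≤ p) (a : ℝ≥0∞) :
    ∫⁻ t in Ioc 0 p, (e t - a) ≤ ∫⁻ t in Ioc 0 p, (f t - a) := by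
  have hfa : Antitone fun t => f t - a := fun s t hst => tsub_le_tsub_right (hf hst) a
  have h1 := setLIntegral_le_excess (B := Ioc 0 p) (fun t ht => ht.1) (fun t => e t - a) (f p - a)
  rw [Real.volume_Ioc, sub_zero, excess_tsub] at h1
  refine h1.trans ?_
  rw [← excess_add_eq_primitive hfa hp, excess_tsub]
  gcongr
  exact h _

/-- No function of the orbit has more mass above `a` on (0, p] than the decreasing `f`; when the
total excess at `a` agrees, it has no less than `f` on (p, ∞). -/
theorem setLIntegral_Ioi_tsub_le {e f : ℝ → ℝ≥0∞} (hf : Antitone f)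
    (h : ∀ s, excess e s ≤ excess f s) {p : ℝ} (hp : 0 ≤ p) {a : ℝ≥0∞}
    (ha : excess e a = excess f a) (hfin : excess f a ≠ ∞) :
    ∫⁻ t in Ioi p, (f t - a) ≤ ∫⁻ t in Ioi p, (e t - a) := by
  have h1 := setLIntegral_Ioc_tsub_le hf h hp a
  rw [excess_eq_setLIntegral_add e a hp, excess_eq_setLIntegral_add f a hp] at ha
  rw [excess_eq_setLIntegral_add f a hp] at hfin
  have h2 : ∫⁻ t in Ioc 0 p, (f t - a) ≠ ∞ := (ENNReal.add_ne_top.1 hfin).1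
  refine (ENNReal.add_le_add_iff_left h2).1 ?_
  rw [← ha]
  gcongr

namespace BanachIdealLattice

variable {E : BanachIdealLattice}

/-- A lower bound for the part of a convex combination that lies far above a bounded function. -/
theorem extNorm_spread_le_four_mul (hE : E.IsFullySymmetric) {f : ℝ → ℝ≥0∞} (hf : Antitone f)
    {p : ℝ} (hp : 0 ≤ p) {σ v : ℝ≥0∞} (hfin : excess f σ ≠ ∞) {ι : Type*} (I : Finset ι)
    {l : ι → ℝ≥0∞} {n : ℕ} (hn : n ≠ 0) (hl : ∀ i, (n : ℝ≥0∞)⁻¹ ≤ l i) (hlt : ∀ i, l i ≠ ∞)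
    {Z : ι → ℝ → ℝ≥0∞} (hZ : ∀ i, Measurable (Z i)) (hZt : ∀ i t, Z i t ≠ ∞)
    (hle : ∀ i ∈ I, ∀ s, excess (Z i) s ≤ excess f s)
    (heq : ∀ i ∈ I, ∀ s, σ ≤ s → excess (Z i) s = excess f s) (hI : 2⁻¹ ≤ ∑ i ∈ I, l i)
    {e : ℝ → ℝ≥0∞} (he : ∀ᵐ t ∂semiAxis, p < t → ∑ i ∈ I, l i * Z i t ≤ v + e t)
    (hv : 2 * n * v ≤ σ) :
    E.extNorm (spread n ((Ioi p).indicator fun t => f t - σ)) ≤ 4 * E.extNorm e := by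
  have hn0 : (n : ℝ≥0∞) ≠ 0 := Nat.cast_ne_zero.2 hn
  have hnt : (n : ℝ≥0∞) ≠ ∞ := ENNReal.natCast_ne_top n
  have hl0 : ∀ i, l i ≠ 0 := fun i h => by simpa [h, hnt] using hl i
  have hp0 : Ioi p ⊆ Ioi (0 : ℝ) := Ioi_subset_Ioi hp
  set g : ℝ → ℝ≥0∞ := (Ioi p).indicator fun t => f t - σ with hg
  have hgm : Measurable g := (hf.measurable.sub_const σ).indicator measurableSet_Ioi
  set u : ι → ℝ → ℝ≥0∞ := fun i => (Ioi p).indicator fun t => Z i t - σ with hu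
  have hum : ∀ i, Measurable (u i) := fun i => ((hZ i).sub_const σ).indicator measurableSet_Ioi
  set h : ℝ → ℝ≥0∞ := fun t => ∑ i ∈ I, l i * u i t with hh
  -- Where some Z i exceeds σ, the sum T satisfies T ≥ σ/n ≥ 2v, and T ≤ v + e then gives T ≤ 2e.
  -- Elsewhere h vanishes.
  have hhe : ∀ᵐ t ∂semiAxis, h t ≤ 2 * e t := by
    filter_upwards [he] with t ht
    by_cases htp : t ∈ Ioi p
    swap
    · simp [hh, hu, htp]
    have hhT : h t ≤ ∑ i ∈ I, l i * Z i t := by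
      refine Finset.sum_le_sum fun i _ => ?_
      simp only [hu, indicator_of_mem htp]
      gcongr
      exact tsub_le_self
    by_cases hex : ∃ i ∈ I, σ < Z i t
    · obtain ⟨i, hi, hσ⟩ := hex
      set T := ∑ i ∈ I, l i * Z i t with hT
      have hTt : T ≠ ∞ := ENNReal.sum_ne_top.2 fun i _ => ENNReal.mul_ne_top (hlt i) (hZt i t)
      have h1 : 2 * v ≤ T := by
        calc 2 * v = (n : ℝ≥0∞)⁻¹ * (2 * n * v) := by
              rw [mul_comm (2 : ℝ≥0∞) n, mul_assoc, ← mul_assoc, ENNReal.inv_mul_cancel hn0 hnt,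
                one_mul]
          _ ≤ l i * Z i t := mul_le_mul' (hl i) (hv.trans hσ.le)
          _ ≤ T := Finset.single_le_sum (f := fun i => l i * Z i t) (fun _ _ => zero_le) hi
      have h2 : T + T ≤ 2 * e t + T := by
        calc T + T ≤ (v + e t) + (v + e t) := add_le_add (ht htp) (ht htp)
          _ = 2 * e t + 2 * v := by ring
          _ ≤ _ := by gcongr
      exact hhT.trans ((ENNReal.add_le_add_iff_right hTt).1 h2)
    · push Not at hex
      have : h t = 0 := Finset.sum_eq_zero fun i hi => by
        simp only [hu, indicator_of_mem htp, tsub_eq_zero_of_le (hex i hi), mul_zero]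
      rw [this]
      exact zero_le
  have hug : ∀ i ∈ I, ∀ r, excess g r ≤ excess (u i) r := by
    intro i hi r
    simp only [hg, hu]
    rw [excess_indicator measurableSet_Ioi hp0, excess_indicator measurableSet_Ioi hp0]
    simp only [tsub_tsub]
    have hσr : σ ≤ σ + r := le_self_add
    exact setLIntegral_Ioi_tsub_le hf (hle i hi) hp (heq i hi _ hσr)
      (ne_top_of_le_ne_top hfin (excess_antitone f hσr))
  -- The weight l i rescales the level by its inverse, which is at most n. This is where the
  -- dilation by n comes from.
  have hhex : ∀ s, 2⁻¹ * excess g (n * s) ≤ excess h s := by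
    intro s
    calc 2⁻¹ * excess g (n * s) ≤ (∑ i ∈ I, l i) * excess g (n * s) := by gcongr
      _ = ∑ i ∈ I, l i * excess g (n * s) := Finset.sum_mul _ _ _
      _ ≤ ∑ i ∈ I, excess (fun t => l i * u i t) s := by
        refine Finset.sum_le_sum fun i hi => ?_
        rw [excess_const_mul' _ (hl0 i) (hlt i)]
        gcongr
        refine (hug i hi _).trans (excess_antitone _ ?_)
        gcongr
        exact ENNReal.inv_le_iff_inv_le.1 (hl i)
      _ ≤ excess h s := sum_excess_le I (fun i => (hum i).const_mul _) s
  have h2 : (2⁻¹ : ℝ≥0∞) ≠ 0 := by simp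
  have h3 : (2⁻¹ : ℝ≥0∞) ≠ ∞ := by simp
  have hnr : (0 : ℝ) < n := Nat.cast_pos.2 (Nat.pos_of_ne_zero hn)
  have h4 : 2⁻¹ * E.extNorm (spread n g) ≤ E.extNorm h := by
    rw [← extNorm_const_mul h2 h3]
    refine extNorm_le_of_excess_le hE ((measurable_spread hgm n).const_mul _).aemeasurable
      fun s _ _ => ?_
    rw [excess_const_mul' _ h2 h3]
    refine le_trans ?_ (hhex s)
    gcongr
    rw [excess_spread hgm hnr, ENNReal.ofReal_natCast, inv_inv]
    refine excess_antitone _ ?_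
    gcongr
    rw [two_mul]
    exact le_self_add
  have h5 : E.extNorm h ≤ 2 * E.extNorm e := by
    rw [← extNorm_const_mul (by simp) (by simp)]
    exact extNorm_mono_ae hhe
  calc E.extNorm (spread n g) = 2 * (2⁻¹ * E.extNorm (spread n g)) := by
        rw [← mul_assoc, ENNReal.mul_inv_cancel (by simp) (by simp), one_mul]
    _ ≤ 2 * (2 * E.extNorm e) := mul_le_mul' le_rfl (h4.trans h5)
    _ = 4 * E.extNorm e := by ring

theorem exists_lt_extNorm_spread (hE : E.IsFullySymmetric) (hF : E.IsFatouNorm)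
    {e : ℕ → ℝ → ℝ≥0∞} {e' : ℝ → ℝ≥0∞} (he : ∀ m, Measurable (e m)) (he' : Measurable e')
    (hmono : Monotone e) (hlim : ∀ t, 0 < t → Tendsto (fun m => e m t) atTop (𝓝 (e' t)))
    (hfin : E.extNorm e' ≠ ∞) {n : ℕ} (hn : n ≠ 0) {r : ℝ≥0∞} (hr : r < E.extNorm (spread n e')) :
    ∃ m, r < E.extNorm (spread n (e m)) := by
  have hnr : (1 : ℝ) ≤ n := Nat.one_le_cast.2 (Nat.pos_of_ne_zero hn)
  refine exists_lt_extNorm_of_isFatouNorm hF (fun m => measurable_spread (he m) n)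
    (measurable_spread he' n) (fun i j hij t => ?_) ?_
    (ne_top_of_le_ne_top hfin (extNorm_spread_le hE he' hnr)) hr
  · simp only [spread, stretch]
    gcongr
    exact hmono hij _
  · filter_upwards [ae_restrict_mem measurableSet_Ioi] with t ht
    simp only [spread, stretch]
    refine ENNReal.Tendsto.const_mul (hlim _ (div_pos ht (by linarith))) (Or.inr ?_)
    simp only [ENNReal.ofReal_natCast, ne_eq, ENNReal.inv_eq_top, Nat.cast_eq_zero]
    exact hn

/-- Spreading out a bounded integrable function makes its norm small. -/
theorem exists_extNorm_spread_le (hE : E.IsFullySymmetric)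
    (hL1 : ¬ ((E.carrier : Set L0) ⊆ L1)) {h : ℝ → ℝ≥0∞} (hh : Measurable h)
    (hint : ∫⁻ t, h t ∂semiAxis ≠ ∞) {M : ℝ≥0∞} (hM : M ≠ ∞) (hb : ∀ t, h t ≤ M) {ε : ℝ≥0∞}
    (hε : ε ≠ 0) : ∃ n : ℕ, n ≠ 0 ∧ E.extNorm (spread n h) ≤ ε := by
  obtain ⟨u, hu, huL⟩ := not_subset.1 hL1
  have huint : ∫⁻ t, ‖u t‖ₑ ∂semiAxis = ∞ := by
    by_contra hne
    refine huL (memLp_one_iff_integrable.2 ⟨u.aestronglyMeasurable, ?_⟩)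
    exact lt_top_iff_ne_top.2 hne
  have huE : E.extNorm (fun t => ‖u t‖ₑ) ≠ ∞ := by
    rw [extNorm_enorm hu]; exact ENNReal.ofReal_ne_top
  have hu0 : E.extNorm (fun t => ‖u t‖ₑ) ≠ 0 := fun h0 => by
    have h1 := ae_eq_zero_of_extNorm_eq_zero (aemeasurable_enorm u) h0
    rw [lintegral_congr_ae h1, lintegral_zero] at huint
    simp at huint
  by_cases hεt : ε = ∞
  · exact ⟨1, one_ne_zero, hεt ▸ le_top⟩
  set η := ε / E.extNorm (fun t => ‖u t‖ₑ) with hη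
  have hη0 : η ≠ 0 := ENNReal.div_ne_zero.2 ⟨hε, huE⟩
  have hηt : η ≠ ∞ := ENNReal.div_ne_top hεt hu0
  -- As u is in E but not integrable, the excess of η|u| tends to ∞ as the level drops to 0, so it
  -- exceeds the integral of h at some level 1/(m + 1).
  have h1 := tendsto_excess ((aemeasurable_enorm u).const_mul η) 0 (antitone_add_inv_nat 0)
    (tendsto_add_inv_nat 0)
  rw [excess_zero_right, lintegral_const_mul' _ _ hηt, huint, ENNReal.mul_top hη0] at h1
  obtain ⟨m, hm⟩ := (h1.eventually (lt_mem_nhds (lt_top_iff_ne_top.2 hint))).exists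
  rw [zero_add] at hm
  -- For n > M(m + 1) the excess of h at level ns vanishes when s ≥ 1/(m + 1); lower levels are
  -- covered by the integral of h.
  obtain ⟨n, hn⟩ := ENNReal.exists_nat_gt
    (ENNReal.mul_ne_top hM (ENNReal.add_ne_top.2 ⟨ENNReal.natCast_ne_top m, ENNReal.one_ne_top⟩))
  have hn0 : n ≠ 0 := by
    rintro rfl
    simp at hn
  refine ⟨n, hn0, ?_⟩
  have hnr : (0 : ℝ) < n := Nat.cast_pos.2 (Nat.pos_of_ne_zero hn0)
  calc E.extNorm (spread n h) ≤ E.extNorm (fun t => η * ‖u t‖ₑ) := by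
        refine extNorm_le_of_excess_le hE (measurable_spread hh n).aemeasurable fun s _ _ => ?_
        rw [excess_spread hh hnr, ENNReal.ofReal_natCast]
        rcases le_total s ((m : ℝ≥0∞) + 1)⁻¹ with hs | hs
        · calc excess h (n * s) ≤ excess h 0 := excess_antitone h zero_le
            _ = ∫⁻ t, h t ∂semiAxis := excess_zero_right h
            _ ≤ _ := hm.le
            _ ≤ _ := excess_antitone _ hs
        · have hMs : M ≤ n * s := by
            have hm1 : (m : ℝ≥0∞) + 1 ≠ ∞ := by simp
            calc M = M * (m + 1) * ((m : ℝ≥0∞) + 1)⁻¹ := by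
                  rw [mul_assoc, ENNReal.mul_inv_cancel (by simp) hm1, mul_one]
              _ ≤ n * s := by gcongr
          have h0 : excess h (n * s) = 0 := by
            simp only [excess, tsub_eq_zero_of_le ((hb _).trans hMs), lintegral_zero]
          rw [h0]
          exact zero_le
    _ = η * E.extNorm (fun t => ‖u t‖ₑ) := extNorm_const_mul hη0 hηt _
    _ = ε := ENNReal.div_mul_cancel hu0 huE

/-- A smaller norm would give Φ_e(d) ≤ d, and over an interval of length at most 1 the integral is
at most d more than the excess. -/
theorem mul_extNorm_unitIndicator_le (hE : E.IsFullySymmetric) {e : ℝ → ℝ≥0∞} {d : ℝ≥0∞}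
    (hd0 : d ≠ 0) (hd : d ≠ ∞) {τ : ℝ} (hτ : τ ≤ 1) (h : 2 * d < ∫⁻ t in Ioc 0 τ, e t) :
    d * E.extNorm unitIndicator ≤ E.extNorm e := by
  by_contra! hcon
  refine absurd h (not_lt.2 ?_)
  calc ∫⁻ t in Ioc 0 τ, e t ≤ excess e d + d * volume (Ioc 0 τ) :=
        setLIntegral_le_excess (fun t ht => ht.1) e d
    _ ≤ d + d * 1 := by
      gcongr
      · exact excess_le_of_extNorm_lt hE hd0 hd hcon
      · simpa using hτ
    _ = 2 * d := by ring

/-- Let f cross the level s at t'. If t' < q, the piece on (q, p] has no excess. Otherwise t' lies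
in [q, p], where primitives compare, and enlarging the interval of integration to (0, t'] only
increases the left side. -/
theorem extNorm_indicator_Ioc_le (hE : E.IsFullySymmetric) {e f : ℝ → ℝ≥0∞} (hf : Antitone f)
    {K : ℝ≥0∞} (hK0 : K ≠ 0) (hK : K ≠ ∞) {q p : ℝ} (hq : 0 ≤ q)
    (h : ∀ t ∈ Icc q p, ∫⁻ u in Ioc 0 t, f u ≤ K * ∫⁻ u in Ioc 0 t, e u) :
    E.extNorm ((Ioc q p).indicator f) ≤ K * E.extNorm e := by
  rw [← extNorm_const_mul hK0 hK]
  refine extNorm_le_of_excess_le hE (hf.measurable.indicator measurableSet_Ioc).aemeasurable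
    fun s _ hs => ?_
  rw [excess_indicator measurableSet_Ioc (fun t ht => hq.trans_lt ht.1)]
  rcases lt_or_ge p q with hpq | hpq
  · rw [Ioc_eq_empty (not_lt.2 hpq.le)]; simp
  obtain ⟨t', ⟨h0, ht'⟩, h1, h2⟩ := exists_crossing hf s (hq.trans hpq)
  rcases lt_or_ge t' q with htq | htq
  · rw [setLIntegral_congr_fun (g := fun _ => 0) measurableSet_Ioc fun t ht =>
      tsub_eq_zero_of_le (h2 t (htq.trans ht.1) ht.2)]
    simp
  have e1 : ∫⁻ t in Ioc q p, (f t - s) ≤ ∫⁻ t in Ioo 0 t', (f t - s) := by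
    rw [setLIntegral_Ioo_eq_Ioc, ← Ioc_union_Ioc_eq_Ioc htq ht', lintegral_union measurableSet_Ioc
      (Set.disjoint_left.2 fun u hu hu' => absurd hu.2 (not_le.2 hu'.1)),
      setLIntegral_congr_fun (g := fun _ => 0) (s := Ioc t' p) measurableSet_Ioc fun t ht =>
      tsub_eq_zero_of_le (h2 t ht.1 ht.2), lintegral_zero, add_zero]
    exact lintegral_mono_set (Ioc_subset_Ioc_left hq)
  refine e1.trans ?_
  have hsv : s * volume (Ioo 0 t') ≠ ∞ := ENNReal.mul_ne_top hs (by simp)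
  refine (ENNReal.add_le_add_iff_right hsv).1 ?_
  rw [setLIntegral_tsub_add measurableSet_Ioo fun t ht => h1 t ht.1 ht.2, setLIntegral_Ioo_eq_Ioc]
  calc ∫⁻ u in Ioc 0 t', f u ≤ K * ∫⁻ u in Ioc 0 t', e u := h t' ⟨htq, ht'⟩
    _ = ∫⁻ u in Ioc 0 t', K * e u := (lintegral_const_mul' _ _ hK).symm
    _ = ∫⁻ u in Ioo 0 t', K * e u := (setLIntegral_Ioo_eq_Ioc _ _ _).symm
    _ ≤ _ := setLIntegral_le_excess (fun t ht => ht.1) _ s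

end BanachIdealLattice

/-! ### Block averages -/

/-- The function equal to the average of `f` over `B k` on each `B k`, and to `f` elsewhere. -/
noncomputable def blockAverage (B : ℕ → Set ℝ) (f : ℝ → ℝ≥0∞) (t : ℝ) : ℝ≥0∞ :=
  (⋃ k, B k)ᶜ.indicator f t
    + ∑' k, (B k).indicator (fun _ => (volume (B k))⁻¹ * ∫⁻ u in B k, f u) t

section BlockAverage

variable {B : ℕ → Set ℝ} {f : ℝ → ℝ≥0∞}

theorem blockAverage_of_mem (hd : Pairwise fun i j => Disjoint (B i) (B j)) {k : ℕ} {t : ℝ}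
    (ht : t ∈ B k) : blockAverage B f t = (volume (B k))⁻¹ * ∫⁻ u in B k, f u := by
  rw [blockAverage, tsum_indicator_apply hd (fun k _ => (volume (B k))⁻¹ * ∫⁻ u in B k, f u) ht,
    indicator_of_notMem (notMem_compl_iff.2 (mem_iUnion.2 ⟨k, ht⟩)), zero_add]

theorem blockAverage_of_notMem {t : ℝ} (ht : ∀ k, t ∉ B k) : blockAverage B f t = f t := by
  rw [blockAverage, tsum_indicator_eq_zero _ ht, indicator_of_mem (by simpa using ht), add_zero]

theorem measurable_blockAverage (hB : ∀ k, MeasurableSet (B k)) (hf : Measurable f) :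
    Measurable (blockAverage B f) :=
  (hf.indicator (MeasurableSet.iUnion hB).compl).add
    (measurable_tsum_indicator hB fun _ => measurable_const)

theorem eq_indicator_add_tsum (hd : Pairwise fun i j => Disjoint (B i) (B j)) (t : ℝ) :
    f t = (⋃ k, B k)ᶜ.indicator f t + ∑' k, (B k).indicator f t := by
  by_cases h : ∃ k, t ∈ B k
  · obtain ⟨k, hk⟩ := h
    rw [tsum_indicator_apply hd (fun _ => f) hk,
      indicator_of_notMem (notMem_compl_iff.2 (mem_iUnion.2 ⟨k, hk⟩)), zero_add]
  · push Not at h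
    rw [tsum_indicator_eq_zero _ h, indicator_of_mem (by simpa using h), add_zero]

theorem indicator_eq_zero_or_tsum_eq_zero (u : ℕ → ℝ → ℝ≥0∞) (t : ℝ) :
    (⋃ k, B k)ᶜ.indicator f t = 0 ∨ ∑' k, (B k).indicator (u k) t = 0 := by
  by_cases h : ∃ k, t ∈ B k
  · obtain ⟨k, hk⟩ := h
    exact Or.inl (indicator_of_notMem (notMem_compl_iff.2 (mem_iUnion.2 ⟨k, hk⟩)) _)
  · push Not at h
    exact Or.inr (tsum_indicator_eq_zero _ h)

theorem excess_blockAverage_le (hB : ∀ k, MeasurableSet (B k)) (hB0 : ∀ k, B k ⊆ Ioi 0)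
    (hd : Pairwise fun i j => Disjoint (B i) (B j)) (hf : Measurable f)
    (hv0 : ∀ k, volume (B k) ≠ 0) (hv : ∀ k, volume (B k) ≠ ∞) (s : ℝ≥0∞) :
    excess (blockAverage B f) s ≤ excess f s := by
  have hUm : Measurable ((⋃ k, B k)ᶜ.indicator f) :=
    hf.indicator (MeasurableSet.iUnion hB).compl
  have h1 : excess f s = excess ((⋃ k, B k)ᶜ.indicator f) s + ∑' k, ∫⁻ t in B k, (f t - s) := by
    rw [← excess_tsum_indicator hB hB0 hd (fun _ => hf), ← excess_add_of_disjoint hUm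
      (indicator_eq_zero_or_tsum_eq_zero fun _ => f)]
    congr 1
    exact funext (eq_indicator_add_tsum hd)
  have h2 : excess (blockAverage B f) s = excess ((⋃ k, B k)ᶜ.indicator f) s
      + ∑' k, ∫⁻ _ in B k, ((volume (B k))⁻¹ * (∫⁻ u in B k, f u) - s) := by
    rw [← excess_tsum_indicator hB hB0 hd
      (u := fun k _ => (volume (B k))⁻¹ * ∫⁻ u in B k, f u) (fun _ => measurable_const),
      ← excess_add_of_disjoint hUm (indicator_eq_zero_or_tsum_eq_zero _)]
    rfl
  rw [h1, h2]
  refine add_le_add le_rfl (ENNReal.tsum_le_tsum fun k => ?_)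
  rw [setLIntegral_const, mul_comm]
  refine measure_mul_average_tsub_le f ?_ (hv k) s
  rw [← mul_assoc, ENNReal.mul_inv_cancel (hv0 k) (hv k), one_mul]

/-- Applied to initial intervals whose endpoint cuts no block, where averaging does not change the
primitive. -/
theorem setLIntegral_blockAverage (hB : ∀ k, MeasurableSet (B k))
    (hd : Pairwise fun i j => Disjoint (B i) (B j)) (hf : Measurable f)
    (hv0 : ∀ k, volume (B k) ≠ 0) (hv : ∀ k, volume (B k) ≠ ∞) {A : Set ℝ}
    (h : ∀ k, B k ⊆ A ∨ Disjoint (B k) A) : ∫⁻ t in A, blockAverage B f t = ∫⁻ t in A, f t := by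
  have hUm : Measurable ((⋃ k, B k)ᶜ.indicator f) :=
    hf.indicator (MeasurableSet.iUnion hB).compl
  have h1 : ∫⁻ t in A, f t = (∫⁻ t in A, (⋃ k, B k)ᶜ.indicator f t)
      + ∑' k, ∫⁻ t in A, (B k).indicator f t := by
    rw [← lintegral_tsum fun k => (hf.indicator (hB k)).aemeasurable, ← lintegral_add_left hUm]
    exact lintegral_congr fun t => eq_indicator_add_tsum hd t
  unfold blockAverage
  rw [h1, lintegral_add_left hUm,
    lintegral_tsum fun k => (measurable_const.indicator (hB k)).aemeasurable]
  congr 1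
  refine tsum_congr fun k => ?_
  rw [lintegral_indicator (hB k), lintegral_indicator (hB k), Measure.restrict_restrict (hB k)]
  rcases h k with h | h
  · rw [inter_eq_left.2 h, setLIntegral_const, mul_comm, ← mul_assoc,
      ENNReal.mul_inv_cancel (hv0 k) (hv k), one_mul]
  · rw [h.inter_eq]
    simp

end BlockAverage

/-! ### Finite convex combinations close to an averaged element of the orbit. -/

namespace BanachIdealLattice

variable {E : BanachIdealLattice}

/-- Carathéodory's form of the convex hull supplies strictly positive weights; being finitely many,
they are bounded below by 1/k for large k, which the necessity argument needs. -/
theorem exists_convex_combination {x y : L0} (hy : y ∈ E.QPlus x) {η : ℝ≥0∞} (hη : η ≠ 0) :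
    ∃ (ι : Type) (_ : Fintype ι) (l : ι → ℝ≥0∞) (z : ι → L0) (e : ℝ → ℝ≥0∞),
      (∀ i, z i ∈ (OmegaPlus x).extremePoints ℝ) ∧ (∀ i, l i ≠ 0) ∧ ∑ i, l i = 1 ∧
      E.extNorm e < η ∧ ∀ᵐ t ∂semiAxis, ‖y t‖ₑ ≤ ∑ i, l i * ‖z i t‖ₑ + e t ∧
        ∑ i, l i * ‖z i t‖ₑ ≤ ‖y t‖ₑ + e t := by
  have hyE := hy.1
  obtain ⟨r, hr0, hr⟩ : ∃ r : ℝ, 0 < r ∧ ENNReal.ofReal r ≤ η := by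
    refine ⟨(min η 1).toReal, ENNReal.toReal_pos (by simp [hη]) (by simp), ?_⟩
    rw [ENNReal.ofReal_toReal (by simp)]
    exact min_le_left _ _
  obtain ⟨w, hw, hwE, hyw⟩ := hy.2 r hr0
  obtain ⟨ι, hι, z, l, hz, -, hl, hl1, hzw⟩ := eq_pos_convex_span_of_mem_convexHull hw
  refine ⟨ι, hι, fun i => ENNReal.ofReal (l i), z, fun t => ‖y t - w t‖ₑ,
    fun i => hz (mem_range_self i), fun i => by simpa using hl i, ?_, ?_, ?_⟩
  · rw [← ENNReal.ofReal_sum_of_nonneg fun i _ => (hl i).le, hl1, ENNReal.ofReal_one]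
  · rw [extNorm_sub_eq hyE hwE]
    exact ((ENNReal.ofReal_lt_ofReal_iff hr0).2 hyw).trans_le hr
  · have hz0 : ∀ᵐ t ∂semiAxis, ∀ i, 0 ≤ z i t :=
      ae_all_iff.2 fun i => nonneg_iff_ae.1 (hz (mem_range_self i)).1.1
    have hsm : ∀ᵐ t ∂semiAxis, ∀ i, (l i • z i : L0) t = l i * z i t :=
      ae_all_iff.2 fun i => AEEqFun.coeFn_smul (l i) (z i)
    filter_upwards [hz0, hsm, AEEqFun.coeFn_finsetSum Finset.univ fun i => l i • z i]
      with t h0 h1 h2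
    have h3 : w t = ∑ i, l i * z i t := by
      rw [← hzw, h2, Finset.sum_apply]
      exact Finset.sum_congr rfl fun i _ => h1 i
    have h4 : ∑ i, ENNReal.ofReal (l i) * ‖z i t‖ₑ = ‖w t‖ₑ := by
      rw [h3, Real.enorm_of_nonneg (Finset.sum_nonneg fun i _ => mul_nonneg (hl i).le (h0 i)),
        ENNReal.ofReal_sum_of_nonneg fun i _ => mul_nonneg (hl i).le (h0 i)]
      refine Finset.sum_congr rfl fun i _ => ?_
      rw [ENNReal.ofReal_mul (hl i).le, Real.enorm_of_nonneg (h0 i)]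
    rw [h4]
    constructor
    · calc ‖y t‖ₑ = ‖w t + (y t - w t)‖ₑ := by rw [add_sub_cancel]
        _ ≤ _ := enorm_add_le _ _
    · calc ‖w t‖ₑ = ‖y t + -(y t - w t)‖ₑ := by congr 1; ring
        _ ≤ ‖y t‖ₑ + ‖-(y t - w t)‖ₑ := enorm_add_le _ _
        _ = _ := by rw [enorm_neg]

end BanachIdealLattice

theorem exists_nat_forall_inv_le {ι : Type*} [Fintype ι] {l : ι → ℝ≥0∞} (hl : ∀ i, l i ≠ 0) :
    ∃ n : ℕ, ∀ k, n ≤ k → ∀ i, (k : ℝ≥0∞)⁻¹ ≤ l i := by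
  obtain ⟨n, hn⟩ := ENNReal.exists_nat_gt (r := ∑ i, (l i)⁻¹)
    (ENNReal.sum_ne_top.2 fun i _ => ENNReal.inv_ne_top.2 (hl i))
  refine ⟨n, fun k hk i => ENNReal.inv_le_iff_inv_le.1 ?_⟩
  calc (l i)⁻¹ ≤ ∑ i, (l i)⁻¹ :=
        Finset.single_le_sum (f := fun i => (l i)⁻¹) (fun _ _ => zero_le) (Finset.mem_univ i)
    _ ≤ n := hn.le
    _ ≤ k := by exact_mod_cast hk

theorem inv_measure_mul_setLIntegral_le {B : Set ℝ} {f : ℝ → ℝ≥0∞} {M : ℝ≥0∞}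
    (hB : MeasurableSet B) (h0 : volume B ≠ 0) (ht : volume B ≠ ∞) (h : ∀ t ∈ B, f t ≤ M) :
    (volume B)⁻¹ * ∫⁻ t in B, f t ≤ M := by
  calc (volume B)⁻¹ * ∫⁻ t in B, f t ≤ (volume B)⁻¹ * ∫⁻ _ in B, M := by
        gcongr 1
        exact setLIntegral_mono' hB h
    _ = ((volume B)⁻¹ * volume B) * M := by rw [setLIntegral_const, mul_comm M, mul_assoc]
    _ = M := by rw [ENNReal.inv_mul_cancel h0 ht, one_mul]

theorem le_inv_mul_setLIntegral {f : ℝ → ℝ≥0∞} {M a : ℝ≥0∞} {B : Set ℝ}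
    (hB : MeasurableSet B) (ha0 : a ≠ 0) (hat : a ≠ ∞) (ha : a ≤ volume B)
    (h : ∀ t ∈ B, M ≤ f t) : M ≤ a⁻¹ * ∫⁻ t in B, f t := by
  calc M = a⁻¹ * a * M := by rw [ENNReal.inv_mul_cancel ha0 hat, one_mul]
    _ ≤ a⁻¹ * volume B * M := by gcongr
    _ = a⁻¹ * ∫⁻ _ in B, M := by rw [setLIntegral_const, mul_comm M, mul_assoc]
    _ ≤ _ := by
        gcongr 1
        exact setLIntegral_mono' hB h

theorem exists_mem_omegaPlus_blockAverage {x : L0} (hx : x ∈ L1AddLInfty) {B : ℕ → Set ℝ}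
    (hB : ∀ k, MeasurableSet (B k)) (hB0 : ∀ k, B k ⊆ Ioi 0)
    (hd : Pairwise fun i j => Disjoint (B i) (B j))
    (hv0 : ∀ k, volume (B k) ≠ 0) (hv : ∀ k, volume (B k) ≠ ∞) :
    ∃ y ∈ OmegaPlus x, ∀ᵐ t ∂semiAxis, ‖y t‖ₑ = blockAverage B (rearrangement x) t := by
  have hm := measurable_rearrangement x
  have hbm := (measurable_blockAverage hB hm).aemeasurable (μ := semiAxis)
  have hex : ∀ s, excess (blockAverage B (rearrangement x)) s ≤ excess (fun t => ‖x t‖ₑ) s :=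
    fun s => by
      rw [← excess_rearrangement]
      exact excess_blockAverage_le hB hB0 hd hm hv0 hv s
  obtain ⟨s0, hs0, hs0'⟩ := exists_excess_ne_top hx
  have he := enorm_classOf hbm (ae_ne_top_of_excess hbm hs0 (ne_top_of_le_ne_top hs0' (hex s0)))
  refine ⟨classOf _ hbm, (mem_omegaPlus_iff hx).2 ⟨classOf_nonneg _, fun s => ?_⟩, he⟩
  rw [excess_congr_ae he]
  exact hex s

/-- Integration of a convex combination, split according to whether the mass is carried by
functions whose integral is controlled. -/
theorem setLIntegral_le_of_convex_combination {ι : Type*} [Fintype ι] [DecidableEq ι]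
    (I : Finset ι) {l : ι → ℝ≥0∞} {Z : ι → ℝ → ℝ≥0∞} (hZ : ∀ i, Measurable (Z i))
    {Y e : ℝ → ℝ≥0∞} {A : Set ℝ} (hA0 : A ⊆ Ioi 0)
    (hY : ∀ᵐ t ∂semiAxis, Y t ≤ ∑ i, l i * Z i t + e t) {K M : ℝ≥0∞}
    (hK : ∀ i ∈ I, ∫⁻ t in A, Z i t ≤ K) (hI : ∑ i ∈ I, l i ≤ 2⁻¹)
    (hM : ∑ i ∈ Iᶜ, l i * ∫⁻ t in A, Z i t ≤ M) :
    ∫⁻ t in A, Y t ≤ 2⁻¹ * K + M + ∫⁻ t in A, e t := by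
  have hWm : Measurable fun t => ∑ i, l i * Z i t :=
    Finset.measurable_fun_sum _ fun i _ => (hZ i).const_mul _
  calc ∫⁻ t in A, Y t ≤ ∫⁻ t in A, (∑ i, l i * Z i t + e t) :=
        lintegral_mono_ae (ae_restrict_of_ae_restrict_of_subset hA0 hY)
    _ = (∑ i, l i * ∫⁻ t in A, Z i t) + ∫⁻ t in A, e t := by
        rw [lintegral_add_left hWm, lintegral_finsetSum _ fun i _ => (hZ i).const_mul _]
        congr 1
        exact Finset.sum_congr rfl fun i _ => lintegral_const_mul _ (hZ i)
    _ = (∑ i ∈ I, l i * ∫⁻ t in A, Z i t) + (∑ i ∈ Iᶜ, l i * ∫⁻ t in A, Z i t)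
          + ∫⁻ t in A, e t := by rw [Finset.sum_add_sum_compl]
    _ ≤ _ := by
        refine add_le_add (add_le_add ?_ hM) le_rfl
        calc ∑ i ∈ I, l i * ∫⁻ t in A, Z i t ≤ ∑ i ∈ I, l i * K :=
              Finset.sum_le_sum fun i hi => mul_le_mul' le_rfl (hK i hi)
          _ = (∑ i ∈ I, l i) * K := (Finset.sum_mul _ _ _).symm
          _ ≤ _ := by gcongr

/-- Half of X is absorbed on the left and at most a quarter is used up by M, so J accounts for a
quarter; cancellation needs X finite. -/
theorem le_four_mul_of_le {X J : ℝ≥0∞} (hX : X ≠ ∞) {M : ℝ≥0∞} (hM : 4 * M ≤ X)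
    (h : X ≤ 2⁻¹ * X + M + J) : X ≤ 4 * J := by
  have h3 : 3 * X ≠ ∞ := ENNReal.mul_ne_top (by simp) hX
  refine (ENNReal.add_le_add_iff_left h3).1 ?_
  calc 3 * X + X = 4 * X := by ring
    _ ≤ 4 * (2⁻¹ * X + M + J) := by gcongr
    _ = 2 * (2 * 2⁻¹) * X + 4 * M + 4 * J := by ring
    _ ≤ 2 * (2 * 2⁻¹) * X + X + 4 * J := by gcongr
    _ = 3 * X + 4 * J := by rw [ENNReal.mul_inv_cancel (by simp) (by simp)]; ring

/-! ### Necessity when large values carry the failure. -/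

namespace BanachIdealLattice

variable {E : BanachIdealLattice}

/-- If large values of `x` are responsible for the failure of the dilation condition, the orbit is
not the closed convex hull of its extreme points. -/
theorem not_omegaPlus_subset_qPlus_of_peaks (hE : E.IsFullySymmetric) (hF : E.IsFatouNorm)
    {x : L0} (hx : x ∈ E.carrier) {δ : ℝ≥0∞} (hδ0 : δ ≠ 0)
    (hδ : ∀ σ : ℝ≥0∞, σ ≠ ∞ → ∀ n : ℕ, n ≠ 0 →
      δ ≤ E.extNorm (spread n fun t => rearrangement x t - σ)) :
    ¬ OmegaPlus x ⊆ E.QPlus x := by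
  intro hQ
  classical
  have hx1 := mem_L1AddLInfty hE hx
  obtain ⟨s0, hs0, hs0'⟩ := exists_excess_ne_top hx1
  have hcfin := asymptote_ne_top hs0 hs0'
  set c := asymptote fun t => ‖x t‖ₑ with hc
  set f := rearrangement x with hf
  have hfa : Antitone f := rearrangement_antitone x
  have hfm : Measurable f := measurable_rearrangement x
  have hfE : E.extNorm f ≠ ∞ := extNorm_rearrangement_ne_top hE hx
  have hfs0 : excess f s0 ≠ ∞ := by rwa [hf, excess_rearrangement]
  have hdm : ∀ σ, Measurable fun t => f t - σ := fun σ => hfm.sub_const σ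
  have hdE : ∀ σ, E.extNorm (fun t => f t - σ) ≠ ∞ := fun σ =>
    ne_top_of_le_ne_top hfE (extNorm_mono fun t => tsub_le_self)
  have hδt : δ ≠ ∞ := ne_top_of_le_ne_top (hdE 0) ((hδ 0 (by simp) 1 one_ne_zero).trans
    (extNorm_spread_le hE (hdm 0) (by simp)))
  set X : ℝ → ℝ≥0∞ := fun q => ∫⁻ t in Ioc 0 q, f t with hX
  have hXt : ∀ q, X q ≠ ∞ := fun q => setLIntegral_ne_top hs0 hfs0 (fun t ht => ht.1) (by simp)
  -- Extreme points bounded by c must integrate to little over (0, τ]. Such τ exists because x*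
  -- exceeds 4c + 1 somewhere; otherwise its part above that level would vanish, against the lower
  -- bound δ.
  obtain ⟨τ, hτ0, hτ1, hτX0, hτX⟩ : ∃ τ : ℝ, 0 < τ ∧ τ ≤ 1 ∧ X τ ≠ 0 ∧
      4 * (c * ENNReal.ofReal τ) ≤ X τ := by
    have hσ : 4 * c + 1 ≠ ∞ :=
      ENNReal.add_ne_top.2 ⟨ENNReal.mul_ne_top (by simp) hcfin, ENNReal.one_ne_top⟩
    obtain ⟨t, ht0, ht⟩ : ∃ t, 0 < t ∧ 4 * c + 1 < f t := by
      by_contra! hcon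
      have h1 := (hδ _ hσ 1 one_ne_zero).trans (extNorm_spread_le hE (hdm _) (by simp))
      have h2 : E.extNorm (fun t => f t - (4 * c + 1)) ≤ E.extNorm fun _ => 0 := by
        refine extNorm_mono_ae ?_
        filter_upwards [ae_restrict_mem measurableSet_Ioi] with t ht
        exact (tsub_eq_zero_of_le (hcon t ht)).le
      rw [extNorm_zero] at h2
      exact hδ0 (le_antisymm (h1.trans h2) zero_le)
    have hm0 : 0 < min t 1 := lt_min ht0 one_pos
    have h3 : (4 * c + 1) * ENNReal.ofReal (min t 1) ≤ X (min t 1) := by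
      have : ENNReal.ofReal (min t 1) = volume (Ioc 0 (min t 1)) := by simp
      rw [this, ← setLIntegral_const]
      exact setLIntegral_mono' measurableSet_Ioc fun u hu =>
        ht.le.trans (hfa (hu.2.trans (min_le_left _ _)))
    refine ⟨min t 1, hm0, min_le_right _ _, ?_, ?_⟩
    · intro h0
      rw [h0, nonpos_iff_eq_zero, mul_eq_zero] at h3
      rcases h3 with h3 | h3
      · simp at h3
      · simp only [ENNReal.ofReal_eq_zero] at h3
        linarith
    · refine le_trans ?_ h3
      rw [add_mul, mul_assoc]
      exact le_self_add
  have hstep : ∀ (k : ℕ) (q : ℝ), ∃ (σ : ℝ≥0∞) (p : ℝ), 0 < q → (s0 ≤ σ ∧ (k : ℝ≥0∞) ≤ σ ∧ 0 < p ∧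
      p ≤ q / 2 ∧ 2 * ((k + 1 : ℕ) : ℝ≥0∞) * ((ENNReal.ofReal (q / 2))⁻¹ * X q) ≤ σ ∧
      δ / 2 ≤ E.extNorm (spread (k + 1 : ℕ) ((Ioi p).indicator fun t => f t - σ))) := by
    intro k q
    by_cases hq : 0 < q
    swap
    · exact ⟨0, 0, fun h => absurd h hq⟩
    -- The term s0 makes the excess finite, k sends the levels to infinity, and the last term beats
    -- the block average by 2(k + 1). Dividing by q/2 bounds that average whichever next endpoint p
    -- ≤ q/2 is chosen; p is fixed only afterwards.
    set σ : ℝ≥0∞ := s0 + k + 2 * ((k + 1 : ℕ) : ℝ≥0∞) * ((ENNReal.ofReal (q / 2))⁻¹ * X q) with hσ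
    have hσt : σ ≠ ∞ := by
      refine ENNReal.add_ne_top.2 ⟨ENNReal.add_ne_top.2 ⟨hs0, by simp⟩, ENNReal.mul_ne_top
        (ENNReal.mul_ne_top (by simp) (by simp)) (ENNReal.mul_ne_top ?_ (hXt q))⟩
      exact ENNReal.inv_ne_top.2 (by simpa using hq)
    have hpos : ∀ m : ℕ, (0 : ℝ) < q / 2 / (m + 1) := fun m => by positivity
    have hlim : ∀ t, 0 < t → Tendsto (fun m : ℕ => (Ioi (q / 2 / ((m : ℝ) + 1))).indicator
        (fun t => f t - σ) t) atTop (𝓝 (f t - σ)) := by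
      intro t ht
      have h1 : Tendsto (fun m : ℕ => q / 2 / ((m : ℝ) + 1)) atTop (𝓝 0) :=
        tendsto_const_div_atTop_nhds_zero_nat (q / 2) |>.comp (tendsto_add_atTop_nat 1)
          |>.congr fun m => by simp
      refine tendsto_const_nhds.congr' ?_
      filter_upwards [h1.eventually (gt_mem_nhds ht)] with m hm
      rw [indicator_of_mem (show t ∈ Ioi (q / 2 / ((m : ℝ) + 1)) from hm)]
    -- The Fatou property keeps half of δ after a neighbourhood of 0 is cut off.
    obtain ⟨m, hm⟩ := exists_lt_extNorm_spread hE hF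
      (e := fun m : ℕ => (Ioi (q / 2 / (m + 1))).indicator fun t => f t - σ)
      (e' := fun t => f t - σ) (fun m => (hdm σ).indicator measurableSet_Ioi) (hdm σ)
      (fun i j hij t => indicator_le_indicator_of_subset (Ioi_subset_Ioi (by gcongr))
        (fun _ => zero_le) t) hlim (hdE σ) (Nat.succ_ne_zero k)
      ((ENNReal.half_lt_self hδ0 hδt).trans_le (hδ σ hσt _ (Nat.succ_ne_zero k)))
    refine ⟨σ, q / 2 / (m + 1), fun _ => ⟨?_, ?_, hpos m, ?_, le_add_self, hm.le⟩⟩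
    · exact le_self_add.trans le_self_add
    · exact le_add_self.trans le_self_add
    · exact div_le_self (by positivity) (by linarith [(Nat.cast_nonneg m : (0 : ℝ) ≤ m)])
  choose σ P hstep using hstep
  set q : ℕ → ℝ := fun k => Nat.rec τ (fun k q => P k q) k with hq
  have hq0' : q 0 = τ := rfl
  have hqs : ∀ k, q (k + 1) = P k (q k) := fun k => rfl
  have hq0 : ∀ k, 0 < q k := by
    intro k
    induction k with
    | zero => exact hτ0
    | succ k ih => exact (hstep k (q k) ih).2.2.1
  have hS := fun k => hstep k (q k) (hq0 k)
  simp only [← hqs] at hS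
  have hhalf : ∀ k, q (k + 1) ≤ q k / 2 := fun k => (hS k).2.2.2.1
  have hqlt : ∀ k, q (k + 1) < q k := fun k => (hhalf k).trans_lt (half_lt_self (hq0 k))
  have hqa : Antitone q := antitone_nat_of_succ_le fun k => (hqlt k).le
  set B : ℕ → Set ℝ := fun k => Ioc (q (k + 1)) (q k) with hB
  have hBm : ∀ k, MeasurableSet (B k) := fun k => measurableSet_Ioc
  have hB0 : ∀ k, B k ⊆ Ioi 0 := fun k t ht => (hq0 (k + 1)).trans ht.1
  have hBd : Pairwise fun i j => Disjoint (B i) (B j) := hqa.pairwise_disjoint_on_Ioc_succ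
  have hBv0 : ∀ k, volume (B k) ≠ 0 := fun k => by
    simpa [hB] using hqlt k
  have hBv : ∀ k, volume (B k) ≠ ∞ := fun k => by simp [hB]
  obtain ⟨y, hy, hyB⟩ := exists_mem_omegaPlus_blockAverage hx1 hBm hB0 hBd hBv0 hBv
  rw [← hf] at hyB
  set v : ℕ → ℝ≥0∞ := fun k => (ENNReal.ofReal (q k / 2))⁻¹ * X (q k) with hv
  have hh0 : ∀ k, ENNReal.ofReal (q k / 2) ≠ 0 := fun k => by simpa using hq0 k
  have hfv : ∀ k, f (q k) ≤ v k := fun k =>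
    le_inv_mul_setLIntegral measurableSet_Ioc (hh0 k) ENNReal.ofReal_ne_top
      (by rw [Real.volume_Ioc]; exact ENNReal.ofReal_le_ofReal (by linarith [hq0 k]))
      fun t ht => hfa ht.2
  have hbound : ∀ k t, q (k + 1) < t → blockAverage B f t ≤ v k := by
    intro k t ht
    by_cases h : ∃ j, t ∈ B j
    · obtain ⟨j, hj⟩ := h
      rw [blockAverage_of_mem hBd hj]
      rcases lt_trichotomy j k with hjk | hjk | hjk
      · refine (inv_measure_mul_setLIntegral_le (hBm j) (hBv0 j) (hBv j) fun u hu => ?_).trans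
          (hfv k)
        exact hfa ((hqa hjk).trans hu.1.le)
      · subst hjk
        refine mul_le_mul' (ENNReal.inv_le_inv.2 ?_) (lintegral_mono_set fun u hu =>
          ⟨(hq0 (j + 1)).trans hu.1, hu.2⟩)
        simp only [hB, Real.volume_Ioc]
        exact ENNReal.ofReal_le_ofReal (by linarith [hhalf j])
      · exact absurd (hj.2.trans (hqa hjk)) (not_le.2 ht)
    · push Not at h
      rw [blockAverage_of_notMem h]
      have : q k < t := by
        by_contra hcon
        exact h k ⟨ht, not_lt.1 hcon⟩
      exact (hfa this.le).trans (hfv k)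
  have hXint : ∫⁻ t in Ioc 0 τ, blockAverage B f t = X τ :=
    setLIntegral_blockAverage hBm hBd hfm hBv0 hBv fun k => Or.inl fun t ht =>
      ⟨(hq0 (k + 1)).trans ht.1, ht.2.trans (hqa (Nat.zero_le k))⟩
  -- The integral of the error over (0, τ] will turn out to be at least X(τ)/4 = 4d, whereas a small
  -- norm allows only 2d.
  set d := X τ / 16 with hd
  have hXd : X τ = 16 * d := (ENNReal.mul_div_cancel (by simp) (by simp)).symm
  have hd0 : d ≠ 0 := fun h => hτX0 (by rw [hXd, h, mul_zero])
  have hdt : d ≠ ∞ := ENNReal.div_ne_top (hXt τ) (by simp)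
  have hunit : d * E.extNorm unitIndicator ≠ 0 := mul_ne_zero hd0 extNorm_unitIndicator_ne_zero
  have hδ8 : δ / 2 / 4 ≠ 0 := by simp [hδ0]
  obtain ⟨ι, hι, l, z, e, hz, hl0, hl1, heη, hae⟩ := exists_convex_combination (hQ hy)
    (η := min (δ / 2 / 4) (d * E.extNorm unitIndicator)) (by
      rcases min_choice (δ / 2 / 4) (d * E.extNorm unitIndicator) with h | h <;> rwa [h])
  have hlt : ∀ i, l i ≠ ∞ := fun i => ne_top_of_le_ne_top ENNReal.one_ne_top
    (hl1 ▸ Finset.single_le_sum (f := l) (fun _ _ => zero_le) (Finset.mem_univ i))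
  set Z : ι → ℝ → ℝ≥0∞ := fun i t => ‖z i t‖ₑ with hZ
  have hZm : ∀ i, Measurable (Z i) := fun i => measurable_enorm_L0 (z i)
  have hZle : ∀ i s, excess (Z i) s ≤ excess f s := fun i s => by
    rw [hf, excess_rearrangement]
    exact ((mem_omegaPlus_iff hx1).1 (hz i).1).2 s
  set I : Finset ι := Finset.univ.filter fun i => ∃ r : ℝ≥0∞, r ≠ ∞ ∧ ∀ s, r ≤ s →
      excess (Z i) s = excess f s with hI
  by_cases hI2 : 2⁻¹ ≤ ∑ i ∈ I, l i
  · have hr : ∀ i, ∃ r : ℝ≥0∞, i ∈ I → r ≠ ∞ ∧ ∀ s, r ≤ s → excess (Z i) s = excess f s := by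
      intro i
      by_cases hi : i ∈ I
      · obtain ⟨r, hr⟩ := (Finset.mem_filter.1 hi).2
        exact ⟨r, fun _ => hr⟩
      · exact ⟨0, fun h => absurd h hi⟩
    choose r hr using hr
    obtain ⟨m, hm⟩ := ENNReal.exists_nat_gt (r := ∑ i ∈ I, r i)
      (ENNReal.sum_ne_top.2 fun i hi => (hr i hi).1)
    obtain ⟨n, hn⟩ := exists_nat_forall_inv_le hl0
    -- The block is so late that its level σ_k passes every threshold r i with i in I, and 1/(k + 1)
    -- is below every weight.
    set k := max m n with hk
    have hmk : (m : ℝ≥0∞) ≤ k := by exact_mod_cast le_max_left m n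
    have hkey := extNorm_spread_le_four_mul hE hfa (hq0 (k + 1)).le (σ := σ k (q k)) (v := v k)
      (ne_top_of_le_ne_top hfs0 (excess_antitone f (hS k).1)) I (Nat.succ_ne_zero k)
      (hn (k + 1) ((le_max_right m n).trans (Nat.le_succ _))) hlt hZm (fun i t => enorm_ne_top)
      (fun i _ => hZle i) (fun i hi s hs => (hr i hi).2 s (le_trans ?_ hs)) hI2 (e := e) ?_
      (hS k).2.2.2.2.1
    · have h1 := ((hS k).2.2.2.2.2).trans hkey
      have h2 := heη.trans_le (min_le_left _ _)
      have h3 : 4 * E.extNorm e < 4 * (δ / 2 / 4) :=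
        ENNReal.mul_lt_mul_right (by simp) (by simp) h2
      rw [ENNReal.mul_div_cancel (by simp) (by simp)] at h3
      exact absurd h1 (not_le.2 h3)
    · calc r i ≤ ∑ i ∈ I, r i := Finset.single_le_sum (f := r) (fun _ _ => zero_le) hi
        _ ≤ m := hm.le
        _ ≤ k := hmk
        _ ≤ _ := (hS k).2.1
    · filter_upwards [hae, hyB] with t ht htB htq
      calc ∑ i ∈ I, l i * Z i t ≤ ∑ i, l i * Z i t :=
            Finset.sum_le_sum_of_subset (Finset.subset_univ I)
        _ ≤ ‖y t‖ₑ + e t := ht.2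
        _ ≤ v k + e t := by
          rw [htB]
          gcongr
          exact hbound k t htq
  · have hZI : ∀ i ∈ Iᶜ, ∀ᵐ t ∂semiAxis, Z i t ≤ c := by
      intro i hi
      rcases eventually_excess_eq_or_le_asymptote hx1 (hz i) with ⟨r, hr, h⟩ | h
      · refine absurd (Finset.mem_filter.2 ⟨Finset.mem_univ i, r, hr, fun s hs => ?_⟩)
          (Finset.mem_compl.1 hi)
        rw [hf, excess_rearrangement]
        exact h s hs
      · exact h
    have hτsub : Ioc 0 τ ⊆ Ioi (0 : ℝ) := fun t ht => ht.1
    -- With weight over 1/2 on functions bounded by c, the combination integrates to at most X/2 +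
    -- cτ ≤ 3X/4, so the error has to supply the rest.
    have h1 := setLIntegral_le_of_convex_combination I hZm (A := Ioc 0 τ) hτsub
      (hae.mono fun t ht => ht.1) (K := X τ) (M := c * ENNReal.ofReal τ) (fun i _ => by
        simpa using setLIntegral_Ioc_tsub_le hfa (hZle i) hτ0.le 0) (not_le.1 hI2).le (by
        calc ∑ i ∈ Iᶜ, l i * ∫⁻ t in Ioc 0 τ, Z i t
            ≤ ∑ i ∈ Iᶜ, l i * (c * ENNReal.ofReal τ) := by
              refine Finset.sum_le_sum fun i hi => mul_le_mul' le_rfl ?_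
              calc ∫⁻ t in Ioc 0 τ, Z i t ≤ ∫⁻ _ in Ioc 0 τ, c := lintegral_mono_ae
                    (ae_restrict_of_ae_restrict_of_subset hτsub (hZI i hi))
                _ = _ := by rw [setLIntegral_const, Real.volume_Ioc, sub_zero]
          _ = (∑ i ∈ Iᶜ, l i) * (c * ENNReal.ofReal τ) := (Finset.sum_mul _ _ _).symm
          _ ≤ 1 * (c * ENNReal.ofReal τ) := by
              gcongr
              rw [← hl1]
              exact Finset.sum_le_sum_of_subset (Finset.subset_univ _)
          _ = _ := one_mul _)
    rw [lintegral_congr_ae (ae_restrict_of_ae_restrict_of_subset hτsub hyB), hXint] at h1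
    have h2 := le_four_mul_of_le (hXt τ) hτX h1
    have h3 : 2 * d < ∫⁻ t in Ioc 0 τ, e t := by
      have h4 : 4 * (4 * d) ≤ 4 * ∫⁻ t in Ioc 0 τ, e t := by
        calc 4 * (4 * d) = X τ := by rw [hXd]; ring
          _ ≤ _ := h2
      rw [ENNReal.mul_le_mul_iff_right (by simp) (by simp)] at h4
      refine lt_of_lt_of_le ?_ h4
      exact ENNReal.mul_lt_mul_left hd0 hdt (by norm_num)
    exact absurd (mul_extNorm_unitIndicator_le hE hd0 hdt hτ1 h3)
      (not_le.2 (heη.trans_le (min_le_right _ _)))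

end BanachIdealLattice

/-! ### Necessity when the tail carries the failure. -/

theorem exists_lt_setLIntegral_Ioc {f : ℝ → ℝ≥0∞} (hf : Measurable f)
    {K : ℝ≥0∞} (h : K < ∫⁻ t in Ioi 0, f t) :
    ∃ q₀ : ℝ, ∀ q, q₀ ≤ q → K < ∫⁻ t in Ioc 0 q, f t := by
  have h1 : Tendsto (fun m : ℕ => ∫⁻ t in Ioi 0, (Iic (m : ℝ)).indicator f t) atTop
      (𝓝 (∫⁻ t in Ioi 0, f t)) := by
    refine lintegral_tendsto_of_tendsto_of_monotone
      (fun m => (hf.indicator measurableSet_Iic).aemeasurable)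
      (Eventually.of_forall fun t i j hij => indicator_le_indicator_of_subset
        (Iic_subset_Iic.2 (by exact_mod_cast hij)) (fun _ => zero_le) t)
      (Eventually.of_forall fun t => tendsto_const_nhds.congr' ?_)
    filter_upwards [eventually_ge_atTop ⌈t⌉₊] with m hm
    rw [indicator_of_mem (show t ∈ Iic (m : ℝ) from (Nat.le_ceil t).trans (by exact_mod_cast hm))]
  obtain ⟨m, hm⟩ := (h1.eventually (lt_mem_nhds h)).exists
  rw [lintegral_indicator measurableSet_Iic, Measure.restrict_restrict measurableSet_Iic] at hm
  refine ⟨m, fun q hq => hm.trans_le (lintegral_mono_set fun t ht => ⟨ht.2, ?_⟩)⟩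
  exact le_trans ht.1 hq

/-- The averages over `(p, q]` of a decreasing function vanishing at infinity tend to zero. -/
theorem exists_average_Ioc_le {f : ℝ → ℝ≥0∞} (hf : Antitone f)
    (hfin : ∀ s, s ≠ 0 → excess f s ≠ ∞) {p : ℝ} (hp : 0 < p) {ε : ℝ≥0∞} (hε0 : ε ≠ 0) :
    ∃ q₀ : ℝ, p < q₀ ∧ ∀ q, q₀ ≤ q →
      (volume (Ioc p q))⁻¹ * ∫⁻ t in Ioc p q, f t ≤ ε := by
  by_cases hε : ε = ∞
  · exact ⟨p + 1, by linarith, fun q _ => by simp [hε]⟩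
  obtain ⟨t, ht0, ht⟩ := exists_le_of_excess (s := ε / 2 / 2) (r := ε / 2)
    (hfin _ (by simp [hε0])) (ENNReal.half_lt_self (by simp [hε0]) (ENNReal.div_ne_top hε (by simp)))
  have hX : ∫⁻ u in Ioc 0 t, f u ≠ ∞ := setLIntegral_ne_top (s := ε) hε (hfin ε hε0)
    (fun t ht => ht.1) (by simp)
  set L := (∫⁻ u in Ioc 0 t, f u) / (ε / 2) with hL
  have hLt : L ≠ ∞ := ENNReal.div_ne_top hX (by simp [hε0])
  -- Past t the function is at most ε/2, and on an interval longer than L the mass before t adds at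
  -- most ε/2 to the average.
  refine ⟨p + L.toReal + 1, by linarith [ENNReal.toReal_nonneg (a := L)], fun q hq => ?_⟩
  have hpq : p < q := by linarith [ENNReal.toReal_nonneg (a := L)]
  have hv0 : volume (Ioc p q) ≠ 0 := by simpa using hpq
  have hvt : volume (Ioc p q) ≠ ∞ := by simp
  have hLv : L ≤ volume (Ioc p q) := by
    rw [Real.volume_Ioc, ← ENNReal.ofReal_toReal hLt]
    exact ENNReal.ofReal_le_ofReal (by linarith)
  have h1 : ∫⁻ u in Ioc p q, f u ≤ ε * volume (Ioc p q) := by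
    calc ∫⁻ u in Ioc p q, f u ≤ ∫⁻ u in Ioc p q, ((Ioc 0 t).indicator f u + ε / 2) := by
          refine setLIntegral_mono' measurableSet_Ioc fun u hu => ?_
          by_cases hut : u ≤ t
          · rw [indicator_of_mem (show u ∈ Ioc 0 t from ⟨hp.trans hu.1, hut⟩)]
            exact le_self_add
          · exact ((hf (not_le.1 hut).le).trans ht).trans le_add_self
      _ = (∫⁻ u in Ioc p q, (Ioc 0 t).indicator f u) + ε / 2 * volume (Ioc p q) := by
          rw [lintegral_add_right _ measurable_const, setLIntegral_const]
      _ ≤ (∫⁻ u in Ioc 0 t, f u) + ε / 2 * volume (Ioc p q) := by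
          refine add_le_add ?_ le_rfl
          rw [← lintegral_indicator (s := Ioc 0 t) measurableSet_Ioc]
          exact setLIntegral_le_lintegral _ _
      _ = L * (ε / 2) + ε / 2 * volume (Ioc p q) := by
          rw [hL, ENNReal.div_mul_cancel (by simp [hε0]) (ENNReal.div_ne_top hε (by simp))]
      _ ≤ volume (Ioc p q) * (ε / 2) + ε / 2 * volume (Ioc p q) := by gcongr
      _ = (ε / 2 + ε / 2) * volume (Ioc p q) := by ring
      _ = _ := by rw [ENNReal.add_halves]
  calc (volume (Ioc p q))⁻¹ * ∫⁻ t in Ioc p q, f t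
      ≤ (volume (Ioc p q))⁻¹ * (ε * volume (Ioc p q)) := by gcongr
    _ = ε * ((volume (Ioc p q))⁻¹ * volume (Ioc p q)) := by ring
    _ = ε := by rw [ENNReal.inv_mul_cancel hv0 hvt, mul_one]

namespace BanachIdealLattice

variable {E : BanachIdealLattice}

/-- If the tail of `x` is responsible for the failure of the dilation condition, the orbit is not
the closed convex hull of its extreme points. -/
theorem not_omegaPlus_subset_qPlus_of_tails (hE : E.IsFullySymmetric) (hF : E.IsFatouNorm)
    {x : L0} (hx : x ∈ E.carrier) (hc : asymptote (fun t => ‖x t‖ₑ) = 0)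
    (hint : ∫⁻ t in Ioi 0, rearrangement x t = ∞) {δ : ℝ≥0∞} (hδ0 : δ ≠ 0)
    (hδ : ∀ p : ℝ, 0 < p → ∀ n : ℕ, n ≠ 0 →
      δ ≤ E.extNorm (spread n ((Ioi p).indicator (rearrangement x)))) :
    ¬ OmegaPlus x ⊆ E.QPlus x := by
  intro hQ
  classical
  have hx1 := mem_L1AddLInfty hE hx
  set f := rearrangement x with hf
  have hfa : Antitone f := rearrangement_antitone x
  have hfm : Measurable f := measurable_rearrangement x
  have hfE : E.extNorm f ≠ ∞ := extNorm_rearrangement_ne_top hE hx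
  have hfin : ∀ s, s ≠ 0 → excess f s ≠ ∞ := fun s hs => by
    rw [hf, excess_rearrangement]
    exact excess_ne_top_of_asymptote_lt (hc ▸ pos_iff_ne_zero.2 hs)
  have him : ∀ p : ℝ, Measurable ((Ioi p).indicator f) := fun p => hfm.indicator measurableSet_Ioi
  have hiE : ∀ p : ℝ, E.extNorm ((Ioi p).indicator f) ≠ ∞ := fun p =>
    ne_top_of_le_ne_top hfE (extNorm_mono fun t => indicator_le_self _ _ t)
  have hδi : ∀ p : ℝ, 0 < p → δ ≤ E.extNorm ((Ioi p).indicator f) := fun p hp =>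
    (hδ p hp 1 one_ne_zero).trans (extNorm_spread_le hE (him p) (by simp))
  have hδt : δ ≠ ∞ := ne_top_of_le_ne_top (hiE 1) (hδi 1 one_pos)
  set X : ℝ → ℝ≥0∞ := fun q => ∫⁻ t in Ioc 0 q, f t with hX
  have hXt : ∀ q, X q ≠ ∞ := fun q =>
    setLIntegral_ne_top (s := 1) (by simp) (hfin 1 one_ne_zero) (fun t ht => ht.1) (by simp)
  have hstep : ∀ (k : ℕ) (p : ℝ), ∃ (σ : ℝ≥0∞) (q p' : ℝ), 0 < p → (σ ≠ 0 ∧ p < q ∧ q < p' ∧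
      (∀ t, q ≤ t → (k : ℝ≥0∞) ≤ X t) ∧
      2 * ((k + 1 : ℕ) : ℝ≥0∞) * ((volume (Ioc p q))⁻¹ * ∫⁻ t in Ioc p q, f t) ≤ σ ∧
      δ / 2 ≤ E.extNorm (spread (k + 1 : ℕ) ((Ioi p).indicator fun t => f t - σ)) ∧
      δ / 2 ≤ E.extNorm ((Ioc q p').indicator f)) := by
    intro k p
    by_cases hp : 0 < p
    swap
    · exact ⟨0, 0, 0, fun h => absurd h hp⟩
    have hlim : ∀ t, 0 < t → Tendsto (fun m : ℕ => (Ioi p).indicator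
        (fun t => f t - (0 + ((m : ℝ≥0∞) + 1)⁻¹)) t) atTop (𝓝 ((Ioi p).indicator f t)) := by
      intro t ht
      by_cases htp : t ∈ Ioi p
      · simp only [indicator_of_mem htp]
        have h1 := ENNReal.Tendsto.sub (tendsto_const_nhds (x := f t)) (tendsto_add_inv_nat 0)
          (Or.inr ENNReal.zero_ne_top)
        simpa using h1
      · simp only [indicator_of_notMem htp]
        exact tendsto_const_nhds
    obtain ⟨m, hm⟩ := exists_lt_extNorm_spread hE hF
      (e := fun m : ℕ => (Ioi p).indicator fun t => f t - (0 + ((m : ℝ≥0∞) + 1)⁻¹))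
      (e' := (Ioi p).indicator f) (fun m => (hfm.sub_const _).indicator measurableSet_Ioi) (him p)
      (fun i j hij t => indicator_le_indicator (tsub_le_tsub_left
        (antitone_add_inv_nat 0 hij) _)) hlim (hiE p) (Nat.succ_ne_zero k)
      ((ENNReal.half_lt_self hδ0 hδt).trans_le (hδ p hp _ (Nat.succ_ne_zero k)))
    -- The Fatou property gives a positive level above which the tail keeps half of δ. The block is
    -- then extended until its average is below σ/(2(k + 1)) and the primitive of x* exceeds k; a
    -- second use of Fatou fixes the end of the unaveraged gap.
    set σ : ℝ≥0∞ := 0 + ((m : ℝ≥0∞) + 1)⁻¹ with hσ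
    have hσ0 : σ ≠ 0 := by simp [hσ]
    have h2k0 : 2 * ((k + 1 : ℕ) : ℝ≥0∞) ≠ 0 := by simp
    have h2kt : 2 * ((k + 1 : ℕ) : ℝ≥0∞) ≠ ∞ := ENNReal.mul_ne_top (by simp) (by simp)
    obtain ⟨q₁, hpq₁, hq₁⟩ := exists_average_Ioc_le hfa hfin hp
      (ε := σ / (2 * ((k + 1 : ℕ) : ℝ≥0∞))) (ENNReal.div_ne_zero.2 ⟨hσ0, h2kt⟩)
    obtain ⟨q₂, hq₂⟩ := exists_lt_setLIntegral_Ioc hfm (K := k) (by rw [hint]; simp)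
    set q := max q₁ q₂ with hq
    have hpq : p < q := hpq₁.trans_le (le_max_left _ _)
    obtain ⟨m', hm'⟩ := exists_lt_extNorm_of_isFatouNorm hF
      (e := fun m : ℕ => (Ioc q (q + (m + 1))).indicator f) (e' := (Ioi q).indicator f)
      (fun m => hfm.indicator measurableSet_Ioc) (him q)
      (fun i j hij t => indicator_le_indicator_of_subset
        (Ioc_subset_Ioc_right (by gcongr)) (fun _ => zero_le) t) (Eventually.of_forall fun t => by
        refine tendsto_const_nhds.congr' ?_
        filter_upwards [eventually_ge_atTop ⌈t - q⌉₊] with m hm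
        have h1 : t - q ≤ m := (Nat.le_ceil _).trans (by exact_mod_cast hm)
        by_cases htq : t ∈ Ioi q
        · rw [indicator_of_mem htq, indicator_of_mem]
          exact ⟨htq, by linarith⟩
        · rw [indicator_of_notMem htq, indicator_of_notMem fun h => htq h.1]) (hiE q)
      ((ENNReal.half_lt_self hδ0 hδt).trans_le (hδi q (hp.trans hpq)))
    refine ⟨σ, q, q + (m' + 1), fun _ => ⟨hσ0, hpq, ?_, fun t ht => ?_, ?_, hm.le, hm'.le⟩⟩
    · linarith [(Nat.cast_nonneg m' : (0 : ℝ) ≤ m')]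
    · exact (hq₂ t ((le_max_right _ _).trans ht)).le
    · calc 2 * ((k + 1 : ℕ) : ℝ≥0∞) * ((volume (Ioc p q))⁻¹ * ∫⁻ t in Ioc p q, f t)
          ≤ 2 * ((k + 1 : ℕ) : ℝ≥0∞) * (σ / (2 * ((k + 1 : ℕ) : ℝ≥0∞))) := by
            gcongr
            exact hq₁ q (le_max_left _ _)
        _ = σ := ENNReal.mul_div_cancel h2k0 h2kt
  choose σ Q P hstep using hstep
  set p : ℕ → ℝ := fun k => Nat.rec 1 (fun k p => P k p) k with hp
  have hps : ∀ k, p (k + 1) = P k (p k) := fun k => rfl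
  have hp0 : ∀ k, 0 < p k := by
    intro k
    induction k with
    | zero => exact one_pos
    | succ k ih => exact ih.trans ((hstep k (p k) ih).2.1.trans (hstep k (p k) ih).2.2.1)
  have hS := fun k => hstep k (p k) (hp0 k)
  set q : ℕ → ℝ := fun k => Q k (p k) with hq
  change ∀ k, σ k (p k) ≠ 0 ∧ p k < q k ∧ q k < p (k + 1) ∧ (∀ t, q k ≤ t → (k : ℝ≥0∞) ≤ X t) ∧
      2 * ((k + 1 : ℕ) : ℝ≥0∞) * ((volume (Ioc (p k) (q k)))⁻¹ * ∫⁻ t in Ioc (p k) (q k), f t)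
        ≤ σ k (p k) ∧
      δ / 2 ≤ E.extNorm (spread (k + 1 : ℕ) ((Ioi (p k)).indicator fun t => f t - σ k (p k))) ∧
      δ / 2 ≤ E.extNorm ((Ioc (q k) (p (k + 1))).indicator f) at hS
  have hpq : ∀ k, p k < q k := fun k => (hS k).2.1
  have hqp : ∀ k, q k < p (k + 1) := fun k => (hS k).2.2.1
  have hpm : Monotone p := monotone_nat_of_le_succ fun k => ((hpq k).trans (hqp k)).le
  set B : ℕ → Set ℝ := fun k => Ioc (p k) (q k) with hB
  have hBm : ∀ k, MeasurableSet (B k) := fun k => measurableSet_Ioc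
  have hB0 : ∀ k, B k ⊆ Ioi 0 := fun k t ht => (hp0 k).trans ht.1
  have hBd : Pairwise fun i j => Disjoint (B i) (B j) := fun i j hij =>
    (hpm.pairwise_disjoint_on_Ioc_succ hij).mono (Ioc_subset_Ioc_right (hqp i).le)
      (Ioc_subset_Ioc_right (hqp j).le)
  have hBv0 : ∀ k, volume (B k) ≠ 0 := fun k => by simpa [hB] using hpq k
  have hBv : ∀ k, volume (B k) ≠ ∞ := fun k => by simp [hB]
  obtain ⟨y, hy, hyB⟩ := exists_mem_omegaPlus_blockAverage hx1 hBm hB0 hBd hBv0 hBv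
  rw [← hf] at hyB
  set v : ℕ → ℝ≥0∞ := fun k => (volume (B k))⁻¹ * ∫⁻ t in B k, f t with hv
  have hfv : ∀ k, f (q k) ≤ v k := fun k =>
    le_inv_mul_setLIntegral (hBm k) (hBv0 k) (hBv k) le_rfl fun t ht => hfa ht.2
  have hbound : ∀ k t, p k < t → blockAverage B f t ≤ v k := by
    intro k t ht
    by_cases h : ∃ j, t ∈ B j
    · obtain ⟨j, hj⟩ := h
      rw [blockAverage_of_mem hBd hj]
      rcases lt_trichotomy j k with hjk | hjk | hjk
      · exact absurd (hj.2.trans ((hqp j).le.trans (hpm hjk))) (not_le.2 ht)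
      · subst hjk
        exact le_rfl
      · refine (inv_measure_mul_setLIntegral_le (hBm j) (hBv0 j) (hBv j) fun u hu => ?_).trans
          (hfv k)
        exact hfa ((hqp k).le.trans ((hpm hjk).trans hu.1.le))
    · push Not at h
      rw [blockAverage_of_notMem h]
      have : q k < t := by
        by_contra hcon
        exact h k ⟨ht, not_lt.1 hcon⟩
      exact (hfa this.le).trans (hfv k)
  -- Endpoints in a gap cut no block, so y and x* have the same primitive there.
  have hXint : ∀ k, ∀ t ∈ Icc (q k) (p (k + 1)), ∫⁻ u in Ioc 0 t, blockAverage B f u = X t := by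
    intro k t ht
    refine setLIntegral_blockAverage hBm hBd hfm hBv0 hBv fun j => ?_
    rcases le_or_gt j k with hjk | hjk
    · refine Or.inl fun u hu => ⟨(hp0 j).trans hu.1, hu.2.trans (le_trans ?_ ht.1)⟩
      rcases hjk.eq_or_lt with h | h
      · rw [h]
      · exact (hqp j).le.trans ((hpm h).trans (hpq k).le)
    · exact Or.inr (Set.disjoint_left.2 fun u hu hu' =>
        absurd (hu'.2.trans (ht.2.trans (hpm hjk))) (not_le.2 hu.1))
  have hδ8 : δ / 2 / 4 ≠ 0 := by simp [hδ0]
  obtain ⟨ι, hι, l, z, e, hz, hl0, hl1, heη, hae⟩ := exists_convex_combination (hQ hy) hδ8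
  have h4e : 4 * E.extNorm e < δ / 2 := by
    have h3 : 4 * E.extNorm e < 4 * (δ / 2 / 4) :=
      ENNReal.mul_lt_mul_right (by simp) (by simp) heη
    rwa [ENNReal.mul_div_cancel (by simp) (by simp)] at h3
  have hlt : ∀ i, l i ≠ ∞ := fun i => ne_top_of_le_ne_top ENNReal.one_ne_top
    (hl1 ▸ Finset.single_le_sum (f := l) (fun _ _ => zero_le) (Finset.mem_univ i))
  set Z : ι → ℝ → ℝ≥0∞ := fun i t => ‖z i t‖ₑ with hZ
  have hZm : ∀ i, Measurable (Z i) := fun i => measurable_enorm_L0 (z i)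
  have hZle : ∀ i s, excess (Z i) s ≤ excess f s := fun i s => by
    rw [hf, excess_rearrangement]
    exact ((mem_omegaPlus_iff hx1).1 (hz i).1).2 s
  set I : Finset ι := Finset.univ.filter fun i => ∀ s, s ≠ 0 → excess (Z i) s = excess f s with hI
  by_cases hI2 : 2⁻¹ ≤ ∑ i ∈ I, l i
  · obtain ⟨k, hk⟩ := exists_nat_forall_inv_le hl0
    refine absurd (((hS k).2.2.2.2.2.1).trans (extNorm_spread_le_four_mul hE hfa (hp0 k).le
      (v := v k) (hfin _ (hS k).1) I (Nat.succ_ne_zero k) (hk (k + 1) (Nat.le_succ k)) hlt hZm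
      (fun i t => enorm_ne_top) (fun i _ => hZle i) (fun i hi s hs =>
        (Finset.mem_filter.1 hi).2 s fun h0 => (hS k).1 (by simpa [h0] using hs)) hI2 (e := e) ?_
      (hS k).2.2.2.2.1)) (not_le.2 h4e)
    filter_upwards [hae, hyB] with t ht htB htq
    calc ∑ i ∈ I, l i * Z i t ≤ ∑ i, l i * Z i t :=
          Finset.sum_le_sum_of_subset (Finset.subset_univ I)
      _ ≤ ‖y t‖ₑ + e t := ht.2
      _ ≤ v k + e t := by
        rw [htB]
        gcongr
        exact hbound k t htq
  · have hZI : ∀ i ∈ Iᶜ, ∫⁻ t, Z i t ∂semiAxis ≠ ∞ := by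
      intro i hi
      rcases excess_eq_or_lintegral_ne_top hx1 (hz i) hc with h | h
      · refine absurd (Finset.mem_filter.2 ⟨Finset.mem_univ i, fun s hs => ?_⟩)
          (Finset.mem_compl.1 hi)
        rw [hf, excess_rearrangement]
        exact h s hs
      · exact h
    set M := ∑ i ∈ Iᶜ, l i * ∫⁻ t, Z i t ∂semiAxis with hM
    have hMt : M ≠ ∞ := ENNReal.sum_ne_top.2 fun i hi => ENNReal.mul_ne_top (hlt i) (hZI i hi)
    -- Past q_k the primitive of x* exceeds 4M, with M the total weighted integral of the integrable
    -- extreme points. On the gap it is then at most four times that of the error, which bounds the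
    -- norm of x* on the gap by 4‖e‖ < δ/2.
    obtain ⟨k, hk⟩ := ENNReal.exists_nat_gt (ENNReal.mul_ne_top (by simp : (4 : ℝ≥0∞) ≠ ∞) hMt)
    refine absurd (((hS k).2.2.2.2.2.2).trans (extNorm_indicator_Ioc_le hE hfa (e := e) (K := 4)
      (by simp) (by simp) ((hp0 k).trans (hpq k)).le fun t ht => ?_)) (not_le.2 h4e)
    have ht0 : 0 ≤ t := ((hp0 k).trans (hpq k)).le.trans ht.1
    have htsub : Ioc 0 t ⊆ Ioi (0 : ℝ) := fun u hu => hu.1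
    have h1 := setLIntegral_le_of_convex_combination I hZm (A := Ioc 0 t) htsub
      (hae.mono fun t ht => ht.1) (K := X t) (M := M) (fun i _ => by
        simpa using setLIntegral_Ioc_tsub_le hfa (hZle i) ht0 0) (not_le.1 hI2).le
      (Finset.sum_le_sum fun i _ => mul_le_mul' le_rfl (lintegral_mono_set htsub))
    rw [lintegral_congr_ae (ae_restrict_of_ae_restrict_of_subset htsub hyB), hXint k t ht] at h1
    exact le_four_mul_of_le (hXt t) (hk.le.trans ((hS k).2.2.2.1 t ht.1)) h1

end BanachIdealLattice

/-! ### The dilation functional vanishes if the orbit is generated by its extreme points -/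

namespace BanachIdealLattice

variable {E : BanachIdealLattice}

theorem extNorm_spread_le_add {n : ℕ} {e a b : ℝ → ℝ≥0∞}
    (h : ∀ t, 0 < t → e t ≤ a t + b t) (hn : n ≠ 0) :
    E.extNorm (spread n e) ≤ E.extNorm (spread n a) + E.extNorm (spread n b) := by
  refine (extNorm_mono_ae ?_).trans (extNorm_add_le _ _)
  filter_upwards [ae_restrict_mem measurableSet_Ioi] with t ht
  simp only [spread, stretch]
  rw [← mul_add]
  gcongr
  exact h _ (div_pos ht (Nat.cast_pos.2 (Nat.pos_of_ne_zero hn)))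

/-- A bounded function whose dilations are not small vanishes at infinity, and its tails are not
small either. -/
theorem asymptote_eq_zero_of_le_extNorm_spread (hE : E.IsFullySymmetric) {x : L0}
    (hx : x ∈ E.carrier) {σ δ : ℝ≥0∞} (hσ : σ ≠ ∞) (hδ0 : δ ≠ 0)
    (hδ : ∀ n : ℕ, n ≠ 0 → δ ≤ E.extNorm (spread n fun t => min (rearrangement x t) σ)) :
    asymptote (fun t => ‖x t‖ₑ) = 0 := by
  by_contra hc0
  have hcE := extNorm_const_ne_top hE hx
  obtain ⟨s0, hs0, hs0'⟩ := exists_excess_ne_top (mem_L1AddLInfty hE hx)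
  have hcfin := asymptote_ne_top hs0 hs0'
  set c := asymptote fun t => ‖x t‖ₑ with hc
  -- The normalized dilation of a function bounded by σ is bounded by σ/n, and for c ≠ 0 constants
  -- have finite norm.
  have hbound : ∀ n : ℕ, n ≠ 0 → δ ≤ (n : ℝ≥0∞)⁻¹ * (σ * (c⁻¹ * E.extNorm fun _ => c)) := by
    intro n hn
    have hσ0 : σ ≠ 0 := by
      rintro rfl
      refine hδ0 (le_antisymm ((hδ n hn).trans ?_) zero_le)
      exact (extNorm_mono fun t => by simp [spread, stretch]).trans extNorm_zero.le
    refine (hδ n hn).trans ?_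
    rw [← extNorm_const_mul (ENNReal.inv_ne_zero.2 hcfin) (ENNReal.inv_ne_top.2 hc0),
      ← extNorm_const_mul hσ0 hσ, ← extNorm_const_mul (by simp)
        (ENNReal.inv_ne_top.2 (Nat.cast_ne_zero.2 hn))]
    refine extNorm_mono fun t => ?_
    rw [ENNReal.inv_mul_cancel hc0 hcfin, mul_one]
    simp only [spread, stretch, ENNReal.ofReal_natCast]
    gcongr
    exact min_le_right _ _
  have hlim := ENNReal.Tendsto.mul_const ENNReal.tendsto_inv_nat_nhds_zero
    (Or.inr (ENNReal.mul_ne_top hσ (ENNReal.mul_ne_top (ENNReal.inv_ne_top.2 hc0) hcE)) :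
      (0 : ℝ≥0∞) ≠ 0 ∨ σ * (c⁻¹ * E.extNorm fun _ => c) ≠ ∞)
  rw [zero_mul] at hlim
  obtain ⟨n, hn, hn0⟩ := ((hlim.eventually (gt_mem_nhds (pos_iff_ne_zero.2 hδ0))).and
    (eventually_ne_atTop 0)).exists
  exact absurd (hbound n hn0) (not_le.2 hn)

/-- The head on (0, p] is bounded with bounded support, so its normalized dilations fade because E ⊄
L₁. The tail keeps half of δ for a large parameter, hence for every smaller one by monotonicity. -/
theorem half_le_extNorm_spread_indicator (hE : E.IsFullySymmetric)
    (hL1 : ¬ ((E.carrier : Set L0) ⊆ L1)) {x : L0} {σ δ : ℝ≥0∞} (hσ : σ ≠ ∞) (hδ0 : δ ≠ 0)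
    (hδt : δ ≠ ∞)
    (hδ : ∀ n : ℕ, n ≠ 0 → δ ≤ E.extNorm (spread n fun t => min (rearrangement x t) σ)) (p : ℝ)
    {n : ℕ} (hn : n ≠ 0) :
    δ / 2 ≤ E.extNorm (spread n ((Ioi p).indicator (rearrangement x))) := by
  have hm : Measurable ((Ioi p).indicator (rearrangement x)) :=
    (measurable_rearrangement x).indicator measurableSet_Ioi
  have hhm : Measurable ((Ioc 0 p).indicator fun _ : ℝ => σ) :=
    measurable_const.indicator measurableSet_Ioc
  obtain ⟨n', hn', h'⟩ := exists_extNorm_spread_le hE hL1 hhm (by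
      rw [lintegral_indicator_const measurableSet_Ioc, Measure.restrict_apply measurableSet_Ioc]
      exact ENNReal.mul_ne_top hσ (ne_top_of_le_ne_top (by simp)
        (measure_mono (t := Ioc 0 p) inter_subset_left))) hσ
    (fun t => indicator_le_self' (fun _ _ => zero_le) t) (ε := δ / 2) (by simp [hδ0])
  set m := max n n' with hmdef
  have hm0 : m ≠ 0 := (lt_of_lt_of_le (Nat.pos_of_ne_zero hn) (le_max_left _ _)).ne'
  have h1 : δ ≤ E.extNorm (spread m ((Ioc 0 p).indicator fun _ : ℝ => σ))
      + E.extNorm (spread m ((Ioi p).indicator (rearrangement x))) := by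
    refine (hδ m hm0).trans (extNorm_spread_le_add (fun t ht => ?_) hm0)
    by_cases htp : t ≤ p
    · rw [indicator_of_mem (show t ∈ Ioc 0 p from ⟨ht, htp⟩)]
      exact (min_le_right _ _).trans le_self_add
    · rw [indicator_of_mem (show t ∈ Ioi p from not_le.1 htp)]
      exact (min_le_left _ _).trans le_add_self
  have h2 : E.extNorm (spread m ((Ioc 0 p).indicator fun _ : ℝ => σ)) ≤ δ / 2 :=
    (extNorm_spread_antitone hE hhm (Nat.cast_pos.2 (Nat.pos_of_ne_zero hn'))
      (by exact_mod_cast le_max_right n n')).trans h'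
  have h3 : E.extNorm (spread m ((Ioi p).indicator (rearrangement x)))
      ≤ E.extNorm (spread n ((Ioi p).indicator (rearrangement x))) :=
    extNorm_spread_antitone hE hm (Nat.cast_pos.2 (Nat.pos_of_ne_zero hn))
      (by exact_mod_cast le_max_left n n')
  have h4 : δ / 2 + δ / 2 ≤ δ / 2 + E.extNorm (spread n ((Ioi p).indicator (rearrangement x))) := by
    rw [ENNReal.add_halves]
    exact h1.trans (add_le_add h2 h3)
  exact (ENNReal.add_le_add_iff_left (ENNReal.div_ne_top hδt (by simp))).1 h4

theorem dilationFunctionalEq_zero_of_omegaPlus_subset (hE : E.IsFullySymmetric)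
    (hL1 : ¬ ((E.carrier : Set L0) ⊆ L1)) (hF : E.IsFatouNorm) {x : L0} (hx : x ∈ E.carrier)
    (h : OmegaPlus x ⊆ E.QPlus x) : E.DilationFunctionalEq x 0 := by
  rw [dilationFunctionalEq_zero_iff hE hx]
  by_contra hcon
  set f := rearrangement x with hf
  have hfm : Measurable f := measurable_rearrangement x
  have hpos : ∀ {n : ℕ}, n ≠ 0 → (0 : ℝ) < n := fun hn => Nat.cast_pos.2 (Nat.pos_of_ne_zero hn)
  obtain ⟨δ, hδ0, hδ⟩ : ∃ δ : ℝ≥0∞, δ ≠ 0 ∧ ∀ n : ℕ, n ≠ 0 → δ ≤ E.extNorm (spread n f) := by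
    rw [ENNReal.tendsto_atTop_zero] at hcon
    push Not at hcon
    obtain ⟨δ, hδ0, h1⟩ := hcon
    refine ⟨δ, hδ0.ne', fun n hn => ?_⟩
    obtain ⟨m, hm, h2⟩ := h1 n
    exact h2.le.trans (extNorm_spread_antitone hE hfm (hpos hn) (by exact_mod_cast hm))
  have hδt : δ ≠ ∞ := ne_top_of_le_ne_top (extNorm_rearrangement_ne_top hE hx)
    ((hδ 1 one_ne_zero).trans (extNorm_spread_le hE hfm (by simp)))
  have hδ2 : δ / 2 ≠ 0 := by simp [hδ0]
  have hδ2t : δ / 2 ≠ ∞ := ENNReal.div_ne_top hδt (by simp)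
  -- Either the part above every level σ keeps half of δ, or for some σ the part min(x*, σ) does, by
  -- subadditivity and monotonicity in n.
  by_cases hcase : ∀ σ : ℝ≥0∞, σ ≠ ∞ → ∀ n : ℕ, n ≠ 0 →
      δ / 2 ≤ E.extNorm (spread n fun t => f t - σ)
  · exact not_omegaPlus_subset_qPlus_of_peaks hE hF hx hδ2 hcase h
  push Not at hcase
  obtain ⟨σ, hσ, n₀, hn₀, hlt⟩ := hcase
  have hmin : ∀ n : ℕ, n ≠ 0 → δ / 2 ≤ E.extNorm (spread n fun t => min (f t) σ) := by
    intro n hn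
    set m := max n n₀ with hm
    have hm0 : m ≠ 0 := (lt_of_lt_of_le (Nat.pos_of_ne_zero hn) (le_max_left _ _)).ne'
    have h1 : δ ≤ E.extNorm (spread m fun t => f t - σ)
        + E.extNorm (spread m fun t => min (f t) σ) :=
      (hδ m hm0).trans (extNorm_spread_le_add (fun t _ => tsub_add_min.ge) hm0)
    have h2 : E.extNorm (spread m fun t => f t - σ) ≤ δ / 2 :=
      (extNorm_spread_antitone hE (hfm.sub_const σ) (hpos hn₀)
        (by exact_mod_cast le_max_right n n₀)).trans hlt.le
    have h3 : E.extNorm (spread m fun t => min (f t) σ)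
        ≤ E.extNorm (spread n fun t => min (f t) σ) :=
      extNorm_spread_antitone hE (hfm.min measurable_const) (hpos hn)
        (by exact_mod_cast le_max_left n n₀)
    refine (ENNReal.add_le_add_iff_left hδ2t).1 ?_
    rw [ENNReal.add_halves]
    exact h1.trans (add_le_add h2 h3)
  have htail : ∀ (p : ℝ) (n : ℕ), n ≠ 0 →
      δ / 2 / 2 ≤ E.extNorm (spread n ((Ioi p).indicator f)) := fun p n hn =>
    half_le_extNorm_spread_indicator hE hL1 hσ hδ2 hδ2t hmin p hn
  have hc := asymptote_eq_zero_of_le_extNorm_spread hE hx hσ hδ2 hmin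
  have hδ4 : δ / 2 / 2 ≠ 0 := by simp [hδ0]
  have hδ4t : δ / 2 / 2 ≠ ∞ := ENNReal.div_ne_top hδ2t (by simp)
  refine not_omegaPlus_subset_qPlus_of_tails hE hF hx hc ?_ hδ4 (fun p _ => htail p) h
  -- If x* were integrable, its tail beyond 1 would be bounded and integrable, and its normalized
  -- dilations would become small.
  by_contra hint
  obtain ⟨n, hn, hle⟩ := exists_extNorm_spread_le hE hL1 (hfm.indicator measurableSet_Ioi)
    (ne_top_of_le_ne_top hint (lintegral_mono fun t => indicator_le_self (Ioi 1) f t))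
    (rearrangement_ne_top (hE.1.1 x hx) one_pos) (fun t => by
      by_cases ht : t ∈ Ioi (1 : ℝ)
      · rw [indicator_of_mem ht]
        exact rearrangement_antitone x (le_of_lt ht)
      · rw [indicator_of_notMem ht]
        exact zero_le) (ε := δ / 2 / 2 / 2) (by simp [hδ0])
  exact absurd ((htail 1 n hn).trans hle) (not_le.2 (ENNReal.half_lt_self hδ4 hδ4t))

end BanachIdealLattice

end SymmetricOrbit

theorem mainTheorem4 (E : SymmetricOrbit.BanachIdealLattice) (hE : E.IsFullySymmetric)
    (hL1 : ¬ ((E.carrier : Set SymmetricOrbit.L0) ⊆ SymmetricOrbit.L1))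
    (x : SymmetricOrbit.L0) (hx : x ∈ E.carrier) :
    (E.DilationFunctionalEq x 0 → SymmetricOrbit.OmegaPlus x = E.QPlus x) ∧
    (E.IsFatouNorm → SymmetricOrbit.OmegaPlus x = E.QPlus x → E.DilationFunctionalEq x 0) :=
  ⟨fun h => Set.Subset.antisymm
      (SymmetricOrbit.BanachIdealLattice.omegaPlus_subset_qPlus hE hx h)
      (SymmetricOrbit.BanachIdealLattice.qPlus_subset hE hx),
    fun hF h => SymmetricOrbit.BanachIdealLattice.dilationFunctionalEq_zero_of_omegaPlus_subset
      hE hL1 hF hx h.subset⟩
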